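/- **Setup.** Let $\mathfrak a$ be $\mathfrak o_{2n+1}$ ($n\ge1$), $\mathfrak{sp}_{2n}$ ($n\ge 1$) or $\mathfrak o_{2n}$ ($n\ge2$) over $\mathbb C$, and let $N=2n+1$ or $N=2n$ be the size of its matrices, whose rows and columns are indexed by $-n,\dots,n$ (the index $0$ is skipped if $N=2n$). Put $\theta_{ij}=1$ in the orthogonal case and $\theta_{ij}=\operatorname{sgn} i\cdot\operatorname{sgn} j$ in the symplectic case; $\kappa=N/2-1$ in the orthogonal case and $\kappa=N/2+1$ in the symplectic case. Let $\mathfrak a\subset\mathfrak{gl}_N$ be realized as the Lie algebra of matrices skew-adjoint for the form $\langle e_i,e_j\rangle=\varepsilon_i\delta_{i,-j}$ ($\varepsilon_i=1$, resp. $\varepsilon_i=\operatorname{sgn} i$); it is spanned by $F_{ij}=E_{ij}-\theta_{ij}E_{-j,-i}$. Let $\mathfrak a[x]=\mathfrak a\otimes\mathbb C[x]$. Let $P=\sum e_{ij}\otimes e_{ji}$, $Q=\sum\theta_{ij}\,e_{ij}\otimes e_{-i,-j}$ and $R(u)=1-\frac{P}{u}+\frac{Q}{u-\kappa}$. The extended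 Yangian $\mathrm X(\mathfrak a)$ is the associative unital algebra with generators $t_{ij}^{(r)}$, $-n\le i,j\le n$, $r\ge1$, and the defining relations $R(u-v)T_1(u)T_2(v)=T_2(v)T_1(u)R(u-v)$, where $T(u)=\sum e_{ij}\otimes t_{ij}(u)$ and $t_{ij}(u)=\delta_{ij}+\sum_{r\ge1}t_{ij}^{(r)}u^{-r}$. The Yangian $\mathrm Y(\mathfrak a)$ is the subalgebra of the elements of $\mathrm X(\mathfrak a)$ stable under all automorphisms $T(u)\mapsto f(u)T(u)$, $f(u)\in1+u^{-1}\mathbb C[[u^{-1}]]$. With $(e_{ij})^t=\theta_{ij}e_{-j,-i}$, the series $z(u)=1+z_1u^{-1}+\cdots$ is the one with $T^t(u+\kappa)T(u)=T(u)T^t(u+\kappa)=z(u)1$; $y(u)=1+y_1u^{-1}+\cdots$ is the unique series with $y(u)y(u+\kappa)=z(u)$; and $\tau_{ij}(u)=y(u)^{-1}t_{ij}(u)=\delta_{ij}+\sum_{r\ge1}\tau_{ij}^{(r)}u^{-r}$. Filter $\mathrm X(\mathfrak a)$ by $\deg t_{ij}^{(r)}=r-1$, give $\mathrm Y(\mathfrak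 a)$ the induced filtration, and let $\operatorname{gr}\mathrm Y(\mathfrak a)$ be the associated graded algebra. **Theorem 3.6 (with Corollary 3.7).** The matrices $T^t(u+\kappa)T(u)$ and $T(u)T^t(u+\kappa)$ are equal to one and the same scalar matrix $z(u)1$ (so that $z(u)$ is well defined), and each $\tau_{ij}^{(r)}$, $r\ge1$, lies in $\mathrm Y(\mathfrak a)$ and has degree at most $r-1$. Let $\bar\tau_{ij}^{(r)}$ be its image in the $(r-1)$-th component of $\operatorname{gr}\mathrm Y(\mathfrak a)$. Then: 1. The mapping $F_{ij}x^{r-1}\mapsto\bar\tau_{ij}^{(r)}$ ($-n\le i,j\le n$, $r\ge1$) defines an isomorphism of algebras $\mathrm U(\mathfrak a[x])\to\operatorname{gr}\mathrm Y(\mathfrak a)$. 2. Given any total ordering on the set of generators $\tau_{ij}^{(r)}$ with $r\ge1$ and $i+j>0$ in the orthogonal case, resp. $r\ge1$ and $i+j\ge0$ in the symplectic case, the ordered monomials in these generators form a basis of $\mathrm Y(\mathfrak a)$. -/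

import Mathlib

open scoped TensorProduct Kronecker DirectSum Matrix Polynomial PowerSeries

attribute [local instance 100] LieRing.ofAssociativeRing

noncomputable section

/-! ## The associated graded algebra of a filtered algebra -/

/-- An ascending algebra filtration `F 0 ≤ F 1 ≤ …` of a `k`-algebra `A` by subspaces
(with `F d = 0` for `d < 0`). -/
structure AlgFiltration (k A : Type*) [CommRing k] [Ring A] [Algebra k A] where
  toFun : ℕ → Submodule k A
  mono : Monotone toFun
  one_mem : (1 : A) ∈ toFun 0
  mul_mem : ∀ {i j : ℕ} {a b : A}, a ∈ toFun i → b ∈ toFun j → a * b ∈ toFun (i + j)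

namespace AlgFiltration

variable {k A : Type*} [CommRing k] [Ring A] [Algebra k A] (F : AlgFiltration k A)

/-- The previous step `F (d - 1)` of the filtration, with `F (-1) = 0`. -/
def below : ℕ → Submodule k A
  | 0 => ⊥
  | d + 1 => F.toFun d

/-- The homogeneous component `F d / F (d - 1)` of the associated graded algebra. -/
abbrev Piece (d : ℕ) : Type _ := F.toFun d ⧸ (F.below d).submoduleOf (F.toFun d)

/-- The image of an element of `F d` in the `d`-th component `F d / F (d - 1)`. -/
def symbol (d : ℕ) : F.toFun d →ₗ[k] F.Piece d := Submodule.mkQ _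

theorem symbol_surjective (d : ℕ) : Function.Surjective (F.symbol d) :=
  Submodule.mkQ_surjective _

theorem symbol_eq_zero {d : ℕ} {a : F.toFun d} (h : (a : A) ∈ F.below d) : F.symbol d a = 0 :=
  (Submodule.Quotient.mk_eq_zero _).2 h

theorem below_mul {i j : ℕ} {a b : A} (ha : a ∈ F.below i) (hb : b ∈ F.toFun j) :
    a * b ∈ F.below (i + j) := by
  cases i with
  | zero =>
    have : a = 0 := by simpa [below] using ha
    simp [this]
  | succ i =>
    rw [show i + 1 + j = (i + j) + 1 by omega]
    exact F.mul_mem (i := i) ha hb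

theorem mul_below {i j : ℕ} {a b : A} (ha : a ∈ F.toFun i) (hb : b ∈ F.below j) :
    a * b ∈ F.below (i + j) := by
  cases j with
  | zero =>
    have : b = 0 := by simpa [below] using hb
    simp [this]
  | succ j => exact F.mul_mem (j := j) ha hb

/-- Multiplication `F i × F j → F (i + j)` followed by the projection. -/
def preMul (i j : ℕ) : F.toFun i →ₗ[k] F.toFun j →ₗ[k] F.Piece (i + j) :=
  LinearMap.mk₂ k (fun a b => F.symbol (i + j) ⟨(a : A) * b, F.mul_mem a.2 b.2⟩)
    (fun a a' b => by rw [← map_add]; congr 1; ext; simp [add_mul])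
    (fun r a b => by rw [← map_smul]; congr 1; ext; simp)
    (fun a b b' => by rw [← map_add]; congr 1; ext; simp [mul_add])
    (fun r a b => by rw [← map_smul]; congr 1; ext; simp)

/-- The induced product `F i / F (i-1) × F j / F (j-1) → F (i+j) / F (i+j-1)`. -/
def gmul (i j : ℕ) : F.Piece i →ₗ[k] F.Piece j →ₗ[k] F.Piece (i + j) :=
  Submodule.liftQ _
    (LinearMap.flip (Submodule.liftQ _ (LinearMap.flip (F.preMul i j)) (by
      intro b hb
      ext a
      exact F.symbol_eq_zero (F.mul_below a.2 hb))))
    (by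
      intro a ha
      ext b
      exact F.symbol_eq_zero (F.below_mul ha b.2))

theorem gmul_symbol {i j : ℕ} (a : F.toFun i) (b : F.toFun j) :
    F.gmul i j (F.symbol i a) (F.symbol j b)
      = F.symbol (i + j) ⟨(a : A) * b, F.mul_mem a.2 b.2⟩ := rfl

theorem mk_symbol_eq {i j : ℕ} (h : i = j) {a : F.toFun i} {b : F.toFun j} (hab : (a : A) = b) :
    (GradedMonoid.mk i (F.symbol i a) : GradedMonoid F.Piece)
      = GradedMonoid.mk j (F.symbol j b) := by
  subst h
  rw [Subtype.ext hab]

instance : GradedMonoid.GOne F.Piece where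
  one := F.symbol 0 ⟨1, F.one_mem⟩

instance : GradedMonoid.GMul F.Piece where
  mul {i j} a b := F.gmul i j a b

instance : GradedMonoid.GMonoid F.Piece where
  one_mul := by
    rintro ⟨i, a⟩
    obtain ⟨a, rfl⟩ := F.symbol_surjective i a
    exact F.mk_symbol_eq (zero_add i) (one_mul _)
  mul_one := by
    rintro ⟨i, a⟩
    obtain ⟨a, rfl⟩ := F.symbol_surjective i a
    exact F.mk_symbol_eq (add_zero i) (mul_one _)
  mul_assoc := by
    rintro ⟨i, a⟩ ⟨j, b⟩ ⟨l, c⟩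
    obtain ⟨a, rfl⟩ := F.symbol_surjective i a
    obtain ⟨b, rfl⟩ := F.symbol_surjective j b
    obtain ⟨c, rfl⟩ := F.symbol_surjective l c
    exact F.mk_symbol_eq (add_assoc i j l) (mul_assoc _ _ _)

instance : DirectSum.GSemiring F.Piece where
  mul_zero _ := map_zero _
  zero_mul _ := LinearMap.map_zero₂ _ _
  mul_add _ _ _ := map_add _ _ _
  add_mul _ _ _ := LinearMap.map_add₂ _ _ _ _
  natCast m := m • F.symbol 0 ⟨1, F.one_mem⟩
  natCast_zero := zero_smul _ _
  natCast_succ _ := succ_nsmul _ _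

instance : DirectSum.GAlgebra k F.Piece where
  toFun := (LinearMap.toSpanSingleton k (F.Piece 0) (F.symbol 0 ⟨1, F.one_mem⟩)).toAddMonoidHom
  map_one := one_smul k (F.symbol 0 ⟨1, F.one_mem⟩)
  map_mul r s := by
    refine F.mk_symbol_eq (i := 0) (j := 0 + 0) rfl (a := (r * s) • ⟨1, F.one_mem⟩)
      (b := ⟨((r • ⟨1, F.one_mem⟩ : F.toFun 0) : A) * (s • ⟨1, F.one_mem⟩ : F.toFun 0), _⟩) ?_
    simp [mul_smul]
    rw [smul_comm]
  commutes := by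
    rintro r ⟨i, a⟩
    obtain ⟨a, rfl⟩ := F.symbol_surjective i a
    refine F.mk_symbol_eq (i := 0 + i) (j := i + 0) (by omega)
      (a := ⟨((r • ⟨1, F.one_mem⟩ : F.toFun 0) : A) * a, _⟩)
      (b := ⟨(a : A) * (r • ⟨1, F.one_mem⟩ : F.toFun 0), _⟩) ?_
    simp
  smul_def := by
    rintro r ⟨i, a⟩
    obtain ⟨a, rfl⟩ := F.symbol_surjective i a
    refine F.mk_symbol_eq (i := i) (j := 0 + i) (by omega)
      (a := r • a)
      (b := ⟨((r • ⟨1, F.one_mem⟩ : F.toFun 0) : A) * a, _⟩) ?_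
    simp

/-- The associated graded algebra `gr A = ⨁ d, F d / F (d - 1)`. -/
def Gr : Type _ := ⨁ d, F.Piece d

instance : Semiring F.Gr := inferInstanceAs (Semiring (⨁ d, F.Piece d))

instance : Algebra k F.Gr := inferInstanceAs (Algebra k (⨁ d, F.Piece d))

/-- The image of an element of `F d` in the `d`-th component of `gr A`, as an element of `gr A`. -/
def toGr (d : ℕ) (a : F.toFun d) : F.Gr := DirectSum.of F.Piece d (F.symbol d a)

/-- The filtration induced on a subalgebra. -/
def induced (B : Subalgebra k A) : AlgFiltration k B where
  toFun d := (F.toFun d).comap B.val.toLinearMap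
  mono _ _ h := Submodule.comap_mono (F.mono h)
  one_mem := F.one_mem
  mul_mem ha hb := F.mul_mem ha hb

end AlgFiltration

/-! ## Power series in `u⁻¹`

The variable `X` of `A⟦X⟧` stands for `u⁻¹`. -/

/-- The series `f (u + c)` re-expanded in `u⁻¹`:
as `(u + c)⁻¹ = u⁻¹ (1 + c u⁻¹)⁻¹`, the coefficient of `u⁻ᵐ` in `∑ f_r (u + c)⁻ʳ` is a sum over
`r ≤ m`. -/
def seriesShift {A : Type*} [Ring A] [Algebra ℂ A] (c : ℂ) (f : A⟦X⟧) : A⟦X⟧ :=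
  PowerSeries.mk fun m => ∑ r ∈ Finset.range (m + 1),
    PowerSeries.coeff m ((PowerSeries.X * (1 + PowerSeries.C c * PowerSeries.X)⁻¹) ^ r : ℂ⟦X⟧)
      • PowerSeries.coeff r f

/-- Successive approximations to the series `y` with `y (u) y (u + c) = z (u)`: the `k`-th one has
the terms of `y` up to `u⁻ᵏ`, and the next coefficient is obtained by solving
`z_{k+1} = 2 y_{k+1} + A_{k+1}(y_1, …, y_k)`. -/
def halfSeriesApprox {A : Type*} [Ring A] [Algebra ℂ A] (c : ℂ) (z : A⟦X⟧) : ℕ → A⟦X⟧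
  | 0 => 1
  | k + 1 => halfSeriesApprox c z k + PowerSeries.monomial (k + 1) ((1 / 2 : ℂ) •
      (PowerSeries.coeff (k + 1) z - PowerSeries.coeff (k + 1)
        (halfSeriesApprox c z k * seriesShift c (halfSeriesApprox c z k))))

/-- The series `y (u) = 1 + y₁ u⁻¹ + …` determined by `y (u) y (u + c) = z (u)`,
where `z (u)` has constant term `1`. -/
def halfSeries {A : Type*} [Ring A] [Algebra ℂ A] (c : ℂ) (z : A⟦X⟧) : A⟦X⟧ :=
  PowerSeries.mk fun m => PowerSeries.coeff m (halfSeriesApprox c z m)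

section HalfSeries

variable {A : Type*} [Ring A] [Algebra ℂ A] (c : ℂ)

theorem coeff_seriesShift (f : A⟦X⟧) (m : ℕ) :
    PowerSeries.coeff m (seriesShift c f) = (∑ r ∈ Finset.range m,
      PowerSeries.coeff m ((PowerSeries.X * (1 + PowerSeries.C c * PowerSeries.X)⁻¹) ^ r : ℂ⟦X⟧)
      • PowerSeries.coeff r f) + PowerSeries.coeff m f := by
  rw [seriesShift, PowerSeries.coeff_mk, Finset.sum_range_succ]
  congr 1
  rw [mul_pow, PowerSeries.coeff_X_pow_mul']
  simp

theorem coeff_zero_seriesShift (f : A⟦X⟧) :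
    PowerSeries.coeff 0 (seriesShift c f) = PowerSeries.coeff 0 f := by
  simp [coeff_seriesShift]

theorem coeff_seriesShift_congr {f g : A⟦X⟧} {m : ℕ}
    (h : ∀ r ≤ m, PowerSeries.coeff r f = PowerSeries.coeff r g) :
    PowerSeries.coeff m (seriesShift c f) = PowerSeries.coeff m (seriesShift c g) := by
  simp only [seriesShift, PowerSeries.coeff_mk]
  refine Finset.sum_congr rfl fun r hr => ?_
  rw [h r (by simpa [Nat.lt_succ_iff] using hr)]

/-- If `f` and `g` have constant term `1` and agree below `u⁻ᵐ` (where `m > 0`), then the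
coefficients of `f (u) f (u + c)` and `g (u) g (u + c)` at `u⁻ᵐ` differ by `2 (f_m - g_m)`. -/
theorem coeff_mul_seriesShift_sub {f g : A⟦X⟧} {m : ℕ} (hm : 0 < m)
    (hf : PowerSeries.coeff 0 f = 1) (hg : PowerSeries.coeff 0 g = 1)
    (h : ∀ r < m, PowerSeries.coeff r f = PowerSeries.coeff r g) :
    PowerSeries.coeff m (f * seriesShift c f) - PowerSeries.coeff m (g * seriesShift c g)
      = (2 : ℂ) • (PowerSeries.coeff m f - PowerSeries.coeff m g) := by
  obtain ⟨k, rfl⟩ : ∃ k, m = k + 1 := ⟨m - 1, by omega⟩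
  have hS : ∀ r < k + 1, PowerSeries.coeff r (seriesShift c f)
      = PowerSeries.coeff r (seriesShift c g) :=
    fun r hr => coeff_seriesShift_congr c fun s hs => h s (by omega)
  have h1 : PowerSeries.coeff (k + 1) (seriesShift c f)
      - PowerSeries.coeff (k + 1) (seriesShift c g)
      = PowerSeries.coeff (k + 1) f - PowerSeries.coeff (k + 1) g := by
    rw [coeff_seriesShift, coeff_seriesShift, add_sub_add_comm]
    rw [Finset.sum_congr rfl fun r hr => by rw [h r (Finset.mem_range.1 hr)]]
    simp
  rw [PowerSeries.coeff_mul, PowerSeries.coeff_mul,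
    Finset.Nat.sum_antidiagonal_succ, Finset.Nat.sum_antidiagonal_succ]
  cases k with
  | zero =>
    simp only [zero_add, Finset.Nat.antidiagonal_zero, Finset.sum_singleton, hf, hg, one_mul,
      coeff_zero_seriesShift, mul_one] at h1 ⊢
    rw [add_sub_add_comm, h1, two_smul]
  | succ k =>
    rw [Finset.Nat.sum_antidiagonal_succ', Finset.Nat.sum_antidiagonal_succ']
    simp only [hf, hg, one_mul, coeff_zero_seriesShift, mul_one]
    have h2 : ∀ x ∈ Finset.HasAntidiagonal.antidiagonal k,
        PowerSeries.coeff (x.1 + 1) f * PowerSeries.coeff (x.2 + 1) (seriesShift c f)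
          = PowerSeries.coeff (x.1 + 1) g * PowerSeries.coeff (x.2 + 1) (seriesShift c g) := by
      intro x hx
      have := Finset.HasAntidiagonal.mem_antidiagonal.1 hx
      rw [h _ (by omega), hS _ (by omega)]
    rw [Finset.sum_congr rfl h2, two_smul]
    nth_rewrite 1 [← h1]
    abel

theorem coeff_halfSeriesApprox_succ (z : A⟦X⟧) {k m : ℕ} (h : m ≤ k) :
    PowerSeries.coeff m (halfSeriesApprox c z (k + 1))
      = PowerSeries.coeff m (halfSeriesApprox c z k) := by
  rw [halfSeriesApprox, map_add, PowerSeries.coeff_monomial, if_neg (by omega), add_zero]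

theorem coeff_halfSeriesApprox (z : A⟦X⟧) {k m : ℕ} (h : m ≤ k) :
    PowerSeries.coeff m (halfSeriesApprox c z k) = PowerSeries.coeff m (halfSeries c z) := by
  induction k, h using Nat.le_induction with
  | base => simp [halfSeries]
  | succ k hk ih => rw [coeff_halfSeriesApprox_succ c z hk, ih]

theorem coeff_zero_halfSeries (z : A⟦X⟧) : PowerSeries.coeff 0 (halfSeries c z) = 1 := by
  simp [halfSeries, halfSeriesApprox]

theorem coeff_halfSeriesApprox_eq_zero (z : A⟦X⟧) {k m : ℕ} (h : k < m) :
    PowerSeries.coeff m (halfSeriesApprox c z k) = 0 := by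
  induction k with
  | zero => rw [halfSeriesApprox, PowerSeries.coeff_one, if_neg (by omega)]
  | succ k ih =>
    rw [halfSeriesApprox, map_add, PowerSeries.coeff_monomial, if_neg (by omega), ih (by omega),
      add_zero]

/-- The defining property of `halfSeries`. -/
theorem halfSeries_mul_seriesShift (z : A⟦X⟧) (hz : PowerSeries.coeff 0 z = 1) :
    halfSeries c z * seriesShift c (halfSeries c z) = z := by
  ext m
  cases m with
  | zero =>
    simp only [PowerSeries.coeff_mul, Finset.Nat.antidiagonal_zero, Finset.sum_singleton,
      coeff_zero_seriesShift, coeff_zero_halfSeries, hz, mul_one]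
  | succ k =>
    have h0 : PowerSeries.coeff 0 (halfSeriesApprox c z k) = 1 := by
      rw [coeff_halfSeriesApprox c z (Nat.zero_le k), coeff_zero_halfSeries]
    have key := coeff_mul_seriesShift_sub c (Nat.succ_pos k) (coeff_zero_halfSeries c z) h0
      (fun r hr => (coeff_halfSeriesApprox c z (by omega)).symm)
    have h1 : PowerSeries.coeff (k + 1) (halfSeries c z) = (1 / 2 : ℂ) •
        (PowerSeries.coeff (k + 1) z - PowerSeries.coeff (k + 1)
        (halfSeriesApprox c z k * seriesShift c (halfSeriesApprox c z k))) := by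
      rw [← coeff_halfSeriesApprox c z le_rfl, halfSeriesApprox, map_add,
        coeff_halfSeriesApprox_eq_zero c z (Nat.lt_succ_self k), zero_add,
        PowerSeries.coeff_monomial_same]
    rw [Nat.succ_eq_add_one, coeff_halfSeriesApprox_eq_zero c z (Nat.lt_succ_self k), sub_zero,
      h1, smul_smul] at key
    norm_num at key
    exact key

/-- `halfSeries` is the only series with its defining property. -/
theorem eq_halfSeries (z y : A⟦X⟧) (hz : PowerSeries.coeff 0 z = 1)
    (hy : PowerSeries.coeff 0 y = 1) (h : y * seriesShift c y = z) : y = halfSeries c z := by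
  ext m
  induction m using Nat.strong_induction_on with
  | _ m ih =>
    rcases Nat.eq_zero_or_pos m with rfl | hm
    · rw [hy, coeff_zero_halfSeries]
    · have := coeff_mul_seriesShift_sub c hm hy (coeff_zero_halfSeries c z) ih
      rw [h, halfSeries_mul_seriesShift c z hz, sub_self] at this
      have h2 := (smul_eq_zero.1 this.symm).resolve_left two_ne_zero
      exact sub_eq_zero.1 h2

end HalfSeries

/-! ## The classical Lie algebras of types `B`, `C`, `D` -/

/-- The three families `𝔬_{2n+1}`, `𝔰𝔭_{2n}`, `𝔬_{2n}`. -/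
inductive ClassicalFamily
  | B
  | C
  | D
  deriving DecidableEq

namespace ClassicalFamily

/-- The indices `-n, …, n`; the value `0` is skipped in types `C` and `D`. -/
def Idx (c : ClassicalFamily) (n : ℕ) : Type :=
  {i : ℤ // i ∈ (Finset.Icc (-(n : ℤ)) n).filter fun i => c = B ∨ i ≠ 0}

variable (c : ClassicalFamily) (n : ℕ)

instance : DecidableEq (Idx c n) := inferInstanceAs (DecidableEq (Subtype _))

instance : Fintype (Idx c n) :=
  inferInstanceAs (Fintype {i : ℤ // i ∈ (Finset.Icc (-(n : ℤ)) n).filter fun i => c = B ∨ i ≠ 0})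

variable {c n} in
/-- The index as an integer. -/
def Idx.val (i : Idx c n) : ℤ := Subtype.val i

instance : Neg (Idx c n) where
  neg i := ⟨-i.val, by
    have := i.2
    simp only [Finset.mem_filter, Finset.mem_Icc] at this ⊢
    simp only [Idx.val]
    refine ⟨by omega, ?_⟩
    rcases this.2 with h | h
    · exact Or.inl h
    · exact Or.inr (neg_ne_zero.2 h)⟩

variable {c n} in
theorem Idx.neg_neg (i : Idx c n) : - -i = i := Subtype.ext (_root_.neg_neg i.val)

variable {c n} in
/-- `ε_i = 1` in the orthogonal case and `ε_i = sgn i` in the symplectic case. -/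
def eps (i : Idx c n) : ℂ := if c = C then (Int.sign i.val : ℂ) else 1

variable {c n} in
/-- `θ_{ij} = 1` in the orthogonal case and `θ_{ij} = sgn i · sgn j` in the symplectic case. -/
def theta (i j : Idx c n) : ℂ := eps i * eps j

/-- The size `N` of the matrices. -/
def size : ℕ := if c = B then 2 * n + 1 else 2 * n

/-- `κ = N/2 - 1` in the orthogonal case and `κ = N/2 + 1` in the symplectic case. -/
def kappa : ℂ := if c = C then (size c n : ℂ) / 2 + 1 else (size c n : ℂ) / 2 - 1

/-- The matrix of the bilinear form `⟨e_i, e_j⟩ = ε_i δ_{i,-j}`, symmetric in the orthogonal case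
and alternating in the symplectic case. -/
def form : Matrix (Idx c n) (Idx c n) ℂ := Matrix.of fun i j => if j = -i then eps i else 0

/-- The Lie algebra `𝔞`, i.e. `𝔬_{2n+1}`, `𝔰𝔭_{2n}` or `𝔬_{2n}`: the matrices which are
skew-adjoint with respect to the form. -/
abbrev lieAlg : LieSubalgebra ℂ (Matrix (Idx c n) (Idx c n) ℂ) :=
  skewAdjointMatricesLieSubalgebra (form c n)

/-- The matrix `F_{ij} = E_{ij} - θ_{ij} E_{-j,-i}`. -/
def FMat (i j : Idx c n) : Matrix (Idx c n) (Idx c n) ℂ :=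
  Matrix.single i j 1 - theta i j • Matrix.single (-j) (-i) 1

variable {c n} in
theorem eps_mul_self (i : Idx c n) : eps i * eps i = 1 := by
  unfold eps
  split_ifs with h
  · have h0 : i.val ≠ 0 := by
      have := (Finset.mem_filter.1 i.2).2
      rcases this with h' | h'
      · rw [h] at h'
        cases h'
      · exact h'
    have : Int.sign i.val * Int.sign i.val = 1 := by
      rw [← Int.sign_mul, Int.sign_eq_one_iff_pos]
      exact mul_self_pos.2 h0
    exact_mod_cast this
  · simp

variable {c n} in
theorem eps_neg (i : Idx c n) : eps (-i) = if c = C then -eps i else eps i := by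
  have : (-i).val = -i.val := rfl
  unfold eps
  split_ifs with h
  · rw [this, Int.sign_neg]
    push_cast
    rfl
  · rfl

theorem FMat_mem (i j : Idx c n) : FMat c n i j ∈ lieAlg c n := by
  have h1 : theta i j * eps j = eps i := by
    rw [theta, mul_assoc, eps_mul_self, mul_one]
  have h2 : theta i j * eps (-j) = eps (-i) := by
    rw [eps_neg, eps_neg]
    split_ifs
    · rw [mul_neg, h1]
    · exact h1
  rw [mem_skewAdjointMatricesLieSubalgebra, mem_skewAdjointMatricesSubmodule]
  change (FMat c n i j)ᵀ * form c n = form c n * -FMat c n i j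
  have hneg : ∀ a b : Idx c n, a = -b ↔ b = -a := by
    intro a b
    constructor <;> (rintro rfl; exact (Idx.neg_neg _).symm)
  have hl : ∀ k l : Idx c n, (Matrix.single k l (1 : ℂ))ᵀ * form c n
      = eps k • Matrix.single l (-k) 1 := by
    intro k l
    ext a b
    rw [Matrix.transpose_single]
    by_cases h : a = l
    · subst h
      simp [form, Matrix.single_apply, eq_comm]
    · rw [Matrix.single_mul_apply_of_ne _ _ _ _ _ h]
      simp [Ne.symm h]
  have hr : ∀ k l : Idx c n, form c n * Matrix.single k l (1 : ℂ)
      = eps (-k) • Matrix.single (-k) l 1 := by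
    intro k l
    ext a b
    by_cases h : b = l
    · subst h
      by_cases h' : a = -k
      · subst h'
        simp [form, Idx.neg_neg]
      · simp [form, Ne.symm h', mt (hneg _ _).2 h']
    · rw [Matrix.mul_single_apply_of_ne _ _ _ _ _ h]
      simp [Ne.symm h]
  rw [FMat, Matrix.transpose_sub, Matrix.transpose_smul, sub_mul, neg_sub, mul_sub, smul_mul_assoc,
    mul_smul_comm, hl, hl, hr, hr, smul_smul, smul_smul, Idx.neg_neg, h1, h2]

/-- `F_{ij}` as an element of `𝔞`. -/
def F (i j : Idx c n) : lieAlg c n := ⟨FMat c n i j, FMat_mem c n i j⟩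

/-- The polynomial current Lie algebra `𝔞[x] = ℂ[x] ⊗ 𝔞`. -/
abbrev Current : Type := ℂ[X] ⊗[ℂ] lieAlg c n

/-! ## The extended Yangian -/

/-- The permutation operator `P = ∑ e_{ij} ⊗ e_{ji}`. -/
def opP : Matrix (Idx c n × Idx c n) (Idx c n × Idx c n) ℂ :=
  ∑ i : Idx c n, ∑ j : Idx c n, Matrix.single i j 1 ⊗ₖ Matrix.single j i 1

/-- The operator `Q = ∑ θ_{ij} e_{ij} ⊗ e_{-i,-j}`. -/
def opQ : Matrix (Idx c n × Idx c n) (Idx c n × Idx c n) ℂ :=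
  ∑ i : Idx c n, ∑ j : Idx c n,
    theta i j • (Matrix.single i j 1 ⊗ₖ Matrix.single (-i) (-j) 1)

section RTT

variable (A : Type*) [Ring A] [Algebra ℂ A]

/-- The variable `u⁻¹` of the algebra `A⟦u⁻¹⟧⟦v⁻¹⟧` of series in two commuting variables. -/
def uInv : A⟦X⟧⟦X⟧ := PowerSeries.C PowerSeries.X

/-- The variable `v⁻¹` of the algebra `A⟦u⁻¹⟧⟦v⁻¹⟧`. -/
def vInv : A⟦X⟧⟦X⟧ := PowerSeries.X

/-- The element `u⁻¹ v⁻¹ (u - v) = v⁻¹ - u⁻¹`. -/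
def den₁ : A⟦X⟧⟦X⟧ := vInv A - uInv A

/-- The element `u⁻¹ v⁻¹ (u - v - κ) = v⁻¹ - u⁻¹ - κ u⁻¹ v⁻¹`. -/
def den₂ : A⟦X⟧⟦X⟧ := vInv A - uInv A - kappa c n • (uInv A * vInv A)

/-- The `R`-matrix `R (u - v) = 1 - P / (u - v) + Q / (u - v - κ)` multiplied by
the central non-zero-divisor `u⁻² v⁻² (u - v) (u - v - κ)`. -/
def clearedR : Matrix (Idx c n × Idx c n) (Idx c n × Idx c n) A⟦X⟧⟦X⟧ :=
  (den₁ A * den₂ c n A) • (1 : Matrix (Idx c n × Idx c n) (Idx c n × Idx c n) A⟦X⟧⟦X⟧)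
    - (uInv A * vInv A * den₂ c n A) • (opP c n).map (algebraMap ℂ A⟦X⟧⟦X⟧)
    + (uInv A * vInv A * den₁ A) • (opQ c n).map (algebraMap ℂ A⟦X⟧⟦X⟧)

variable {A}

variable {c n} in
/-- `T₁ (u) = ∑ e_{ij} ⊗ 1 ⊗ t_{ij} (u)`. -/
def T₁ (T : Matrix (Idx c n) (Idx c n) A⟦X⟧) :
    Matrix (Idx c n × Idx c n) (Idx c n × Idx c n) A⟦X⟧⟦X⟧ :=
  T.map (PowerSeries.C (R := A⟦X⟧)) ⊗ₖ 1

variable {c n} in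
/-- `T₂ (v) = ∑ 1 ⊗ e_{ij} ⊗ t_{ij} (v)`. -/
def T₂ (T : Matrix (Idx c n) (Idx c n) A⟦X⟧) :
    Matrix (Idx c n × Idx c n) (Idx c n × Idx c n) A⟦X⟧⟦X⟧ :=
  1 ⊗ₖ T.map (PowerSeries.map (PowerSeries.C (R := A)))

variable {c n} in
/-- The left-hand side of the (cleared) relation `R (u - v) T₁ (u) T₂ (v) = T₂ (v) T₁ (u) R (u - v)`. -/
def rttLeft (T : Matrix (Idx c n) (Idx c n) A⟦X⟧) :
    Matrix (Idx c n × Idx c n) (Idx c n × Idx c n) A⟦X⟧⟦X⟧ :=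
  clearedR c n A * T₁ T * T₂ T

variable {c n} in
/-- The right-hand side of the (cleared) relation `R (u - v) T₁ (u) T₂ (v) = T₂ (v) T₁ (u) R (u - v)`. -/
def rttRight (T : Matrix (Idx c n) (Idx c n) A⟦X⟧) :
    Matrix (Idx c n × Idx c n) (Idx c n × Idx c n) A⟦X⟧⟦X⟧ :=
  T₂ T * T₁ T * clearedR c n A

end RTT

/-- The labels `(i, j, m)` of the generators `t_{ij}^{(m+1)}`, `m ≥ 0`. -/
abbrev GenIdx : Type := Idx c n × Idx c n × ℕ

/-- The free algebra on the symbols `t_{ij}^{(r)}`, `r ≥ 1`. -/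
abbrev FreeX : Type := FreeAlgebra ℂ (GenIdx c n)

variable {c n} in
/-- The matrix `T (u)` with entries `t_{ij} (u) = δ_{ij} + ∑_{r ≥ 1} t_{ij}^{(r)} u⁻ʳ` for given
`t_{ij}^{(r)}`. -/
def genMatrix {A : Type*} [Ring A] (t : GenIdx c n → A) : Matrix (Idx c n) (Idx c n) A⟦X⟧ :=
  Matrix.of fun i j => PowerSeries.mk fun
    | 0 => if i = j then 1 else 0
    | m + 1 => t (i, j, m)

/-- The defining relations of the extended Yangian: the coefficients at `u⁻ʳ v⁻ˢ` of the matrix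
entries of both sides of the `RTT`-relation are identified. -/
inductive RTTRel : FreeX c n → FreeX c n → Prop
  | mk (p q : Idx c n × Idx c n) (r s : ℕ) :
      RTTRel
        (PowerSeries.coeff r (PowerSeries.coeff s
          (rttLeft (genMatrix (FreeAlgebra.ι ℂ : GenIdx c n → FreeX c n)) p q)))
        (PowerSeries.coeff r (PowerSeries.coeff s
          (rttRight (genMatrix (FreeAlgebra.ι ℂ : GenIdx c n → FreeX c n)) p q)))

/-- The extended Yangian `X(𝔞)`. -/
def ExtYangian : Type := RingQuot (RTTRel c n)

instance : Ring (ExtYangian c n) := inferInstanceAs (Ring (RingQuot (RTTRel c n)))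

instance : Algebra ℂ (ExtYangian c n) := inferInstanceAs (Algebra ℂ (RingQuot (RTTRel c n)))

/-- The projection of the free algebra onto the extended Yangian. -/
def proj : FreeX c n →ₐ[ℂ] ExtYangian c n := RingQuot.mkAlgHom ℂ (RTTRel c n)

/-- The generator `t_{ij}^{(m+1)}` of `X(𝔞)` with label `(i, j, m)`. -/
def gen (g : GenIdx c n) : ExtYangian c n := proj c n (FreeAlgebra.ι ℂ g)

/-- The matrix `T (u)` over `X(𝔞)⟦u⁻¹⟧`. -/
def T : Matrix (Idx c n) (Idx c n) (ExtYangian c n)⟦X⟧ := genMatrix (gen c n)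

section Functoriality

variable {c n} {A B : Type*} [Ring A] [Algebra ℂ A] [Ring B] [Algebra ℂ B]

/-- The action of an algebra homomorphism on the coefficients of series in `u⁻¹`, `v⁻¹`. -/
abbrev map₂ (φ : A →ₐ[ℂ] B) : A⟦X⟧⟦X⟧ →+* B⟦X⟧⟦X⟧ :=
  PowerSeries.map (PowerSeries.map (φ : A →+* B))

theorem map₂_algebraMap (φ : A →ₐ[ℂ] B) (a : ℂ) :
    map₂ φ (algebraMap ℂ A⟦X⟧⟦X⟧ a) = algebraMap ℂ B⟦X⟧⟦X⟧ a := by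
  ext r s
  by_cases hr : r = 0 <;> by_cases hs : s = 0 <;>
    simp [PowerSeries.algebraMap_apply, PowerSeries.coeff_C, hr, hs]

theorem map₂_uInv (φ : A →ₐ[ℂ] B) : map₂ φ (uInv A) = uInv B := by
  simp [uInv]

theorem map₂_vInv (φ : A →ₐ[ℂ] B) : map₂ φ (vInv A) = vInv B := by
  simp [vInv]

theorem map₂_clearedR (φ : A →ₐ[ℂ] B) :
    (clearedR c n A).map (map₂ φ) = clearedR c n B := by
  have h1 : map₂ φ (den₁ A) = den₁ B := by
    rw [den₁, map_sub, map₂_uInv, map₂_vInv, den₁]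
  have h2 : map₂ φ (den₂ c n A) = den₂ c n B := by
    rw [den₂, map_sub, map_sub, Algebra.smul_def, map_mul, map_mul, map₂_uInv, map₂_vInv,
      map₂_algebraMap, den₂, Algebra.smul_def]
  ext1 p q
  simp only [clearedR, Matrix.map_apply, Matrix.sub_apply, Matrix.add_apply, Matrix.smul_apply,
    smul_eq_mul, map_sub, map_add, map_mul, h1, h2, map₂_uInv, map₂_vInv, map₂_algebraMap,
    Matrix.one_apply, apply_ite (map₂ φ), map_one, map_zero]

theorem map₂_T₁ (φ : A →ₐ[ℂ] B) (T : Matrix (Idx c n) (Idx c n) A⟦X⟧) :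
    (T₁ T).map (map₂ φ) = T₁ (T.map (PowerSeries.map (φ : A →+* B))) := by
  ext1 p q
  simp [T₁, Matrix.one_apply, apply_ite (map₂ φ)]

theorem map₂_T₂ (φ : A →ₐ[ℂ] B) (T : Matrix (Idx c n) (Idx c n) A⟦X⟧) :
    (T₂ T).map (map₂ φ) = T₂ (T.map (PowerSeries.map (φ : A →+* B))) := by
  ext1 p q
  simp only [T₂, Matrix.map_apply, Matrix.kroneckerMap_apply, Matrix.one_apply, map_mul,
    apply_ite (map₂ φ), map_one, map_zero]
  congr 1
  ext r s
  by_cases hs : s = 0 <;> simp [PowerSeries.coeff_C, hs]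

theorem map₂_rttLeft (φ : A →ₐ[ℂ] B) (T : Matrix (Idx c n) (Idx c n) A⟦X⟧) :
    (rttLeft T).map (map₂ φ) = rttLeft (T.map (PowerSeries.map (φ : A →+* B))) := by
  rw [rttLeft, Matrix.map_mul, Matrix.map_mul, map₂_clearedR, map₂_T₁, map₂_T₂, rttLeft]

theorem map₂_rttRight (φ : A →ₐ[ℂ] B) (T : Matrix (Idx c n) (Idx c n) A⟦X⟧) :
    (rttRight T).map (map₂ φ) = rttRight (T.map (PowerSeries.map (φ : A →+* B))) := by
  rw [rttRight, Matrix.map_mul, Matrix.map_mul, map₂_clearedR, map₂_T₁, map₂_T₂, rttRight]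

theorem map_genMatrix (φ : A →ₐ[ℂ] B) (t : GenIdx c n → A) :
    (genMatrix t).map (PowerSeries.map (φ : A →+* B)) = genMatrix fun g => φ (t g) := by
  ext i j r
  cases r <;> simp [genMatrix]

end Functoriality

/-- The `RTT`-relation holds in the extended Yangian. -/
theorem rtt_T : rttLeft (T c n) = rttRight (T c n) := by
  have hT : T c n = (genMatrix (FreeAlgebra.ι ℂ : GenIdx c n → FreeX c n)).map
      (PowerSeries.map (proj c n : FreeX c n →+* ExtYangian c n)) := by
    rw [map_genMatrix]
    rfl
  rw [hT, ← map₂_rttLeft, ← map₂_rttRight]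
  ext p q s r
  exact RingQuot.mkAlgHom_rel ℂ (RTTRel.mk (c := c) (n := n) p q r s)

variable {c n} in
/-- The universal property of `X(𝔞)`: a solution of the `RTT`-relation over `A` gives an algebra
homomorphism `X(𝔞) → A`. -/
def lift {A : Type*} [Ring A] [Algebra ℂ A] (t : GenIdx c n → A)
    (h : rttLeft (genMatrix t) = rttRight (genMatrix t)) : ExtYangian c n →ₐ[ℂ] A :=
  RingQuot.liftAlgHom ℂ ⟨FreeAlgebra.lift ℂ t, by
    have ht : genMatrix t = (genMatrix (FreeAlgebra.ι ℂ : GenIdx c n → FreeX c n)).map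
        (PowerSeries.map (FreeAlgebra.lift ℂ t : FreeX c n →+* A)) := by
      rw [map_genMatrix]
      simp
    rw [ht, ← map₂_rttLeft, ← map₂_rttRight] at h
    rintro _ _ ⟨p, q, r, s⟩
    have := congrArg (fun M => PowerSeries.coeff r (PowerSeries.coeff s (M p q))) h
    simpa using this⟩

variable {c n} in
theorem lift_gen {A : Type*} [Ring A] [Algebra ℂ A] (t : GenIdx c n → A)
    (h : rttLeft (genMatrix t) = rttRight (genMatrix t)) (g : GenIdx c n) :
    lift t h (gen c n g) = t g :=
  (RingQuot.liftAlgHom_mkAlgHom_apply ℂ _ _ _).trans (FreeAlgebra.lift_ι_apply t g)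

/-! ## The automorphisms `μ_f` and the Yangian -/

/-- The matrix `f (u) T (u)`. -/
def scaledT (f : ℂ⟦X⟧) : Matrix (Idx c n) (Idx c n) (ExtYangian c n)⟦X⟧ :=
  PowerSeries.map (algebraMap ℂ (ExtYangian c n)) f • T c n

theorem genMatrix_scaledT (f : ℂ⟦X⟧) (hf : PowerSeries.constantCoeff f = 1) :
    genMatrix (fun g : GenIdx c n => PowerSeries.coeff (g.2.2 + 1) (scaledT c n f g.1 g.2.1))
      = scaledT c n f := by
  ext i j r
  cases r with
  | zero =>
    have : PowerSeries.constantCoeff (PowerSeries.map (algebraMap ℂ (ExtYangian c n)) f) = 1 := by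
      rw [← PowerSeries.coeff_zero_eq_constantCoeff_apply, PowerSeries.coeff_map,
        PowerSeries.coeff_zero_eq_constantCoeff_apply, hf, map_one]
    simp [scaledT, genMatrix, T, this]
  | succ r => simp [genMatrix]

theorem commute_of_coeff {R : Type*} [Ring R] {f : R⟦X⟧}
    (hf : ∀ (m : ℕ) (x : R), Commute (PowerSeries.coeff m f) x) (g : R⟦X⟧) : Commute f g := by
  ext m
  rw [PowerSeries.coeff_mul, PowerSeries.coeff_mul, ← Finset.Nat.sum_antidiagonal_swap]
  exact Finset.sum_congr rfl fun x _ => hf _ _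

theorem mul_smul_of_commute {R ι : Type*} [Ring R] [Fintype ι] {a : R} (ha : ∀ x, Commute a x)
    (M N : Matrix ι ι R) : M * (a • N) = a • (M * N) := by
  ext p q
  simp only [Matrix.mul_apply, Matrix.smul_apply, smul_eq_mul, Finset.mul_sum]
  refine Finset.sum_congr rfl fun x _ => ?_
  rw [← mul_assoc, ← (ha (M p x)).eq, mul_assoc]

theorem rtt_scaledT (f : ℂ⟦X⟧) : rttLeft (scaledT c n f) = rttRight (scaledT c n f) := by
  set g : (ExtYangian c n)⟦X⟧ := PowerSeries.map (algebraMap ℂ (ExtYangian c n)) f with hg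
  have hc : ∀ (m : ℕ) (x : ExtYangian c n), Commute (PowerSeries.coeff m g) x := fun m x => by
    rw [hg, PowerSeries.coeff_map]
    exact Algebra.commutes _ _
  have hu : ∀ x, Commute (PowerSeries.C g : (ExtYangian c n)⟦X⟧⟦X⟧) x := by
    refine commute_of_coeff fun m => ?_
    rw [PowerSeries.coeff_C]
    split_ifs
    · exact commute_of_coeff hc
    · exact Commute.zero_left
  have hv : ∀ x, Commute (PowerSeries.map (PowerSeries.C (R := ExtYangian c n)) g) x := by
    refine commute_of_coeff fun m => commute_of_coeff fun m' => ?_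
    rw [PowerSeries.coeff_map, PowerSeries.coeff_C]
    split_ifs
    · exact hc m
    · exact Commute.zero_left
  have h₁ : T₁ (scaledT c n f) = (PowerSeries.C g : (ExtYangian c n)⟦X⟧⟦X⟧) • T₁ (T c n) := by
    ext1 p q
    simp [T₁, scaledT, mul_assoc, ← hg]
  have h₂ : T₂ (scaledT c n f)
      = PowerSeries.map (PowerSeries.C (R := ExtYangian c n)) g • T₂ (T c n) := by
    ext1 p q
    by_cases h : p.1 = q.1 <;> simp [T₂, scaledT, ← hg, Matrix.one_apply, h]
  have key := rtt_T c n
  rw [rttLeft, rttRight] at key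
  rw [rttLeft, rttRight, h₁, h₂, mul_smul_of_commute hu, mul_smul_of_commute hv,
    mul_smul_of_commute hu, smul_mul_assoc, key, smul_mul_assoc, smul_mul_assoc,
    smul_mul_assoc, smul_smul, smul_smul, (hu _).eq]

/-- The homomorphism `μ_f : T (u) ↦ f (u) T (u)`, for `f (u) ∈ 1 + u⁻¹ ℂ⟦u⁻¹⟧`. -/
def mu (f : ℂ⟦X⟧) (hf : PowerSeries.constantCoeff f = 1) : ExtYangian c n →ₐ[ℂ] ExtYangian c n :=
  lift (fun g => PowerSeries.coeff (g.2.2 + 1) (scaledT c n f g.1 g.2.1)) (by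
    rw [genMatrix_scaledT c n f hf]
    exact rtt_scaledT c n f)

/-- The Yangian `Y(𝔞)`: the subalgebra of `X(𝔞)` of the elements stable under all `μ_f`. -/
def yangian : Subalgebra ℂ (ExtYangian c n) :=
  ⨅ f : {f : ℂ⟦X⟧ // PowerSeries.constantCoeff f = 1},
    AlgHom.equalizer (mu c n f.1 f.2) (AlgHom.id ℂ (ExtYangian c n))

/-! ## The series `z (u)`, `y (u)`, `τ_{ij} (u)` -/

/-- The matrix `Tᵗ (u + κ)`, where `(e_{ij})ᵗ = θ_{ij} e_{-j,-i}`: its `(k, l)` entry is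
`θ_{kl} t_{-l,-k} (u + κ)`. -/
def TtShift : Matrix (Idx c n) (Idx c n) (ExtYangian c n)⟦X⟧ :=
  Matrix.of fun k l => theta k l • seriesShift (kappa c n) (T c n (-l) (-k))

/-- The series `z (u)`. The matrix `Tᵗ (u + κ) T (u)` is the scalar matrix `z (u) 1`, so that `z (u)`
is its normalized trace. -/
def z : (ExtYangian c n)⟦X⟧ := (size c n : ℂ)⁻¹ • (TtShift c n * T c n).trace

/-- The series `y (u)` with `y (u) y (u + κ) = z (u)`. -/
def y : (ExtYangian c n)⟦X⟧ := halfSeries (kappa c n) (z c n)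

/-- The series `τ_{ij} (u) = y (u)⁻¹ t_{ij} (u)`. -/
def tau (i j : Idx c n) : (ExtYangian c n)⟦X⟧ := PowerSeries.invOfUnit (y c n) 1 * T c n i j

/-- The coefficient `τ_{ij}^{(r)}` of `u⁻ʳ` in `τ_{ij} (u)`. -/
def tauCoeff (i j : Idx c n) (r : ℕ) : ExtYangian c n := PowerSeries.coeff r (tau c n i j)

/-! ## The filtrations -/

/-- The filtration of `X(𝔞)` with `deg t_{ij}^{(r)} = r - 1`. -/
def filtX : AlgFiltration ℂ (ExtYangian c n) where
  toFun d := Submodule.span ℂ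
    {x | ∃ l : List (GenIdx c n), (l.map fun g => g.2.2).sum ≤ d ∧ x = (l.map (gen c n)).prod}
  mono d e h := Submodule.span_mono fun x ⟨l, hl, hx⟩ => ⟨l, hl.trans h, hx⟩
  one_mem := Submodule.subset_span ⟨[], by simp, by simp⟩
  mul_mem {i j a b} ha hb := by
    have := Submodule.mul_mem_mul ha hb
    rw [Submodule.span_mul_span] at this
    refine Submodule.span_mono ?_ this
    rintro _ ⟨_, ⟨l, hl, rfl⟩, _, ⟨l', hl', rfl⟩, rfl⟩
    exact ⟨l ++ l', by simpa using add_le_add hl hl', by simp⟩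

/-- The induced filtration of `Y(𝔞)`. -/
def filtY : AlgFiltration ℂ (yangian c n) := (filtX c n).induced (yangian c n)

/-- The labels of the generators `τ_{ij}^{(m+1)}`, `m ≥ 0`, with `i + j > 0` in the orthogonal case
and `i + j ≥ 0` in the symplectic case. -/
structure PBWIdx where
  i : Idx c n
  j : Idx c n
  m : ℕ
  pos : if c = C then 0 ≤ i.val + j.val else 0 < i.val + j.val

end ClassicalFamily

end

set_option linter.unusedSectionVars false

noncomputable section

/-! ## Shifts and specializations of series -/

section Series

variable {A B : Type*} [Ring A] [Algebra ℂ A] [Ring B] [Algebra ℂ B]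

/-! The proof combines a scalar identity, an invariance argument, a computation of leading terms and
a supply of representations.

Scalars. Replace `u` by `u + κ` in the cleared `RTT`-relation and then put `v = u`. The factor `u -
v` kills every term except those with `Q`, and since `Q` is a multiple of a rank one projection,
what remains says that `Tᵗ(u+κ) T(u)` and `T(u) Tᵗ(u+κ)` are one and the same scalar matrix
(`IsRTT.contracted`, `IsRTT.exists_scalar`). Partial transposition exchanges `P` and `Q`; combined
with the unitarity of `R` it shows that `z(u)` is central (`IsRTT.commute_scalar`). Hence `y(u)⁻¹
T(u)` is again a solution. It does not change when `T(u)` is multiplied by a central series, so the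
`τ_{ij}^{(r)}` lie in the Yangian.

Generation. An element fixed by `μ_f` for all complex series `f` is fixed for the generic `f`, and
then the central series `y(u)⁻¹` may be substituted for `f`. So the homomorphism `T(u) ↦ y(u)⁻¹
T(u)` is the identity on the Yangian (`rho_of_mem`). It takes monomials in the `t_{ij}^{(r)}` to the
same monomials in the `τ_{ij}^{(r)}`, hence the latter span each step of the filtration
(`mem_span_tau`).

Relations. Modulo lower degree the `τ_{ij}^{(r)}` satisfy the symmetry and the commutation relations
of the `F_{ij} x^{r-1}` (`antisymm_mem`, `coeff_commutator_sub_mem`). This gives a homomorphism from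
`U(𝔞[x])` to the graded algebra, surjective by generation.

Independence. By the Yang–Baxter equation the `R`-matrix itself is a solution
(`vectorCleared_isRTT`), and products of commuting solutions are solutions. In a tensor product of
vector representations, with an extra polynomial variable recording the degree, the leading
coefficients of the `τ_{ij}^{(r)}` are those of `𝔞[x]` acting on a tensor product. Functionals that
pick one generator in each factor distinguish monomials up to rearrangement (`Separates.tensor`), so
the ordered monomials are independent modulo lower degree (`weight_ne_of_sum_mem`). Ordered
monomials span `U(𝔞[x])` for the elementary reason that commutators of generators are linear in
generators. A spanning family with independent images forces injectivity, so the
Poincaré–Birkhoff–Witt theorem for `U(𝔞[x])` is not needed. The basis of the Yangian follows by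
induction on the degree. -/

open Finset in
-- Substitution of `g` for the variable is multiplicative because `g ^ a * g ^ b = g ^ (a + b)`. As
-- `g` has no constant term, `g ^ r` contributes only to coefficients of index at least `r`, so
-- every sum can be extended to the common range up to `m`.
theorem sum_sum_shift_mul (m : ℕ) (f h : A⟦X⟧) (g : ℂ⟦X⟧) (hg : PowerSeries.X ∣ g) :
    ∑ r ∈ range (m + 1), PowerSeries.coeff m (g ^ r) • PowerSeries.coeff r (f * h) =
      ∑ x ∈ antidiagonal m,
        (∑ r ∈ range (x.1 + 1), PowerSeries.coeff x.1 (g ^ r) • PowerSeries.coeff r f) *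
        (∑ r ∈ range (x.2 + 1), PowerSeries.coeff x.2 (g ^ r) • PowerSeries.coeff r h) := by
  have hz : ∀ {i r : ℕ}, i < r → PowerSeries.coeff i (g ^ r) = 0 := fun {i r} hir =>
    PowerSeries.X_pow_dvd_iff.1 (pow_dvd_pow_of_dvd hg r) i hir
  have ext : ∀ (i : ℕ) (e : A⟦X⟧), i ≤ m →
      ∑ r ∈ range (i + 1), PowerSeries.coeff i (g ^ r) • PowerSeries.coeff r e =
        ∑ r ∈ range (m + 1), PowerSeries.coeff i (g ^ r) • PowerSeries.coeff r e := by
    intro i e hi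
    refine sum_subset (range_mono (by omega)) fun r _ hr => ?_
    rw [hz (by simpa using hr), zero_smul]
  have hR : ∀ x ∈ antidiagonal m,
      (∑ r ∈ range (x.1 + 1), PowerSeries.coeff x.1 (g ^ r) • PowerSeries.coeff r f) *
        (∑ r ∈ range (x.2 + 1), PowerSeries.coeff x.2 (g ^ r) • PowerSeries.coeff r h) =
      ∑ a ∈ range (m + 1), ∑ b ∈ range (m + 1),
        (PowerSeries.coeff x.1 (g ^ a) * PowerSeries.coeff x.2 (g ^ b)) •
          (PowerSeries.coeff a f * PowerSeries.coeff b h) := by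
    intro x hx
    have := mem_antidiagonal.1 hx
    rw [ext _ _ (by omega), ext _ _ (by omega), sum_mul_sum]
    simp only [smul_mul_smul_comm]
  rw [sum_congr rfl hR, sum_comm]
  have hR2 : ∀ a ∈ range (m + 1), ∑ x ∈ antidiagonal m, ∑ b ∈ range (m + 1),
        (PowerSeries.coeff x.1 (g ^ a) * PowerSeries.coeff x.2 (g ^ b)) •
          (PowerSeries.coeff a f * PowerSeries.coeff b h) =
      ∑ b ∈ range (m + 1), PowerSeries.coeff m (g ^ (a + b)) •
          (PowerSeries.coeff a f * PowerSeries.coeff b h) := by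
    intro a _
    rw [sum_comm]
    refine sum_congr rfl fun b _ => ?_
    rw [pow_add, PowerSeries.coeff_mul, sum_smul]
  rw [sum_congr rfl hR2]
  simp only [PowerSeries.coeff_mul, smul_sum]
  rw [sum_sigma', ← sum_product', ← sum_filter_add_sum_filter_not (range (m + 1) ×ˢ range (m + 1))
    (fun x => x.1 + x.2 ≤ m)]
  refine (Eq.trans ?_ (add_zero _).symm).trans (congrArg _ (Eq.symm (sum_eq_zero ?_)))
  · refine sum_nbij' (fun x => x.2) (fun x => ⟨x.1 + x.2, x⟩) ?_ ?_ ?_ ?_ ?_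
    · rintro ⟨r, a, b⟩ hx
      simp only [mem_sigma, mem_range, HasAntidiagonal.mem_antidiagonal, mem_filter,
        mem_product] at hx ⊢
      omega
    · rintro ⟨a, b⟩ hx
      simp only [mem_filter, mem_product, mem_range] at hx
      exact mem_sigma.2 ⟨mem_range.2 (Nat.lt_succ_of_le hx.2),
        HasAntidiagonal.mem_antidiagonal.2 rfl⟩
    · rintro ⟨r, a, b⟩ hx
      simp only [mem_sigma, mem_range, HasAntidiagonal.mem_antidiagonal] at hx
      obtain ⟨_, rfl⟩ := hx
      rfl
    · intros; rfl
    · rintro ⟨r, a, b⟩ hx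
      simp only [mem_sigma, mem_range, HasAntidiagonal.mem_antidiagonal] at hx
      obtain ⟨_, rfl⟩ := hx
      rfl
  · rintro ⟨a, b⟩ hx
    simp only [mem_filter] at hx
    rw [hz (by omega), zero_smul]

/-- The ring homomorphism `f (u) ↦ f (u + c)`. -/
def shiftHom (A : Type*) [Ring A] [Algebra ℂ A] (c : ℂ) : A⟦X⟧ →+* A⟦X⟧ where
  toFun := seriesShift c
  map_one' := by
    ext m
    rw [coeff_seriesShift]
    rcases Nat.eq_zero_or_pos m with rfl | hm
    · simp
    · rw [Finset.sum_eq_single_of_mem 0 (by simpa using hm)]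
      · simp [PowerSeries.coeff_one, hm.ne']
      · intro r _ hr
        simp [PowerSeries.coeff_one, hr]
  map_zero' := by ext m; simp [coeff_seriesShift]
  map_add' f g := by
    ext m
    simp only [seriesShift, PowerSeries.coeff_mk, map_add, smul_add, Finset.sum_add_distrib]
  map_mul' f g := by
    ext m
    rw [PowerSeries.coeff_mul]
    simp only [seriesShift, PowerSeries.coeff_mk]
    exact sum_sum_shift_mul m f g _ (dvd_mul_right _ _)

theorem shiftHom_apply (c : ℂ) (f : A⟦X⟧) : shiftHom A c f = seriesShift c f := rfl

theorem shiftHom_smul (c a : ℂ) (f : A⟦X⟧) : shiftHom A c (a • f) = a • shiftHom A c f := by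
  ext m
  simp only [shiftHom_apply, seriesShift, PowerSeries.coeff_mk, PowerSeries.coeff_smul,
    Finset.smul_sum, smul_comm a]

theorem map_seriesShift (c : ℂ) (φ : A →ₐ[ℂ] B) (f : A⟦X⟧) :
    PowerSeries.map (φ : A →+* B) (seriesShift c f)
      = seriesShift c (PowerSeries.map (φ : A →+* B) f) := by
  ext m
  simp [seriesShift]

/-- The series `1 + c u⁻¹`. -/
def shiftDen (A : Type*) [Ring A] [Algebra ℂ A] (c : ℂ) : A⟦X⟧ := 1 + c • PowerSeries.X

/-- `(u + c)⁻¹ (1 + c u⁻¹) = u⁻¹`. -/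
theorem shiftHom_X (c : ℂ) : shiftHom A c PowerSeries.X * shiftDen A c = PowerSeries.X := by
  have key : (PowerSeries.X * (1 + PowerSeries.C c * PowerSeries.X)⁻¹ : ℂ⟦X⟧)
      * (1 + PowerSeries.C c * PowerSeries.X) = PowerSeries.X := by
    rw [mul_assoc, PowerSeries.inv_mul_cancel _ (by simp), mul_one]
  have h1 : shiftHom A c PowerSeries.X = PowerSeries.map (algebraMap ℂ A)
      (PowerSeries.X * (1 + PowerSeries.C c * PowerSeries.X)⁻¹ : ℂ⟦X⟧) := by
    ext m
    rw [shiftHom_apply, seriesShift, PowerSeries.coeff_mk, PowerSeries.coeff_map]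
    rcases Nat.eq_zero_or_pos m with rfl | hm
    · simp
    · rw [Finset.sum_eq_single_of_mem 1 (by simpa using hm)]
      · simp [Algebra.algebraMap_eq_smul_one]
      · intro r _ hr
        simp [PowerSeries.coeff_X, hr]
  have h2 : shiftDen A c = PowerSeries.map (algebraMap ℂ A)
      (1 + PowerSeries.C c * PowerSeries.X) := by
    ext m
    simp only [shiftDen, map_add, map_one, map_mul, PowerSeries.map_C, PowerSeries.map_X,
      PowerSeries.coeff_C_mul]
    rw [PowerSeries.coeff_smul, Algebra.smul_def]
  rw [h1, h2, ← map_mul, key, PowerSeries.map_X]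

open Finset in
/-- The specialization `v = u` of a series in `u⁻¹`, `v⁻¹`. -/
def diagHom (A : Type*) [Ring A] : A⟦X⟧⟦X⟧ →+* A⟦X⟧ where
  toFun f := PowerSeries.mk fun m => ∑ x ∈ antidiagonal m,
    PowerSeries.coeff x.1 (PowerSeries.coeff x.2 f)
  map_zero' := by ext m; simp
  map_add' f g := by ext m; simp [sum_add_distrib]
  map_one' := by
    ext m
    rw [PowerSeries.coeff_mk, sum_eq_single (m, 0)]
    · simp
    · rintro ⟨a, b⟩ hx hne
      have : b ≠ 0 := by
        rintro rfl
        simp at hx hne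
        exact hne hx
      simp [PowerSeries.coeff_one, this]
    · simp
  map_mul' f g := by
    ext m
    simp only [PowerSeries.coeff_mul, PowerSeries.coeff_mk, map_sum, sum_mul_sum, sum_sigma']
    refine sum_nbij' (fun x => ⟨(x.2.2.1 + x.2.1.1, x.2.2.2 + x.2.1.2), (x.2.2.1, x.2.1.1),
        (x.2.2.2, x.2.1.2)⟩)
      (fun x => ⟨(x.2.1.1 + x.2.2.1, x.2.1.2 + x.2.2.2), (x.2.1.2, x.2.2.2),
        (x.2.1.1, x.2.2.1)⟩) ?_ ?_ ?_ ?_ ?_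
    · rintro ⟨⟨i, j⟩, ⟨b, b'⟩, a, a'⟩ hx
      simp only [mem_sigma, HasAntidiagonal.mem_antidiagonal] at hx ⊢
      exact ⟨by omega, by simp⟩
    · rintro ⟨⟨i, j⟩, ⟨b, b'⟩, a, a'⟩ hx
      simp only [mem_sigma, HasAntidiagonal.mem_antidiagonal] at hx ⊢
      exact ⟨by omega, by simp⟩
    · rintro ⟨⟨i, j⟩, ⟨b, b'⟩, a, a'⟩ hx
      simp only [mem_sigma, HasAntidiagonal.mem_antidiagonal] at hx
      obtain ⟨_, rfl, rfl⟩ := hx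
      rfl
    · rintro ⟨⟨i, j⟩, ⟨b, b'⟩, a, a'⟩ hx
      simp only [mem_sigma, HasAntidiagonal.mem_antidiagonal] at hx
      obtain ⟨_, rfl, rfl⟩ := hx
      rfl
    · intros; rfl

theorem coeff_diagHom (f : A⟦X⟧⟦X⟧) (m : ℕ) : PowerSeries.coeff m (diagHom A f) =
    ∑ x ∈ Finset.HasAntidiagonal.antidiagonal m, PowerSeries.coeff x.1 (PowerSeries.coeff x.2 f) := by
  simp [diagHom]

theorem diagHom_C (f : A⟦X⟧) : diagHom A (PowerSeries.C f) = f := by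
  ext m
  rw [coeff_diagHom, Finset.sum_eq_single (m, 0)]
  · simp
  · rintro ⟨a, b⟩ hx hne
    have : b ≠ 0 := by
      rintro rfl
      simp at hx hne
      exact hne hx
    simp [PowerSeries.coeff_C, this]
  · simp

theorem diagHom_map_C (f : A⟦X⟧) :
    diagHom A (PowerSeries.map (PowerSeries.C (R := A)) f) = f := by
  ext m
  rw [coeff_diagHom, Finset.sum_eq_single (0, m)]
  · simp
  · rintro ⟨a, b⟩ hx hne
    have : a ≠ 0 := by
      rintro rfl
      simp at hx hne
      exact hne hx
    simp [PowerSeries.coeff_C, this]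
  · simp

/-- A series with left regular constant term is left regular. -/
theorem mul_left_cancel_of_constantCoeff {R : Type*} [Ring R] {a : R⟦X⟧}
    (ha : ∀ x : R, PowerSeries.constantCoeff a * x = 0 → x = 0) {f : R⟦X⟧} (h : a * f = 0) :
    f = 0 := by
  ext m
  induction m using Nat.strong_induction_on with
  | _ m ih =>
    have := congrArg (PowerSeries.coeff m) h
    rw [PowerSeries.coeff_mul, Finset.sum_eq_single (0, m)] at this
    · exact ha _ (by simpa using this)
    · rintro ⟨i, j⟩ hx hne
      have hij := Finset.HasAntidiagonal.mem_antidiagonal.1 hx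
      have : i ≠ 0 := by
        rintro rfl
        simp at hij hne
        exact hne hij
      rw [ih j (by simp at hij; omega), map_zero, mul_zero]
    · simp

end Series

end

noncomputable section

namespace ClassicalFamily

variable {c : ClassicalFamily} {n : ℕ} {A B : Type*} [Ring A] [Algebra ℂ A] [Ring B] [Algebra ℂ B]

/-! ## The `RTT`-relation in components -/

theorem Idx.neg_eq_iff {i j : Idx c n} : -i = j ↔ i = -j :=
  ⟨fun h => by rw [← h, Idx.neg_neg], fun h => by rw [h, Idx.neg_neg]⟩

theorem theta_comm (i j : Idx c n) : theta i j = theta j i := mul_comm _ _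

theorem theta_self (i : Idx c n) : theta i i = 1 := eps_mul_self i

theorem theta_neg_neg (i j : Idx c n) : theta (-i) (-j) = theta i j := by
  unfold theta
  rw [eps_neg, eps_neg]
  split_ifs <;> ring

theorem theta_mul_theta (i j k : Idx c n) : theta i j * theta j k = theta i k := by
  unfold theta
  linear_combination eps i * eps k * eps_mul_self j

theorem theta_mul_theta_self (i j : Idx c n) : theta i j * theta i j = 1 := by
  nth_rewrite 2 [theta_comm]
  rw [theta_mul_theta, theta_self]

theorem theta_neg_left (i j : Idx c n) : theta (-i) j = theta i (-j) := by
  rw [← theta_neg_neg, Idx.neg_neg]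

theorem opP_apply (p q : Idx c n × Idx c n) :
    opP c n p q = if q.2 = p.1 ∧ q.1 = p.2 then 1 else 0 := by
  obtain ⟨i, k⟩ := p
  obtain ⟨m, l⟩ := q
  simp only [opP, Matrix.sum_apply, Matrix.kroneckerMap_apply, Matrix.single_apply]
  rw [Finset.sum_eq_single i, Finset.sum_eq_single m]
  · by_cases h1 : m = k <;> by_cases h2 : l = i <;> simp [h1, h2, eq_comm (a := i)]
  · intro b _ hb
    simp [hb]
  · simp
  · intro b _ hb
    simp [hb]
  · simp

theorem opQ_apply (p q : Idx c n × Idx c n) :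
    opQ c n p q = if p.2 = -p.1 ∧ q.2 = -q.1 then theta p.1 q.1 else 0 := by
  obtain ⟨i, k⟩ := p
  obtain ⟨m, l⟩ := q
  simp only [opQ, Matrix.sum_apply, Matrix.smul_apply, Matrix.kroneckerMap_apply,
    Matrix.single_apply]
  rw [Finset.sum_eq_single i, Finset.sum_eq_single m]
  · by_cases h1 : k = -i <;> by_cases h2 : l = -m <;> simp [h1, h2, eq_comm]
  · intro b _ hb
    simp [hb]
  · simp
  · intro b _ hb
    simp [hb]
  · simp

theorem commute_uInv (x : A⟦X⟧⟦X⟧) : Commute (uInv A) x := by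
  refine commute_of_coeff (fun m => ?_) x
  rw [uInv, PowerSeries.coeff_C]
  split_ifs
  · exact fun f => (PowerSeries.commute_X f).symm
  · exact fun f => Commute.zero_left f

theorem commute_vInv (x : A⟦X⟧⟦X⟧) : Commute (vInv A) x := (PowerSeries.commute_X x).symm

theorem commute_den₁ (x : A⟦X⟧⟦X⟧) : Commute (den₁ A) x :=
  (commute_vInv x).sub_left (commute_uInv x)

theorem commute_uvInv (x : A⟦X⟧⟦X⟧) : Commute (uInv A * vInv A) x :=
  (commute_uInv x).mul_left (commute_vInv x)

theorem commute_den₂ (x : A⟦X⟧⟦X⟧) : Commute (den₂ c n A) x :=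
  (commute_den₁ x).sub_left ((commute_uvInv x).smul_left _)

/-- `f (u)` as a series in `u⁻¹`, `v⁻¹`. -/
abbrev inU : A⟦X⟧ →+* A⟦X⟧⟦X⟧ := PowerSeries.C

/-- `f (v)` as a series in `u⁻¹`, `v⁻¹`. -/
abbrev inV : A⟦X⟧ →+* A⟦X⟧⟦X⟧ := PowerSeries.map PowerSeries.C

theorem T₁_apply (T : Matrix (Idx c n) (Idx c n) A⟦X⟧) (i k j l : Idx c n) :
    T₁ T (i, k) (j, l) = if k = l then inU (T i j) else 0 := by
  simp [T₁, Matrix.one_apply]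

theorem T₂_apply (T : Matrix (Idx c n) (Idx c n) A⟦X⟧) (i k j l : Idx c n) :
    T₂ T (i, k) (j, l) = if i = j then inV (T k l) else 0 := by
  simp [T₂, Matrix.one_apply]

theorem T₁_mul_T₂_apply (T T' : Matrix (Idx c n) (Idx c n) A⟦X⟧) (i k j l : Idx c n) :
    (T₁ T * T₂ T') (i, k) (j, l) = inU (T i j) * inV (T' k l) := by
  rw [Matrix.mul_apply, Fintype.sum_prod_type, Finset.sum_eq_single j, Finset.sum_eq_single k]
  · simp [T₁_apply, T₂_apply]
  · intro b _ hb
    simp [T₁_apply, hb.symm]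
  · simp
  · intro b _ hb
    simp [T₂_apply, hb]
  · simp

theorem T₂_mul_T₁_apply (T T' : Matrix (Idx c n) (Idx c n) A⟦X⟧) (i k j l : Idx c n) :
    (T₂ T * T₁ T') (i, k) (j, l) = inV (T k l) * inU (T' i j) := by
  rw [Matrix.mul_apply, Fintype.sum_prod_type, Finset.sum_eq_single i, Finset.sum_eq_single l]
  · simp [T₁_apply, T₂_apply]
  · intro b _ hb
    simp [T₁_apply, hb]
  · simp
  · intro b _ hb
    simp [T₂_apply, hb.symm]
  · simp

theorem opP_mul_apply (M : Matrix (Idx c n × Idx c n) (Idx c n × Idx c n) A⟦X⟧⟦X⟧)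
    (i k : Idx c n) (q : Idx c n × Idx c n) :
    ((opP c n).map (algebraMap ℂ A⟦X⟧⟦X⟧) * M) (i, k) q = M (k, i) q := by
  rw [Matrix.mul_apply, Finset.sum_eq_single (k, i)]
  · simp [opP_apply]
  · rintro ⟨a, b⟩ _ hb
    have : ¬ (b = i ∧ a = k) := fun h => hb (by rw [h.1, h.2])
    simp [opP_apply, this]
  · simp

theorem mul_opP_apply (M : Matrix (Idx c n × Idx c n) (Idx c n × Idx c n) A⟦X⟧⟦X⟧)
    (p : Idx c n × Idx c n) (j l : Idx c n) :
    (M * (opP c n).map (algebraMap ℂ A⟦X⟧⟦X⟧)) p (j, l) = M p (l, j) := by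
  rw [Matrix.mul_apply, Finset.sum_eq_single (l, j)]
  · simp [opP_apply]
  · rintro ⟨a, b⟩ _ hb
    have : ¬ (l = a ∧ j = b) := fun h => hb (by rw [h.1, h.2])
    simp [opP_apply, this]
  · simp

theorem opQ_mul_apply (M : Matrix (Idx c n × Idx c n) (Idx c n × Idx c n) A⟦X⟧⟦X⟧)
    (i k : Idx c n) (q : Idx c n × Idx c n) :
    ((opQ c n).map (algebraMap ℂ A⟦X⟧⟦X⟧) * M) (i, k) q =
      if k = -i then ∑ m, theta i m • M (m, -m) q else 0 := by
  rw [Matrix.mul_apply, Fintype.sum_prod_type]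
  split_ifs with h
  · refine Finset.sum_congr rfl fun m _ => ?_
    rw [Finset.sum_eq_single (-m)]
    · simp [opQ_apply, h, Algebra.smul_def]
    · intro b _ hb
      simp [opQ_apply, hb]
    · simp
  · refine Finset.sum_eq_zero fun m _ => Finset.sum_eq_zero fun b _ => ?_
    simp [opQ_apply, h]

theorem mul_opQ_apply (M : Matrix (Idx c n × Idx c n) (Idx c n × Idx c n) A⟦X⟧⟦X⟧)
    (p : Idx c n × Idx c n) (j l : Idx c n) :
    (M * (opQ c n).map (algebraMap ℂ A⟦X⟧⟦X⟧)) p (j, l) =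
      if l = -j then ∑ m, theta m j • M p (m, -m) else 0 := by
  rw [Matrix.mul_apply, Fintype.sum_prod_type]
  split_ifs with h
  · refine Finset.sum_congr rfl fun m _ => ?_
    rw [Finset.sum_eq_single (-m)]
    · simp [opQ_apply, h, Algebra.smul_def, (Algebra.commutes _ _ : _ * M p (m, -m) = _)]
    · intro b _ hb
      simp [opQ_apply, hb]
    · simp
  · refine Finset.sum_eq_zero fun m _ => Finset.sum_eq_zero fun b _ => ?_
    simp [opQ_apply, h]

/-- The matrix `T (u)` satisfies the `RTT`-relation. -/
def IsRTT (T : Matrix (Idx c n) (Idx c n) A⟦X⟧) : Prop := rttLeft T = rttRight T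

theorem rttLeft_apply (T : Matrix (Idx c n) (Idx c n) A⟦X⟧) (i k j l : Idx c n) :
    rttLeft T (i, k) (j, l) = den₁ A * den₂ c n A * (inU (T i j) * inV (T k l))
      - uInv A * vInv A * den₂ c n A * (inU (T k j) * inV (T i l))
      + uInv A * vInv A * den₁ A *
        if k = -i then ∑ m, theta i m • (inU (T m j) * inV (T (-m) l)) else 0 := by
  rw [rttLeft, mul_assoc, clearedR, add_mul, sub_mul, Matrix.add_apply, Matrix.sub_apply,
    smul_mul_assoc, smul_mul_assoc, smul_mul_assoc, one_mul, Matrix.smul_apply, Matrix.smul_apply,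
    Matrix.smul_apply, opP_mul_apply, opQ_mul_apply]
  simp only [T₁_mul_T₂_apply, smul_eq_mul]

theorem rttRight_apply (T : Matrix (Idx c n) (Idx c n) A⟦X⟧) (i k j l : Idx c n) :
    rttRight T (i, k) (j, l) = den₁ A * den₂ c n A * (inV (T k l) * inU (T i j))
      - uInv A * vInv A * den₂ c n A * (inV (T k j) * inU (T i l))
      + uInv A * vInv A * den₁ A *
        if l = -j then ∑ m, theta m j • (inV (T k (-m)) * inU (T i m)) else 0 := by
  rw [rttRight, clearedR, mul_add, mul_sub, Matrix.add_apply, Matrix.sub_apply,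
    mul_smul_of_commute fun x => (commute_den₁ x).mul_left (commute_den₂ x),
    mul_smul_of_commute fun x => (commute_uvInv x).mul_left (commute_den₂ x),
    mul_smul_of_commute fun x => (commute_uvInv x).mul_left (commute_den₁ x),
    mul_one, Matrix.smul_apply, Matrix.smul_apply,
    Matrix.smul_apply, mul_opP_apply, mul_opQ_apply]
  simp only [T₂_mul_T₁_apply, smul_eq_mul]

theorem isRTT_iff {T : Matrix (Idx c n) (Idx c n) A⟦X⟧} :
    IsRTT T ↔ ∀ i k j l, rttLeft T (i, k) (j, l) = rttRight T (i, k) (j, l) :=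
  ⟨fun h i k j l => by rw [h], fun h => by
    ext1 ⟨i, k⟩ ⟨j, l⟩
    exact h i k j l⟩

/-! ## Operations on solutions of the `RTT`-relation -/

theorem IsRTT.map {T : Matrix (Idx c n) (Idx c n) A⟦X⟧} (h : IsRTT T) (φ : A →ₐ[ℂ] B) :
    IsRTT (T.map (PowerSeries.map (φ : A →+* B))) := by
  rw [IsRTT, ← map₂_rttLeft, ← map₂_rttRight, h]

/-- The series `g` may have arbitrary central coefficients, not just complex ones. This is what
allows multiplication by `y(u)⁻¹` and by the generic series. -/
theorem IsRTT.smul {T : Matrix (Idx c n) (Idx c n) A⟦X⟧} (h : IsRTT T) {g : A⟦X⟧}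
    (hc : ∀ (m : ℕ) (x : A), Commute (PowerSeries.coeff m g) x) : IsRTT (g • T) := by
  have hu : ∀ x, Commute (PowerSeries.C g : A⟦X⟧⟦X⟧) x := by
    refine commute_of_coeff fun m => ?_
    rw [PowerSeries.coeff_C]
    split_ifs
    · exact commute_of_coeff hc
    · exact Commute.zero_left
  have hv : ∀ x, Commute (PowerSeries.map (PowerSeries.C (R := A)) g) x := by
    refine commute_of_coeff fun m => commute_of_coeff fun m' => ?_
    rw [PowerSeries.coeff_map, PowerSeries.coeff_C]
    split_ifs
    · exact hc m
    · exact Commute.zero_left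
  have h₁ : T₁ (g • T) = (PowerSeries.C g : A⟦X⟧⟦X⟧) • T₁ T := by
    ext1 ⟨i, k⟩ ⟨j, l⟩
    simp [T₁_apply]
  have h₂ : T₂ (g • T) = PowerSeries.map (PowerSeries.C (R := A)) g • T₂ T := by
    ext1 ⟨i, k⟩ ⟨j, l⟩
    simp [T₂_apply]
  rw [IsRTT, rttLeft, rttRight] at h
  rw [IsRTT, rttLeft, rttRight, h₁, h₂, mul_smul_of_commute hu, mul_smul_of_commute hv,
    mul_smul_of_commute hu, smul_mul_assoc, h, smul_mul_assoc, smul_mul_assoc,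
    smul_mul_assoc, smul_smul, smul_smul, (hu _).eq]

theorem commute_inU_inV {f g : A⟦X⟧}
    (h : ∀ r s, Commute (PowerSeries.coeff r f) (PowerSeries.coeff s g)) :
    Commute (inU f) (inV g) := by
  ext s r
  simp only [inU, inV, PowerSeries.coeff_C_mul, PowerSeries.coeff_mul_C, PowerSeries.coeff_map]
  exact h r s

theorem T₁_mul (T T' : Matrix (Idx c n) (Idx c n) A⟦X⟧) : T₁ (T * T') = T₁ T * T₁ T' := by
  ext1 ⟨i, k⟩ ⟨j, l⟩
  rw [Matrix.mul_apply, Fintype.sum_prod_type, Finset.sum_comm, Finset.sum_eq_single k]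
  · simp only [T₁_apply, Matrix.mul_apply, map_sum, map_mul]
    split_ifs <;> simp
  · intro b _ hb
    simp [T₁_apply, hb.symm]
  · simp

theorem T₂_mul (T T' : Matrix (Idx c n) (Idx c n) A⟦X⟧) : T₂ (T * T') = T₂ T * T₂ T' := by
  ext1 ⟨i, k⟩ ⟨j, l⟩
  rw [Matrix.mul_apply, Fintype.sum_prod_type, Finset.sum_eq_single i]
  · simp only [T₂_apply, Matrix.mul_apply, map_sum, map_mul]
    split_ifs <;> simp
  · intro b _ hb
    simp [T₂_apply, hb.symm]
  · simp

/-- The product of two solutions with commuting entries is a solution. -/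
theorem IsRTT.mul {T T' : Matrix (Idx c n) (Idx c n) A⟦X⟧} (h : IsRTT T) (h' : IsRTT T')
    (hc : ∀ i j k l r s, Commute (PowerSeries.coeff r (T i j)) (PowerSeries.coeff s (T' k l))) :
    IsRTT (T * T') := by
  have h12 : T₁ T' * T₂ T = T₂ T * T₁ T' := by
    ext1 ⟨i, k⟩ ⟨j, l⟩
    rw [T₁_mul_T₂_apply, T₂_mul_T₁_apply]
    exact commute_inU_inV fun r s => (hc _ _ _ _ _ _).symm
  have h21 : T₂ T' * T₁ T = T₁ T * T₂ T' := by
    ext1 ⟨i, k⟩ ⟨j, l⟩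
    rw [T₁_mul_T₂_apply, T₂_mul_T₁_apply]
    exact (commute_inU_inV fun r s => hc _ _ _ _ _ _).symm
  rw [IsRTT, rttLeft, rttRight] at h h'
  rw [IsRTT, rttLeft, rttRight, T₁_mul, T₂_mul]
  calc clearedR c n A * (T₁ T * T₁ T') * (T₂ T * T₂ T')
      = clearedR c n A * T₁ T * (T₁ T' * T₂ T) * T₂ T' := by noncomm_ring
    _ = clearedR c n A * T₁ T * T₂ T * T₁ T' * T₂ T' := by rw [h12]; noncomm_ring
    _ = T₂ T * T₁ T * (clearedR c n A * T₁ T' * T₂ T') := by rw [h]; noncomm_ring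
    _ = T₂ T * (T₁ T * T₂ T') * T₁ T' * clearedR c n A := by rw [h']; noncomm_ring
    _ = _ := by rw [← h21]; noncomm_ring

theorem isRTT_one : IsRTT (1 : Matrix (Idx c n) (Idx c n) A⟦X⟧) := by
  have h₁ : T₁ (1 : Matrix (Idx c n) (Idx c n) A⟦X⟧) = 1 := by
    rw [T₁, Matrix.map_one _ (map_zero _) (map_one _), Matrix.one_kronecker_one]
  have h₂ : T₂ (1 : Matrix (Idx c n) (Idx c n) A⟦X⟧) = 1 := by
    rw [T₂, Matrix.map_one _ (map_zero _) (map_one _), Matrix.one_kronecker_one]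
  rw [IsRTT, rttLeft, rttRight, h₁, h₂, mul_one, mul_one, one_mul, one_mul]

end ClassicalFamily

end

noncomputable section

namespace ClassicalFamily

variable {c : ClassicalFamily} {n : ℕ} {A B : Type*} [Ring A] [Algebra ℂ A] [Ring B] [Algebra ℂ B]

/-! ## The shifted `RTT`-relation -/

/-- The substitution `u ↦ u + κ` in series in `u⁻¹`, `v⁻¹`. -/
def shiftU (c : ClassicalFamily) (n : ℕ) (A : Type*) [Ring A] [Algebra ℂ A] :
    A⟦X⟧⟦X⟧ →+* A⟦X⟧⟦X⟧ :=
  PowerSeries.map (shiftHom A (kappa c n))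

theorem shiftU_inU (f : A⟦X⟧) : shiftU c n A (inU f) = inU (shiftHom A (kappa c n) f) := by
  simp [shiftU]

theorem shiftHom_C (a : A) (κ : ℂ) : shiftHom A κ (PowerSeries.C a) = PowerSeries.C a := by
  ext m
  rw [shiftHom_apply, coeff_seriesShift, Finset.sum_eq_zero, zero_add]
  intro r hr
  rcases Nat.eq_zero_or_pos r with rfl | h
  · have : m ≠ 0 := by
      rintro rfl
      simp at hr
    simp [PowerSeries.coeff_one, this]
  · simp [PowerSeries.coeff_C, h.ne']

theorem shiftU_inV (f : A⟦X⟧) : shiftU c n A (inV f) = inV f := by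
  ext1 m
  simp [shiftU, shiftHom_C]

theorem shiftU_vInv : shiftU c n A (vInv A) = vInv A := by simp [shiftU, vInv]

/-- The element `u⁻¹ v⁻¹ (u - v + κ)`. -/
def den₃ (c : ClassicalFamily) (n : ℕ) (A : Type*) [Ring A] [Algebra ℂ A] : A⟦X⟧⟦X⟧ :=
  den₁ A + kappa c n • (uInv A * vInv A)

theorem shiftHom_X_smul (a : ℂ) (x : A⟦X⟧⟦X⟧) :
    shiftU c n A (a • x) = a • shiftU c n A x := by
  ext1 m
  rw [shiftU, PowerSeries.coeff_map, PowerSeries.coeff_smul, shiftHom_smul,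
    PowerSeries.coeff_smul, PowerSeries.coeff_map]

theorem shiftU_uInv : inU (shiftDen A (kappa c n)) * shiftU c n A (uInv A) = uInv A := by
  have h := congrArg (inU (A := A)) (shiftHom_X (A := A) (kappa c n))
  rw [map_mul] at h
  rw [uInv, shiftU_inU, ← h]
  refine (commute_of_coeff (fun m x => ?_) _).eq
  rw [PowerSeries.coeff_C]
  split_ifs
  · refine Commute.add_left (Commute.one_left x) (Commute.smul_left ?_ _)
    exact (PowerSeries.commute_X x).symm
  · exact Commute.zero_left x

theorem inU_shiftDen : inU (shiftDen A (kappa c n)) = 1 + kappa c n • uInv A := by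
  rw [shiftDen, map_add, map_one, uInv, inU]
  congr 1
  ext1 m
  rw [PowerSeries.coeff_smul, PowerSeries.coeff_C, PowerSeries.coeff_C]
  split_ifs <;> simp

theorem commute_inU_shiftDen (x : A⟦X⟧⟦X⟧) : Commute (inU (shiftDen A (kappa c n))) x := by
  rw [inU_shiftDen]
  exact (Commute.one_left x).add_left ((commute_uInv x).smul_left _)

theorem shiftU_den₁ : inU (shiftDen A (kappa c n)) * shiftU c n A (den₁ A) = den₃ c n A := by
  rw [den₁, map_sub, mul_sub, shiftU_uInv, shiftU_vInv, inU_shiftDen, add_mul, one_mul, den₃, den₁,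
    smul_mul_assoc]
  abel

theorem shiftU_uvInv : inU (shiftDen A (kappa c n)) * shiftU c n A (uInv A * vInv A)
    = uInv A * vInv A := by
  rw [map_mul, ← mul_assoc, shiftU_uInv, shiftU_vInv]

/-- The shift by `κ` moves the pole of the `Q`-term to the diagonal: `u - v - κ` becomes `u - v`,
while `u - v` becomes `u - v + κ`. -/
theorem shiftU_den₂ : inU (shiftDen A (kappa c n)) * shiftU c n A (den₂ c n A) = den₁ A := by
  rw [den₂, ← den₁, map_sub, mul_sub, shiftU_den₁, shiftHom_X_smul, mul_smul_comm, shiftU_uvInv,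
    den₃]
  abel

/-- As `(u + κ)⁻¹ = u⁻¹ (1 + κ u⁻¹)⁻¹`, each of the two cleared denominators in a term loses a
factor `1 + κ u⁻¹` under the shift. Multiplying by the square of this central factor restores the
cleared form. -/
theorem IsRTT.shifted {T : Matrix (Idx c n) (Idx c n) A⟦X⟧} (h : IsRTT T) (i k j l : Idx c n) :
    den₃ c n A * den₁ A * (inU (shiftHom A (kappa c n) (T i j)) * inV (T k l))
      - uInv A * vInv A * den₁ A * (inU (shiftHom A (kappa c n) (T k j)) * inV (T i l))
      + uInv A * vInv A * den₃ c n A *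
        (if k = -i then ∑ m, theta i m •
          (inU (shiftHom A (kappa c n) (T m j)) * inV (T (-m) l)) else 0)
    = den₃ c n A * den₁ A * (inV (T k l) * inU (shiftHom A (kappa c n) (T i j)))
      - uInv A * vInv A * den₁ A * (inV (T k j) * inU (shiftHom A (kappa c n) (T i l)))
      + uInv A * vInv A * den₃ c n A *
        if l = -j then ∑ m, theta m j •
          (inV (T k (-m)) * inU (shiftHom A (kappa c n) (T i m))) else 0 := by
  have key := isRTT_iff.1 h i k j l
  rw [rttLeft_apply, rttRight_apply] at key
  replace key := congrArg (fun x => inU (shiftDen A (kappa c n)) * inU (shiftDen A (kappa c n))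
    * shiftU c n A x) key
  have hc := commute_inU_shiftDen (c := c) (n := n) (A := A)
  have e : ∀ x y z : A⟦X⟧⟦X⟧, inU (shiftDen A (kappa c n)) * inU (shiftDen A (kappa c n)) *
      (shiftU c n A (x * y) * z) = (inU (shiftDen A (kappa c n)) * shiftU c n A x) *
        (inU (shiftDen A (kappa c n)) * shiftU c n A y) * z := by
    intro x y z
    simp only [map_mul, mul_assoc]
    rw [(hc (shiftU c n A x)).left_comm]
  simp only [map_add, map_sub, map_mul _ (_ * _) (_ * _), mul_add, mul_sub] at key
  simp only [map_mul _ (_ * _) (ite _ _ _), e, shiftU_den₁, shiftU_den₂,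
    shiftU_uvInv, apply_ite (shiftU c n A), map_sum, map_zero, shiftHom_X_smul] at key
  simpa only [map_mul, shiftU_inU, shiftU_inV] using key

theorem diagHom_uInv : diagHom A (uInv A) = PowerSeries.X := diagHom_C _

theorem diagHom_vInv : diagHom A (vInv A) = PowerSeries.X := by
  have : vInv A = inV PowerSeries.X := by simp [vInv]
  rw [this, diagHom_map_C]

theorem diagHom_smul (a : ℂ) (x : A⟦X⟧⟦X⟧) : diagHom A (a • x) = a • diagHom A x := by
  ext m
  simp [coeff_diagHom, Finset.smul_sum]

theorem X_pow_four_smul_cancel {κ : ℂ} (hκ : κ ≠ 0) {f g : A⟦X⟧}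
    (h : PowerSeries.X * PowerSeries.X * (κ • (PowerSeries.X * PowerSeries.X)) * f =
      PowerSeries.X * PowerSeries.X * (κ • (PowerSeries.X * PowerSeries.X)) * g) : f = g := by
  simp only [mul_smul_comm, smul_mul_assoc] at h
  have h2 := congrArg (fun x => κ⁻¹ • x) h
  simp only [smul_smul, inv_mul_cancel₀ hκ, one_smul, mul_assoc] at h2
  exact PowerSeries.X_mul_cancel (PowerSeries.X_mul_cancel (PowerSeries.X_mul_cancel
    (PowerSeries.X_mul_cancel h2)))

/-- At `v = u` the element `u - v` vanishes, which removes the scalar and the `P`-terms of the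
shifted relation. The `Q`-terms keep the coefficient `κ u⁻⁴`, and this can be cancelled because `κ ≠
0`. -/
theorem IsRTT.contracted (hκ : kappa c n ≠ 0) {T : Matrix (Idx c n) (Idx c n) A⟦X⟧} (h : IsRTT T)
    (i k j l : Idx c n) :
    (if k = -i then ∑ m, theta i m • (seriesShift (kappa c n) (T m j) * T (-m) l) else 0) =
      if l = -j then ∑ m, theta m j • (T k (-m) * seriesShift (kappa c n) (T i m)) else 0 := by
  have key := congrArg (diagHom A) (h.shifted i k j l)
  have h1 : diagHom A (den₁ A) = 0 := by
    rw [den₁, map_sub, diagHom_uInv, diagHom_vInv, sub_self]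
  have h3 : diagHom A (den₃ c n A) = kappa c n • (PowerSeries.X * PowerSeries.X) := by
    rw [den₃, map_add, h1, zero_add, diagHom_smul, map_mul, diagHom_uInv, diagHom_vInv]
  simp only [map_add, map_sub, map_mul, h1, mul_zero, zero_mul, sub_zero, zero_add, h3,
    diagHom_uInv, diagHom_vInv, apply_ite (diagHom A), map_sum, diagHom_smul, diagHom_C,
    diagHom_map_C, map_zero] at key
  exact X_pow_four_smul_cancel hκ key

/-- The matrix `Tᵗ (u + κ)`. -/
def transShift (T : Matrix (Idx c n) (Idx c n) A⟦X⟧) : Matrix (Idx c n) (Idx c n) A⟦X⟧ :=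
  Matrix.of fun k l => theta k l • seriesShift (kappa c n) (T (-l) (-k))

theorem sum_neg (f : Idx c n → A) : ∑ m, f (-m) = ∑ m, f m :=
  Fintype.sum_equiv ⟨fun m => -m, fun m => -m, Idx.neg_neg, Idx.neg_neg⟩ _ _ fun _ => rfl

theorem transShift_mul_apply (T : Matrix (Idx c n) (Idx c n) A⟦X⟧) (k l : Idx c n) :
    (transShift T * T) k l =
      ∑ m, theta (-k) m • (seriesShift (kappa c n) (T m (-k)) * T (-m) l) := by
  rw [Matrix.mul_apply, ← sum_neg]
  refine Finset.sum_congr rfl fun m _ => ?_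
  rw [transShift, Matrix.of_apply, smul_mul_assoc, Idx.neg_neg, theta_neg_left]

theorem mul_transShift_apply (T : Matrix (Idx c n) (Idx c n) A⟦X⟧) (k l : Idx c n) :
    (T * transShift T) k l =
      ∑ m, theta m (-l) • (T k (-m) * seriesShift (kappa c n) (T (-l) m)) := by
  rw [Matrix.mul_apply, ← sum_neg]
  refine Finset.sum_congr rfl fun m _ => ?_
  rw [transShift, Matrix.of_apply, mul_smul_comm, Idx.neg_neg, theta_neg_left]

/-- The contracted relation has two independent conditions, `k = -i` and `l = -j`. When exactly one
of them holds, an off-diagonal entry of one of the two products vanishes; when both hold, a diagonal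
entry of the first product equals an arbitrary diagonal entry of the second, so all of them
coincide. -/
theorem IsRTT.exists_scalar (hκ : kappa c n ≠ 0) {T : Matrix (Idx c n) (Idx c n) A⟦X⟧}
    (h : IsRTT T) : ∃ ζ : A⟦X⟧, transShift T * T = Matrix.scalar (Idx c n) ζ ∧
      T * transShift T = Matrix.scalar (Idx c n) ζ := by
  rcases isEmpty_or_nonempty (Idx c n) with _ | ⟨⟨o⟩⟩
  · exact ⟨0, Subsingleton.elim _ _, Subsingleton.elim _ _⟩
  have h1 : ∀ k l, k ≠ l → (transShift T * T) k l = 0 := fun k l hkl => by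
    have := h.contracted hκ (-k) k (-k) l
    rw [if_pos (Idx.neg_neg k).symm, Idx.neg_neg, if_neg (Ne.symm hkl)] at this
    rw [transShift_mul_apply, this]
  have h2 : ∀ k l, k ≠ l → (T * transShift T) k l = 0 := fun k l hkl => by
    have := h.contracted hκ (-l) k (-l) l
    rw [if_pos (Idx.neg_neg l).symm, Idx.neg_neg, if_neg hkl] at this
    rw [mul_transShift_apply, ← this]
  have h3 : ∀ k l, (transShift T * T) l l = (T * transShift T) k k := fun k l => by
    have := h.contracted hκ (-k) k (-l) l
    rw [if_pos (Idx.neg_neg k).symm, if_pos (Idx.neg_neg l).symm] at this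
    -- By multiplicativity of `θ` both sums acquire the same sign `θ_{-k,-l}`, whose square is `1`.
    have e1 : ∀ f : Idx c n → A⟦X⟧, ∑ m, theta (-k) m • f m
        = theta (-k) (-l) • ∑ m, theta (-l) m • f m := fun f => by
      simp only [Finset.smul_sum, smul_smul, theta_mul_theta]
    have e2 : ∀ f : Idx c n → A⟦X⟧, ∑ m, theta m (-l) • f m
        = theta (-k) (-l) • ∑ m, theta m (-k) • f m := fun f => by
      simp only [Finset.smul_sum, smul_smul, mul_comm (theta (-k) (-l)), theta_mul_theta]
    rw [e1, e2, ← transShift_mul_apply, ← mul_transShift_apply] at this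
    have := congrArg (fun x => theta (-k) (-l) • x) this
    simpa only [smul_smul, theta_mul_theta_self, one_smul] using this
  refine ⟨(T * transShift T) o o, ?_, ?_⟩
  · ext1 k l
    rw [Matrix.scalar_apply, Matrix.diagonal_apply]
    split_ifs with hkl
    · rw [← hkl, h3 o]
    · exact h1 k l hkl
  · ext1 k l
    rw [Matrix.scalar_apply, Matrix.diagonal_apply]
    split_ifs with hkl
    · rw [← hkl, ← h3 k o, h3 o]
    · exact h2 k l hkl

theorem card_idx : Fintype.card (Idx c n) = size c n := by
  have : Fintype.card (Idx c n)
      = ((Finset.Icc (-(n : ℤ)) n).filter fun i => c = B ∨ i ≠ 0).card := Fintype.card_coe _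
  rw [this, size]
  split_ifs with h
  · simp [h]
    omega
  · simp only [h, false_or, Finset.filter_ne']
    rw [Finset.card_erase_of_mem (by simp)]
    simp
    omega

theorem size_ne_zero (hn : 1 ≤ n) : (size c n : ℂ) ≠ 0 := by
  rw [Nat.cast_ne_zero, size]
  split_ifs <;> omega

/-- The values are `n - 1/2`, `n + 1` and `n - 1` in types `B`, `C` and `D`; the condition `n ≥ 2`
in type `D` excludes exactly the zero. -/
theorem kappa_ne_zero (hn : 1 ≤ n) (hD : c = .D → 2 ≤ n) : kappa c n ≠ 0 := by
  have hn' : (n : ℂ) ≠ 0 := Nat.cast_ne_zero.2 (by omega)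
  cases c with
  | B =>
    have : ((2 * n - 1 : ℤ) : ℂ) ≠ 0 := Int.cast_ne_zero.2 (by omega)
    simp only [kappa, size, reduceCtorEq, if_true, if_false]
    push_cast at this ⊢
    intro h
    exact this (by linear_combination 2 * h)
  | C =>
    have : ((n + 1 : ℕ) : ℂ) ≠ 0 := Nat.cast_ne_zero.2 (by omega)
    simp only [kappa, size, reduceCtorEq, if_true, if_false]
    push_cast at this ⊢
    intro h
    exact this (by linear_combination h)
  | D =>
    have : ((n - 1 : ℤ) : ℂ) ≠ 0 := Int.cast_ne_zero.2 (by have := hD rfl; omega)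
    simp only [kappa, size, reduceCtorEq, if_false]
    push_cast at this ⊢
    intro h
    exact this (by linear_combination h)

theorem IsRTT.transShift_mul (hn : 1 ≤ n) (hκ : kappa c n ≠ 0)
    {T : Matrix (Idx c n) (Idx c n) A⟦X⟧} (h : IsRTT T) :
    transShift T * T
        = Matrix.scalar (Idx c n) ((size c n : ℂ)⁻¹ • (transShift T * T).trace) ∧
      T * transShift T
        = Matrix.scalar (Idx c n) ((size c n : ℂ)⁻¹ • (transShift T * T).trace) := by
  obtain ⟨ζ, h1, h2⟩ := h.exists_scalar hκ
  have : (size c n : ℂ)⁻¹ • (transShift T * T).trace = ζ := by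
    rw [h1, Matrix.scalar_apply, Matrix.trace_diagonal, Finset.sum_const, Finset.card_univ,
      card_idx, ← Nat.cast_smul_eq_nsmul ℂ, smul_smul, inv_mul_cancel₀ (size_ne_zero hn), one_smul]
  rw [this]
  exact ⟨h1, h2⟩

end ClassicalFamily

end

noncomputable section

namespace ClassicalFamily

variable {c : ClassicalFamily} {n : ℕ} {A B : Type*} [Ring A] [Algebra ℂ A] [Ring B] [Algebra ℂ B]

/-! ## Scalars -/

theorem commute_map₂ {C : Type*} [CommRing C] [Algebra ℂ C] (φ : C →ₐ[ℂ] A)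
    (hφ : ∀ a x, Commute (φ a) x) (k : C⟦X⟧⟦X⟧) (x : A⟦X⟧⟦X⟧) : Commute (map₂ φ k) x := by
  refine commute_of_coeff (fun m => commute_of_coeff fun m' => ?_) x
  simpa using hφ _

/-- Matrices over `A⟦u⁻¹⟧⟦v⁻¹⟧` form an algebra over `C⟦u⁻¹⟧⟦v⁻¹⟧`, if `C` maps to the center
of `A`. -/
abbrev scalarAlgebra {C : Type*} [CommRing C] [Algebra ℂ C] (φ : C →ₐ[ℂ] A)
    (hφ : ∀ a x, Commute (φ a) x) (ι : Type*) [Fintype ι] [DecidableEq ι] :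
    Algebra C⟦X⟧⟦X⟧ (Matrix ι ι A⟦X⟧⟦X⟧) :=
  RingHom.toAlgebra' ((Matrix.scalar ι).comp (map₂ φ)) fun k M => by
    change Matrix.scalar ι (map₂ φ k) * M = M * Matrix.scalar ι (map₂ φ k)
    exact (Matrix.scalar_commute _ (fun x => commute_map₂ φ hφ k x) M).eq

/-- Unitarity and the Yang–Baxter equation are identities with coefficients in a commutative ring
`K` and can be checked by linear algebra over `K`. The matrices here have noncommutative entries, so
the central scalars are first gathered in such a ring. -/
theorem scalarAlgebra_smul {C : Type*} [CommRing C] [Algebra ℂ C] (φ : C →ₐ[ℂ] A)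
    (hφ : ∀ a x, Commute (φ a) x) {ι : Type*} [Fintype ι] [DecidableEq ι]
    (k : C⟦X⟧⟦X⟧) (M : Matrix ι ι A⟦X⟧⟦X⟧) :
    let _ := scalarAlgebra φ hφ ι
    k • M = map₂ φ k • M := by
  intro _
  rw [Algebra.smul_def]
  change Matrix.scalar ι (map₂ φ k) * M = _
  rw [Matrix.scalar_apply, Matrix.smul_eq_diagonal_mul]

theorem map₂_smul {C : Type*} [Ring C] [Algebra ℂ C] (φ : C →ₐ[ℂ] A) (a : ℂ) (k : C⟦X⟧⟦X⟧) :
    map₂ φ (a • k) = a • map₂ φ k := by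
  rw [Algebra.smul_def, Algebra.smul_def, map_mul, map₂_algebraMap]

theorem map₂_den₁ {C : Type*} [Ring C] [Algebra ℂ C] (φ : C →ₐ[ℂ] A) :
    map₂ φ (den₁ C) = den₁ A := by
  rw [den₁, map_sub, map₂_uInv, map₂_vInv, den₁]

theorem map₂_den₂ {C : Type*} [Ring C] [Algebra ℂ C] (φ : C →ₐ[ℂ] A) :
    map₂ φ (den₂ c n C) = den₂ c n A := by
  rw [den₂, map_sub, map_sub, map₂_smul, map_mul, map₂_uInv, map₂_vInv, den₂]

theorem map₂_den₃ {C : Type*} [Ring C] [Algebra ℂ C] (φ : C →ₐ[ℂ] A) :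
    map₂ φ (den₃ c n C) = den₃ c n A := by
  rw [den₃, map_add, map₂_den₁, map₂_smul, map_mul, map₂_uInv, map₂_vInv, den₃]

/-! ## Unitarity and the centrality of `z (u)` -/

/-- `1` in the orthogonal and `-1` in the symplectic case. -/
def sgn (c : ClassicalFamily) : ℂ := if c = C then -1 else 1

/-- This is the only property of `κ` that unitarity and the Yang–Baxter equation use. -/
theorem kappa_eq : 2 * kappa c n + 2 * sgn c = size c n := by
  unfold kappa sgn
  split_ifs <;> ring

theorem theta_neg_self (i : Idx c n) : theta i (-i) = sgn c := by
  rw [theta, eps_neg, sgn]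
  split_ifs
  · rw [mul_neg, eps_mul_self]
  · exact eps_mul_self i

theorem opP_mul_opP : opP c n * opP c n = 1 := by
  ext1 ⟨i, k⟩ ⟨j, l⟩
  rw [Matrix.mul_apply, Finset.sum_eq_single (k, i)]
  · simp [opP_apply, Matrix.one_apply, eq_comm, and_comm]
  · rintro ⟨a, b⟩ _ hb
    have : ¬ (b = i ∧ a = k) := fun h => hb (by rw [h.1, h.2])
    simp [opP_apply, this]
  · simp

theorem opP_mul_opQ : opP c n * opQ c n = sgn c • opQ c n := by
  ext1 ⟨i, k⟩ ⟨j, l⟩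
  rw [Matrix.mul_apply, Finset.sum_eq_single (k, i)]
  · rw [Matrix.smul_apply, opP_apply, opQ_apply, opQ_apply]
    by_cases h : k = -i
    · subst h
      simp only [Idx.neg_neg, true_and, and_self, if_true, one_mul, smul_eq_mul, mul_ite, mul_zero]
      rw [← theta_mul_theta (-i) i j, theta_comm (-i), theta_neg_self]
    · have : ¬ (i = -k) := fun h' => h (by rw [h', Idx.neg_neg])
      simp [h, this]
  · rintro ⟨a, b⟩ _ hb
    have : ¬ (b = i ∧ a = k) := fun h => hb (by rw [h.1, h.2])
    simp [opP_apply, this]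
  · simp

theorem opP_transpose : (opP c n)ᵀ = opP c n := by
  ext1 ⟨i, k⟩ ⟨j, l⟩
  simp [opP_apply, eq_comm, and_comm]

theorem opQ_transpose : (opQ c n)ᵀ = opQ c n := by
  ext1 ⟨i, k⟩ ⟨j, l⟩
  simp [opQ_apply, and_comm, theta_comm]

theorem opQ_mul_opP : opQ c n * opP c n = sgn c • opQ c n := by
  have := congrArg Matrix.transpose (opP_mul_opQ (c := c) (n := n))
  rwa [Matrix.transpose_mul, Matrix.transpose_smul, opP_transpose, opQ_transpose] at this

theorem opQ_mul_opQ : opQ c n * opQ c n = (size c n : ℂ) • opQ c n := by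
  ext1 ⟨i, k⟩ ⟨j, l⟩
  rw [Matrix.mul_apply, Fintype.sum_prod_type]
  have : ∀ m : Idx c n, ∑ b, opQ c n (i, k) (m, b) * opQ c n (m, b) (j, l)
      = opQ c n (i, k) (j, l) := fun m => by
    rw [Finset.sum_eq_single (-m)]
    · simp only [opQ_apply]
      by_cases h1 : k = -i <;> by_cases h2 : l = -j <;> simp [h1, h2, theta_mul_theta]
    · intro b _ hb
      simp [opQ_apply, hb]
    · simp
  rw [Finset.sum_congr rfl fun m _ => this m, Finset.sum_const, Finset.card_univ, card_idx,
    Matrix.smul_apply, ← Nat.cast_smul_eq_nsmul ℂ]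

/-- With `a` for the cleared `u - v` and `p` for `u⁻¹ v⁻¹`, the second factor is the first with `a`
replaced by `-a`: the identity is `R(u) R(-u) = (1 - u⁻²) 1` without denominators. The coefficient
of `Q` cancels thanks to `N = 2κ + 2s`. -/
theorem unitarity {K M : Type*} [CommRing K] [Ring M] [Algebra K M] (a p κ s N : K) (P Q : M)
    (hPP : P * P = 1) (hPQ : P * Q = s • Q) (hQP : Q * P = s • Q) (hQQ : Q * Q = N • Q)
    (hN : N = 2 * κ + 2 * s) :
    ((a * (a - κ * p)) • (1 : M) - (p * (a - κ * p)) • P + (p * a) • Q) *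
      (((a + κ * p) * a) • (1 : M) + (p * (a + κ * p)) • P - (p * a) • Q) =
      ((a * a - κ * κ * p * p) * (a * a - p * p)) • (1 : M) := by
  simp only [mul_add, add_mul, mul_sub, sub_mul, smul_mul_smul_comm, mul_one, one_mul, hPP, hPQ,
    hQP, hQQ, smul_smul, hN]
  module

/-- An abstract form of the argument that `z (u)` commutes with `T (v)`. -/
theorem commute_of_unitarity {K M : Type*} [CommRing K] [Ring M] [Algebra K M] {ω : K}
    (hω : ∀ x : M, ω • x = 0 → x = 0) {R R' t₁ t₂ t₁' ζ : M} (hR : R * R' = ω • (1 : M))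
    (hR' : R' * R = ω • (1 : M)) (h : R * t₁ * t₂ = t₂ * t₁ * R) (h' : t₁' * R' * t₂ = t₂ * R' * t₁')
    (hζ : t₁' * t₁ = ζ) (hζR : ζ * R' = R' * ζ) : ζ * t₂ = t₂ * ζ := by
  have cancel : ∀ x y : M, ω • x = ω • y → x = y := fun x y hxy => by
    rw [← sub_eq_zero]
    exact hω _ (by rw [smul_sub, hxy, sub_self])
  -- The `RTT`-relation multiplied by `R'` on both sides, with the scalar `ω = R R' = R' R`
  -- cancelled.
  have e1 : R' * t₂ * t₁ = t₁ * t₂ * R' := by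
    refine cancel _ _ ?_
    calc ω • (R' * t₂ * t₁) = R' * (t₂ * t₁) * (ω • (1 : M)) := by
          rw [mul_smul_comm, mul_one, mul_assoc]
      _ = R' * (t₂ * t₁ * R) * R' := by rw [← hR]; noncomm_ring
      _ = (R' * R) * (t₁ * t₂ * R') := by rw [← h]; noncomm_ring
      _ = _ := by rw [hR', smul_mul_assoc, one_mul]
  -- The factor `t₂` moves first past `t₁' R'` by the transposed relation and then past `t₁` by the
  -- inverted one.
  have e2 : t₂ * ζ * R' = ζ * t₂ * R' := by
    calc t₂ * ζ * R' = (t₂ * R' * t₁') * t₁ := by rw [mul_assoc, hζR, ← hζ]; noncomm_ring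
      _ = t₁' * (R' * t₂ * t₁) := by rw [← h']; noncomm_ring
      _ = _ := by rw [e1, ← hζ]; noncomm_ring
  refine cancel _ _ ?_
  have e3 := congrArg (fun x => x * R) e2
  simp only [mul_assoc, hR', mul_smul_comm, mul_one] at e3
  exact e3.symm

theorem den₁_constantCoeff : PowerSeries.constantCoeff (den₁ A) = -PowerSeries.X := by
  simp [den₁, uInv, vInv]

/-- As a series in `v⁻¹` the multiplier has constant term `u⁻⁴`: that of `den₁` is `-u⁻¹`, and all
terms containing `v⁻¹` as a factor drop out. -/
theorem mul_den_cancel {κ : ℂ} {f : A⟦X⟧⟦X⟧}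
    (h : ((den₁ A * den₁ A - algebraMap ℂ _ κ * algebraMap ℂ _ κ * (uInv A * vInv A) *
      (uInv A * vInv A)) * (den₁ A * den₁ A - (uInv A * vInv A) * (uInv A * vInv A))) * f = 0) :
    f = 0 := by
  refine mul_left_cancel_of_constantCoeff (fun x hx => ?_) h
  have hv : PowerSeries.constantCoeff (vInv A) = 0 := by simp [vInv]
  simp only [map_mul, map_sub, den₁_constantCoeff, hv, mul_zero, sub_zero, neg_mul_neg,
    mul_assoc] at hx
  exact PowerSeries.X_mul_cancel (PowerSeries.X_mul_cancel (PowerSeries.X_mul_cancel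
    (PowerSeries.X_mul_cancel (by simpa using hx))))

/-- Transposition in the first tensor factor exchanges `P` and `Q`, so it turns `R(u + κ - v)` into
a multiple of `R(v - u)`. In entries this is `IsRTT.shifted` for the indices `(-j, k, -i, l)`,
multiplied by `θ_{ij}`. -/
theorem IsRTT.transposed {T : Matrix (Idx c n) (Idx c n) A⟦X⟧} (h : IsRTT T) :
    T₁ (transShift T) * ((den₃ c n A * den₁ A) •
        (1 : Matrix (Idx c n × Idx c n) (Idx c n × Idx c n) A⟦X⟧⟦X⟧)
        + (uInv A * vInv A * den₃ c n A) • (opP c n).map (algebraMap ℂ A⟦X⟧⟦X⟧)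
        - (uInv A * vInv A * den₁ A) • (opQ c n).map (algebraMap ℂ A⟦X⟧⟦X⟧)) * T₂ T
      = T₂ T * ((den₃ c n A * den₁ A) •
        (1 : Matrix (Idx c n × Idx c n) (Idx c n × Idx c n) A⟦X⟧⟦X⟧)
        + (uInv A * vInv A * den₃ c n A) • (opP c n).map (algebraMap ℂ A⟦X⟧⟦X⟧)
        - (uInv A * vInv A * den₁ A) • (opQ c n).map (algebraMap ℂ A⟦X⟧⟦X⟧)) *
        T₁ (transShift T) := by
  have c3 : ∀ x, Commute (den₃ c n A) x := fun x =>
    (commute_den₁ x).add_left ((commute_uvInv x).smul_left _)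
  have s1 : ∀ x, Commute (den₃ c n A * den₁ A) x := fun x => (c3 x).mul_left (commute_den₁ x)
  have s2 : ∀ x, Commute (uInv A * vInv A * den₃ c n A) x := fun x =>
    (commute_uvInv x).mul_left (c3 x)
  have s3 : ∀ x, Commute (uInv A * vInv A * den₁ A) x := fun x =>
    (commute_uvInv x).mul_left (commute_den₁ x)
  have hθ : ∀ i j, inU (transShift T i j)
      = theta i j • inU (shiftHom A (kappa c n) (T (-j) (-i))) := fun i j => by
    ext1 m
    rw [PowerSeries.coeff_smul, inU, PowerSeries.coeff_C, PowerSeries.coeff_C]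
    split_ifs
    · rfl
    · rw [smul_zero]
  ext1 ⟨i, k⟩ ⟨j, l⟩
  simp only [mul_add, mul_sub, add_mul, sub_mul, mul_smul_of_commute s1, mul_smul_of_commute s2,
    mul_smul_of_commute s3, smul_mul_assoc, mul_one, Matrix.add_apply, Matrix.sub_apply,
    Matrix.smul_apply, smul_eq_mul]
  have p1 : (T₁ (transShift T) * (opP c n).map (algebraMap ℂ A⟦X⟧⟦X⟧) * T₂ T) (i, k) (j, l)
      = if k = j then ∑ m, theta i (-m) • (inU (shiftHom A (kappa c n) (T m (-i))) *
        inV (T (-m) l)) else 0 := by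
    rw [Matrix.mul_apply, Fintype.sum_prod_type, Finset.sum_eq_single j]
    · simp only [mul_opP_apply, T₁_apply, T₂_apply, if_true]
      split_ifs
      · rw [← sum_neg]
        refine Finset.sum_congr rfl fun m _ => ?_
        rw [hθ, smul_mul_assoc, Idx.neg_neg]
      · simp
    · intro b _ hb
      simp [T₂_apply, hb]
    · simp
  have p2 : (T₂ T * (opP c n).map (algebraMap ℂ A⟦X⟧⟦X⟧) * T₁ (transShift T)) (i, k) (j, l)
      = if l = i then ∑ m, theta j (-m) • (inV (T k (-m)) *
        inU (shiftHom A (kappa c n) (T (-j) m))) else 0 := by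
    rw [mul_assoc, Matrix.mul_apply, Fintype.sum_prod_type, Finset.sum_eq_single i]
    · simp only [opP_mul_apply, T₁_apply, T₂_apply, if_true, eq_comm (a := i) (b := l)]
      split_ifs
      · rw [← sum_neg]
        refine Finset.sum_congr rfl fun m _ => ?_
        rw [hθ, mul_smul_comm, Idx.neg_neg, theta_comm]
      · simp
    · intro b _ hb
      simp [T₂_apply, hb.symm]
    · simp
  have q1 : (T₁ (transShift T) * (opQ c n).map (algebraMap ℂ A⟦X⟧⟦X⟧) * T₂ T) (i, k) (j, l)
      = theta i j • (inU (shiftHom A (kappa c n) (T k (-i))) * inV (T (-j) l)) := by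
    rw [Matrix.mul_apply, Fintype.sum_prod_type, Finset.sum_eq_single j,
      Finset.sum_eq_single (-j)]
    · rw [mul_opQ_apply, if_pos rfl, Finset.sum_eq_single (-k), T₁_apply, T₂_apply, if_pos rfl,
        if_pos (Idx.neg_neg k).symm, hθ, Idx.neg_neg, smul_smul, mul_comm (theta (-k) j),
        theta_mul_theta, smul_mul_assoc]
      · intro b _ hb
        rw [T₁_apply, if_neg, smul_zero]
        exact fun h => hb (by rw [h, Idx.neg_neg])
      · simp
    · intro b _ hb
      rw [mul_opQ_apply, if_neg hb, zero_mul]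
    · simp
    · intro b _ hb
      simp [T₂_apply, hb]
    · simp
  have q2 : (T₂ T * (opQ c n).map (algebraMap ℂ A⟦X⟧⟦X⟧) * T₁ (transShift T)) (i, k) (j, l)
      = theta i j • (inV (T k (-i)) * inU (shiftHom A (kappa c n) (T (-j) l))) := by
    rw [mul_assoc, Matrix.mul_apply, Fintype.sum_prod_type, Finset.sum_eq_single i,
      Finset.sum_eq_single (-i)]
    · rw [opQ_mul_apply, if_pos rfl, Finset.sum_eq_single (-l), T₁_apply, T₂_apply, if_pos rfl,
        if_pos (Idx.neg_neg l), hθ, Idx.neg_neg, smul_smul, theta_mul_theta, mul_smul_comm]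
      · intro b _ hb
        rw [T₁_apply, if_neg, smul_zero]
        exact fun h => hb (by rw [← h, Idx.neg_neg])
      · simp
    · intro b _ hb
      rw [opQ_mul_apply, if_neg hb, mul_zero]
    · simp
    · intro b _ hb
      simp [T₂_apply, hb.symm]
    · simp
  rw [p1, p2, q1, q2, T₁_mul_T₂_apply, T₂_mul_T₁_apply, hθ]
  have key := congrArg (fun x => theta i j • x) (h.shifted (-j) k (-i) l)
  simp only [smul_add, smul_sub, Idx.neg_neg, ← mul_smul_comm, smul_ite, smul_zero,
    Finset.smul_sum, smul_smul] at key
  have e1 : ∀ m, theta i j * theta (-j) m = theta i (-m) := fun m => by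
    rw [theta_neg_left, theta_mul_theta]
  have e2 : ∀ m, theta i j * theta m (-i) = theta j (-m) := fun m => by
    rw [← theta_neg_left, theta_comm (-m), theta_comm i j, theta_mul_theta]
  simp only [e1, e2, mul_smul_comm, smul_mul_assoc] at key ⊢
  rw [add_sub_right_comm, add_sub_right_comm]
  exact key

theorem T₁_scalar (ζ : A⟦X⟧) : T₁ (Matrix.scalar (Idx c n) ζ) =
    inU ζ • (1 : Matrix (Idx c n × Idx c n) (Idx c n × Idx c n) A⟦X⟧⟦X⟧) := by
  ext1 ⟨i, k⟩ ⟨j, l⟩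
  rw [T₁_apply, Matrix.scalar_apply, Matrix.diagonal_apply, Matrix.smul_apply, Matrix.one_apply]
  by_cases h1 : i = j <;> by_cases h2 : k = l <;> simp [h1, h2]

theorem commute_smul_one_map (ζ : A⟦X⟧⟦X⟧) (M : Matrix (Idx c n × Idx c n) (Idx c n × Idx c n) ℂ) :
    (ζ • (1 : Matrix (Idx c n × Idx c n) (Idx c n × Idx c n) A⟦X⟧⟦X⟧)) *
      M.map (algebraMap ℂ A⟦X⟧⟦X⟧) = M.map (algebraMap ℂ A⟦X⟧⟦X⟧) * (ζ • 1) := by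
  ext p q
  rw [Matrix.smul_eq_diagonal_mul, mul_one, Matrix.diagonal_mul, Matrix.mul_diagonal,
    Matrix.map_apply, Algebra.commutes]

/-- The coefficients of `z (u)` commute with the coefficients of the entries of `T (u)`. -/
theorem IsRTT.commute_scalar {T : Matrix (Idx c n) (Idx c n) A⟦X⟧} (h : IsRTT T) {ζ : A⟦X⟧}
    (hζ : transShift T * T = Matrix.scalar (Idx c n) ζ) (r s : ℕ) (k l : Idx c n) :
    Commute (PowerSeries.coeff r ζ) (PowerSeries.coeff s (T k l)) := by
  let φ : ℂ →ₐ[ℂ] A := Algebra.ofId ℂ A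
  have hφ : ∀ a x, Commute (φ a) x := Algebra.commutes
  let _ := scalarAlgebra φ hφ (Idx c n × Idx c n)
  let M := Matrix (Idx c n × Idx c n) (Idx c n × Idx c n) A⟦X⟧⟦X⟧
  have hs : ∀ (x : ℂ⟦X⟧⟦X⟧) (m : M), x • m = map₂ φ x • m :=
    fun x m => scalarAlgebra_smul φ hφ x m
  let a : ℂ⟦X⟧⟦X⟧ := den₁ ℂ
  let p : ℂ⟦X⟧⟦X⟧ := uInv ℂ * vInv ℂ
  let κ : ℂ⟦X⟧⟦X⟧ := algebraMap ℂ _ (kappa c n)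
  let P : M := (opP c n).map (algebraMap ℂ A⟦X⟧⟦X⟧)
  let Q : M := (opQ c n).map (algebraMap ℂ A⟦X⟧⟦X⟧)
  have hmap : ∀ (x : ℂ) (m : Matrix (Idx c n × Idx c n) (Idx c n × Idx c n) ℂ),
      (x • m).map (algebraMap ℂ A⟦X⟧⟦X⟧)
        = algebraMap ℂ ℂ⟦X⟧⟦X⟧ x • (m.map (algebraMap ℂ A⟦X⟧⟦X⟧) : M) := by
    intro x m
    rw [hs, map₂_algebraMap]
    ext1 i j
    exact map_mul (algebraMap ℂ A⟦X⟧⟦X⟧) _ _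
  have hPP : P * P = 1 := by
    rw [← Matrix.map_mul, opP_mul_opP, Matrix.map_one _ (map_zero _) (map_one _)]
  have hPQ : P * Q = algebraMap ℂ ℂ⟦X⟧⟦X⟧ (sgn c) • Q := by
    rw [← Matrix.map_mul, opP_mul_opQ, hmap]
  have hQP : Q * P = algebraMap ℂ ℂ⟦X⟧⟦X⟧ (sgn c) • Q := by
    rw [← Matrix.map_mul, opQ_mul_opP, hmap]
  have hQQ : Q * Q = algebraMap ℂ ℂ⟦X⟧⟦X⟧ (size c n) • Q := by
    rw [← Matrix.map_mul, opQ_mul_opQ, hmap]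
  have hN : algebraMap ℂ ℂ⟦X⟧⟦X⟧ (size c n) = 2 * κ + 2 * algebraMap ℂ ℂ⟦X⟧⟦X⟧ (sgn c) := by
    rw [← kappa_eq, map_add, map_mul, map_mul, map_ofNat]
  have d2 : den₂ c n ℂ = a - κ * p := by rw [den₂, Algebra.smul_def]; rfl
  have d3 : den₃ c n ℂ = a + κ * p := by rw [den₃, Algebra.smul_def]
  let R : M := (a * (a - κ * p)) • (1 : M) - (p * (a - κ * p)) • P + (p * a) • Q
  let R' : M := ((a + κ * p) * a) • (1 : M) + (p * (a + κ * p)) • P - (p * a) • Q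
  have hR : clearedR c n A = R := by
    simp only [R, ← d2, hs, map_mul, a, p, map₂_den₁, map₂_den₂, map₂_uInv, map₂_vInv]
    rfl
  have hR' : (den₃ c n A * den₁ A) • (1 : M) + (uInv A * vInv A * den₃ c n A) • P
      - (uInv A * vInv A * den₁ A) • Q = R' := by
    simp only [R', ← d3, hs, map_mul, a, p, map₂_den₁, map₂_den₃, map₂_uInv, map₂_vInv]
  have u1 : R * R' = _ := unitarity a p κ _ _ P Q hPP hPQ hQP hQQ hN
  -- Replacing `a` by `-a` interchanges `R` and `R'` and preserves the right-hand side of the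
  -- unitarity relation.
  have u2 : R' * R = ((a * a - κ * κ * p * p) * (a * a - p * p)) • (1 : M) := by
    have := unitarity (-a) p κ _ _ P Q hPP hPQ hQP hQQ hN
    have e1 : -a * (-a - κ * p) = (a + κ * p) * a := by ring
    have e2 : p * (-a - κ * p) = -(p * (a + κ * p)) := by ring
    have e3 : p * -a = -(p * a) := by ring
    have e4 : (-a + κ * p) * -a = a * (a - κ * p) := by ring
    have e5 : p * (-a + κ * p) = -(p * (a - κ * p)) := by ring
    simp only [e1, e2, e3, e4, e5, neg_mul_neg, neg_smul, sub_neg_eq_add, ← sub_eq_add_neg] at this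
    exact this
  have hω : ∀ x : M, ((a * a - κ * κ * p * p) * (a * a - p * p)) • x = 0 → x = 0 := by
    intro x hx
    ext1 i j
    refine mul_den_cancel (κ := kappa c n) ?_
    rw [hs] at hx
    have := congrFun (congrFun hx i) j
    change map₂ φ _ * x i j = 0 at this
    simp only [map_mul, map_sub, a, p, κ, map₂_den₁, map₂_uInv, map₂_vInv,
      map₂_algebraMap] at this
    simpa only [mul_assoc] using this
  have hz : T₁ (transShift T) * T₁ T = inU ζ • (1 : M) := by
    rw [← T₁_mul, hζ, T₁_scalar]
  have h1 : R * T₁ T * T₂ T = T₂ T * T₁ T * R := by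
    rw [← hR]
    exact h
  have h2 : T₁ (transShift T) * R' * T₂ T = T₂ T * R' * T₁ (transShift T) := by
    rw [← hR']
    exact h.transposed
  -- The series `ζ` is not yet known to be central. It commutes with `R'` because the entries of `P`
  -- and `Q` are complex numbers and the coefficients of `R'` are central.
  have hζR : (inU ζ • (1 : M)) * R' = R' * (inU ζ • (1 : M)) := by
    have e1 : (inU ζ • (1 : M)) * P = P * (inU ζ • (1 : M)) := commute_smul_one_map _ _
    have e2 : (inU ζ • (1 : M)) * Q = Q * (inU ζ • (1 : M)) := commute_smul_one_map _ _
    generalize inU ζ • (1 : M) = w at e1 e2 ⊢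
    simp only [R', mul_add, mul_sub, add_mul, sub_mul, mul_smul_comm, smul_mul_assoc, e1, e2,
      mul_one, one_mul]
  have key := commute_of_unitarity hω u1 u2 h1 h2 hz hζR
  -- This entry of `ζ(u) T₂(v) = T₂(v) ζ(u)` contains the single product of `ζ(u)` with `t_{kl}(v)`.
  have key2 := congrFun (congrFun key (k, k)) (k, l)
  rw [← T₁_scalar, T₁_mul_T₂_apply, T₂_mul_T₁_apply] at key2
  have key3 := congrArg (fun x => PowerSeries.coeff r (PowerSeries.coeff s x)) key2
  rw [Commute, SemiconjBy]
  simpa [inU, inV, PowerSeries.coeff_C_mul, PowerSeries.coeff_mul_C] using key3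

end ClassicalFamily

end

noncomputable section

namespace ClassicalFamily

variable {c : ClassicalFamily} {n : ℕ} {A B : Type*} [Ring A] [Algebra ℂ A] [Ring B] [Algebra ℂ B]

/-! ## Series with coefficients in a subalgebra -/

section SeriesIn

variable (S : Subalgebra ℂ A)

theorem coeff_mul_mem {f g : A⟦X⟧} (hf : ∀ m, PowerSeries.coeff m f ∈ S)
    (hg : ∀ m, PowerSeries.coeff m g ∈ S) (m : ℕ) : PowerSeries.coeff m (f * g) ∈ S := by
  rw [PowerSeries.coeff_mul]
  exact sum_mem fun x _ => mul_mem (hf _) (hg _)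

theorem coeff_seriesShift_mem (κ : ℂ) {f : A⟦X⟧} (hf : ∀ m, PowerSeries.coeff m f ∈ S) (m : ℕ) :
    PowerSeries.coeff m (seriesShift κ f) ∈ S := by
  rw [seriesShift, PowerSeries.coeff_mk]
  exact sum_mem fun x _ => S.smul_mem (hf _) _

/-- Applied to the centre, this makes `y(u)`, and then `y(u)⁻¹`, central as soon as `z(u)` is. -/
theorem coeff_halfSeries_mem (κ : ℂ) {f : A⟦X⟧} (hf : ∀ m, PowerSeries.coeff m f ∈ S) (m : ℕ) :
    PowerSeries.coeff m (halfSeries κ f) ∈ S := by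
  have : ∀ k m, PowerSeries.coeff m (halfSeriesApprox κ f k) ∈ S := by
    intro k
    induction k with
    | zero =>
      intro m
      rw [halfSeriesApprox, PowerSeries.coeff_one]
      split_ifs
      · exact one_mem _
      · exact zero_mem _
    | succ k ih =>
      intro m
      rw [halfSeriesApprox, map_add, PowerSeries.coeff_monomial]
      refine add_mem (ih m) ?_
      split_ifs
      · exact S.smul_mem (sub_mem (hf _) (coeff_mul_mem S ih (coeff_seriesShift_mem S κ ih) _)) _
      · exact zero_mem _
  rw [halfSeries, PowerSeries.coeff_mk]
  exact this m m

theorem coeff_invOfUnit_mem {f : A⟦X⟧} (hf : ∀ m, PowerSeries.coeff m f ∈ S) (m : ℕ) :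
    PowerSeries.coeff m (PowerSeries.invOfUnit f 1) ∈ S := by
  induction m using Nat.strong_induction_on with
  | _ m ih =>
    rw [PowerSeries.coeff_invOfUnit]
    split_ifs
    · simp
    · refine mul_mem (neg_mem (by simp)) (sum_mem fun x _ => ?_)
      split_ifs with h
      · exact mul_mem (hf _) (ih _ h)
      · exact zero_mem _

end SeriesIn

/-- The image of `y` solves the defining equation for the image of `z`, and that solution is unique.
-/
theorem map_halfSeries (κ : ℂ) (φ : A →ₐ[ℂ] B) {f : A⟦X⟧} (hf : PowerSeries.coeff 0 f = 1) :
    PowerSeries.map (φ : A →+* B) (halfSeries κ f)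
      = halfSeries κ (PowerSeries.map (φ : A →+* B) f) := by
  refine eq_halfSeries κ _ _ ?_ ?_ ?_
  · rw [PowerSeries.coeff_map, hf, map_one]
  · rw [PowerSeries.coeff_map, coeff_zero_halfSeries, map_one]
  · rw [← map_seriesShift, ← map_mul, halfSeries_mul_seriesShift κ f hf]

theorem constantCoeff_halfSeries (κ : ℂ) (f : A⟦X⟧) :
    PowerSeries.constantCoeff (halfSeries κ f) = 1 := by
  rw [← PowerSeries.coeff_zero_eq_constantCoeff_apply, coeff_zero_halfSeries]

theorem eq_invOfUnit {f g : A⟦X⟧} (hf : PowerSeries.constantCoeff f = 1) (h : g * f = 1) :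
    g = PowerSeries.invOfUnit f 1 := by
  rw [← mul_one g, ← PowerSeries.mul_invOfUnit f 1 (by simpa using hf), ← mul_assoc, h, one_mul]

/-! ## The normalization of a solution -/

section Normalization

/-- The series `z (u)` of a solution of the `RTT`-relation. -/
def zSeries (T : Matrix (Idx c n) (Idx c n) A⟦X⟧) : A⟦X⟧ :=
  (size c n : ℂ)⁻¹ • (transShift T * T).trace

/-- The matrix `y (u)⁻¹ T (u)`. -/
def normalize (T : Matrix (Idx c n) (Idx c n) A⟦X⟧) : Matrix (Idx c n) (Idx c n) A⟦X⟧ :=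
  PowerSeries.invOfUnit (halfSeries (kappa c n) (zSeries T)) 1 • T

/-- The constant term of `T (u)` is the identity matrix. -/
def IsUnital (T : Matrix (Idx c n) (Idx c n) A⟦X⟧) : Prop :=
  ∀ i j, PowerSeries.coeff 0 (T i j) = if i = j then 1 else 0

theorem IsUnital.smul {T : Matrix (Idx c n) (Idx c n) A⟦X⟧} (h : IsUnital T) {g : A⟦X⟧}
    (hg : PowerSeries.coeff 0 g = 1) : IsUnital (g • T) := by
  intro i j
  rw [← h i j, Matrix.smul_apply, smul_eq_mul, PowerSeries.coeff_mul,
    Finset.Nat.antidiagonal_zero, Finset.sum_singleton, hg, one_mul]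

theorem IsUnital.map {T : Matrix (Idx c n) (Idx c n) A⟦X⟧} (h : IsUnital T) (φ : A →+* B) :
    IsUnital (T.map (PowerSeries.map φ)) := by
  intro i j
  rw [Matrix.map_apply, PowerSeries.coeff_map, h i j, apply_ite φ, map_one, map_zero]

theorem IsUnital.genMatrix_eq {T : Matrix (Idx c n) (Idx c n) A⟦X⟧} (h : IsUnital T) :
    genMatrix (fun g : GenIdx c n => PowerSeries.coeff (g.2.2 + 1) (T g.1 g.2.1)) = T := by
  ext i j r
  cases r with
  | zero => rw [h i j]; simp [genMatrix]
  | succ r => simp [genMatrix]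

variable {T : Matrix (Idx c n) (Idx c n) A⟦X⟧}

theorem IsUnital.coeff_zero_zSeries (hn : 1 ≤ n) (h : IsUnital T) :
    PowerSeries.coeff 0 (zSeries T) = 1 := by
  have : ∀ i, PowerSeries.coeff 0 ((transShift T * T) i i) = 1 := fun i => by
    rw [Matrix.mul_apply, map_sum, Finset.sum_eq_single i]
    · simp only [transShift, Matrix.of_apply, PowerSeries.coeff_mul,
        Finset.Nat.antidiagonal_zero, Finset.sum_singleton, PowerSeries.coeff_smul,
        coeff_zero_seriesShift, h _ _, theta_self]
      simp
    · intro b _ hb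
      simp [PowerSeries.coeff_mul, h b i, hb]
    · simp
  rw [zSeries, PowerSeries.coeff_smul, Matrix.trace, map_sum]
  simp only [Matrix.diag, this, Finset.sum_const, Finset.card_univ, card_idx]
  rw [← Nat.cast_smul_eq_nsmul ℂ, smul_smul, inv_mul_cancel₀ (size_ne_zero hn), one_smul]

theorem map_transShift (φ : A →ₐ[ℂ] B) :
    transShift (T.map (PowerSeries.map (φ : A →+* B)))
      = (transShift T).map (PowerSeries.map (φ : A →+* B)) := by
  ext1 i j
  simp only [transShift, Matrix.of_apply, Matrix.map_apply, ← map_seriesShift]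
  ext m
  simp

theorem map_zSeries (φ : A →ₐ[ℂ] B) :
    zSeries (T.map (PowerSeries.map (φ : A →+* B)))
      = PowerSeries.map (φ : A →+* B) (zSeries T) := by
  have : ∀ M : Matrix (Idx c n) (Idx c n) A⟦X⟧, (M.map (PowerSeries.map (φ : A →+* B))).trace
      = PowerSeries.map (φ : A →+* B) M.trace := fun M => by
    simp [Matrix.trace]
  rw [zSeries, map_transShift, ← Matrix.map_mul, this, zSeries]
  ext m
  simp

theorem map_normalize (hn : 1 ≤ n) (h : IsUnital T) (φ : A →ₐ[ℂ] B) :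
    normalize (T.map (PowerSeries.map (φ : A →+* B)))
      = (normalize T).map (PowerSeries.map (φ : A →+* B)) := by
  have h0 := h.coeff_zero_zSeries hn
  have : PowerSeries.map (φ : A →+* B)
      (PowerSeries.invOfUnit (halfSeries (kappa c n) (zSeries T)) 1)
      = PowerSeries.invOfUnit (PowerSeries.map (φ : A →+* B)
        (halfSeries (kappa c n) (zSeries T))) 1 := by
    refine eq_invOfUnit ?_ ?_
    · rw [← PowerSeries.coeff_zero_eq_constantCoeff_apply, PowerSeries.coeff_map,
        coeff_zero_halfSeries, map_one]
    · rw [← map_mul, PowerSeries.invOfUnit_mul _ _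
        (by simpa using constantCoeff_halfSeries _ _), map_one]
  rw [normalize, map_zSeries, ← map_halfSeries _ _ h0, ← this, normalize]
  ext1 i j
  simp

theorem commute_of_coeff_left {g : A⟦X⟧} (hg : ∀ m x, Commute (PowerSeries.coeff m g) x) (κ : ℂ)
    (m : ℕ) (x : A) : Commute (PowerSeries.coeff m (seriesShift κ g)) x := by
  rw [seriesShift, PowerSeries.coeff_mk]
  exact Commute.sum_left _ _ _ fun r _ => (hg r x).smul_left _

/-- The normalization does not change under `T (u) ↦ g (u) T (u)`. -/
theorem normalize_smul (hn : 1 ≤ n) (h : IsUnital T) {g : A⟦X⟧}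
    (hg : ∀ m x, Commute (PowerSeries.coeff m g) x) (hg1 : PowerSeries.coeff 0 g = 1) :
    normalize (g • T) = normalize T := by
  have h0 := h.coeff_zero_zSeries hn
  have hg' : ∀ f, Commute g f := commute_of_coeff hg
  have hs : ∀ f, Commute (seriesShift (kappa c n) g) f :=
    commute_of_coeff (commute_of_coeff_left hg _)
  -- The scalar `z(u)` is multiplied by `g(u) g(u + κ)`. By uniqueness `y(u)` is then multiplied by
  -- `g(u)`, which cancels against the factor of `T(u)`.
  have hz : zSeries (g • T) = g * seriesShift (kappa c n) g * zSeries T := by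
    have e1 : transShift (g • T) = seriesShift (kappa c n) g • transShift T := by
      ext1 i j
      simp only [transShift, Matrix.of_apply, Matrix.smul_apply, smul_eq_mul, ← shiftHom_apply,
        map_mul, mul_smul_comm]
    rw [zSeries, e1, smul_mul_assoc, mul_smul_of_commute hg', smul_smul, Matrix.trace_smul,
      zSeries, smul_eq_mul, mul_smul_comm, (hg' _).eq]
  have hy : halfSeries (kappa c n) (zSeries (g • T))
      = g * halfSeries (kappa c n) (zSeries T) := by
    refine (eq_halfSeries _ _ _ ((h.smul hg1).coeff_zero_zSeries hn) ?_ ?_).symm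
    · simp [PowerSeries.coeff_mul, hg1, coeff_zero_halfSeries]
    · have hyz := halfSeries_mul_seriesShift (kappa c n) _ h0
      generalize halfSeries (kappa c n) (zSeries T) = y at hyz
      rw [hz, ← hyz, ← shiftHom_apply _ (g * _), map_mul, shiftHom_apply, shiftHom_apply,
        mul_assoc g, mul_assoc g, ← mul_assoc y, ← (hs _).eq, mul_assoc]
  have hy1 := constantCoeff_halfSeries (kappa c n) (zSeries T)
  have e : PowerSeries.invOfUnit (halfSeries (kappa c n) (zSeries T)) 1
      = PowerSeries.invOfUnit (halfSeries (kappa c n) (zSeries (g • T))) 1 * g := by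
    refine (eq_invOfUnit hy1 ?_).symm
    rw [mul_assoc, ← hy, PowerSeries.invOfUnit_mul _ _
      (by simpa using constantCoeff_halfSeries _ _)]
  rw [normalize, normalize, e, smul_smul]

theorem normalize_isUnital (h : IsUnital T) : IsUnital (normalize T) :=
  h.smul (by simp [PowerSeries.coeff_invOfUnit])

theorem normalize_isRTT (h : IsRTT T)
    (hz : ∀ m x, Commute (PowerSeries.coeff m (zSeries T)) x) : IsRTT (normalize T) := by
  refine h.smul fun m x => ?_
  have : PowerSeries.coeff m (PowerSeries.invOfUnit (halfSeries (kappa c n) (zSeries T)) 1)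
      ∈ Subalgebra.center ℂ A :=
    coeff_invOfUnit_mem _ (coeff_halfSeries_mem _ _ fun m =>
      Subalgebra.mem_center_iff.2 fun b => (hz m b).eq.symm) m
  exact (Subalgebra.mem_center_iff.1 this x).symm

/-- The normalized solution has the scalar `z(u) / (y(u) y(u + κ)) = 1`. In leading order this
relation becomes the symmetry of the `F_{ij}`. -/
theorem transShift_normalize_mul (hn : 1 ≤ n) (hκ : kappa c n ≠ 0) (h : IsRTT T) (h1 : IsUnital T)
    (hz : ∀ m x, Commute (PowerSeries.coeff m (zSeries T)) x) :
    transShift (normalize T) * normalize T = 1 := by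
  set w := PowerSeries.invOfUnit (halfSeries (kappa c n) (zSeries T)) 1 with hw
  have hwc : ∀ m x, Commute (PowerSeries.coeff m w) x := fun m x => by
    have : PowerSeries.coeff m w ∈ Subalgebra.center ℂ A :=
      coeff_invOfUnit_mem _ (coeff_halfSeries_mem _ _ fun m =>
        Subalgebra.mem_center_iff.2 fun b => (hz m b).eq.symm) m
    exact (Subalgebra.mem_center_iff.1 this x).symm
  have hwy : w * halfSeries (kappa c n) (zSeries T) = 1 :=
    PowerSeries.invOfUnit_mul _ _ (by simpa using constantCoeff_halfSeries _ _)
  have hs : ∀ f, Commute (seriesShift (kappa c n) w) f :=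
    commute_of_coeff (commute_of_coeff_left hwc _)
  have e1 : transShift (normalize T) = seriesShift (kappa c n) w • transShift T := by
    ext1 i j
    simp only [transShift, normalize, Matrix.of_apply, Matrix.smul_apply, smul_eq_mul,
      ← shiftHom_apply, map_mul, mul_smul_comm, ← hw]
  have hz0 := h1.coeff_zero_zSeries hn
  have key : seriesShift (kappa c n) w * w * zSeries T = 1 := by
    rw [← halfSeries_mul_seriesShift (kappa c n) _ hz0, mul_assoc, ← mul_assoc w, hwy, one_mul,
      ← shiftHom_apply, ← shiftHom_apply, ← map_mul, hwy, map_one]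
  have hsc : transShift T * T = Matrix.scalar (Idx c n) (zSeries T) := (h.transShift_mul hn hκ).1
  rw [e1, normalize, ← hw, smul_mul_assoc, mul_smul_of_commute (commute_of_coeff hwc), smul_smul,
    hsc, Matrix.scalar_apply]
  ext1 i j
  rw [Matrix.smul_apply, Matrix.diagonal_apply, Matrix.one_apply]
  split_ifs
  · rw [smul_eq_mul, key]
  · rw [smul_zero]

end Normalization

/-! ## The Yangian as a quotient and a subalgebra of the extended Yangian -/

theorem isRTT_T : IsRTT (T c n) := rtt_T c n

theorem isUnital_T : IsUnital (T c n) := fun i j => by simp [T, genMatrix]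

theorem coeff_T (i j : Idx c n) (m : ℕ) :
    PowerSeries.coeff (m + 1) (T c n i j) = gen c n (i, j, m) := by
  simp [T, genMatrix]

theorem adjoin_gen : Algebra.adjoin ℂ (Set.range (gen c n)) = ⊤ := by
  have : Set.range (gen c n) = proj c n '' Set.range (FreeAlgebra.ι ℂ) := by
    rw [← Set.range_comp]
    rfl
  rw [this, ← AlgHom.map_adjoin, FreeAlgebra.adjoin_range_ι, Algebra.map_top,
    AlgHom.range_eq_top]
  exact RingQuot.mkAlgHom_surjective ℂ _

theorem algHom_ext {φ ψ : ExtYangian c n →ₐ[ℂ] A} (h : ∀ g, φ (gen c n g) = ψ (gen c n g)) :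
    φ = ψ := by
  refine AlgHom.ext_of_adjoin_eq_top adjoin_gen ?_
  rintro _ ⟨g, rfl⟩
  exact h g

theorem commute_z (hn : 1 ≤ n) (hκ : kappa c n ≠ 0) (m : ℕ) (x : ExtYangian c n) :
    Commute (PowerSeries.coeff m (z c n)) x := by
  have hx : x ∈ Algebra.adjoin ℂ (Set.range (gen c n)) := by rw [adjoin_gen]; trivial
  have hsc : transShift (T c n) * T c n = Matrix.scalar (Idx c n) (z c n) :=
    (isRTT_T.transShift_mul hn hκ).1
  induction hx using Algebra.adjoin_induction with
  | mem x hx =>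
    obtain ⟨⟨i, j, s⟩, rfl⟩ := hx
    rw [← coeff_T]
    exact isRTT_T.commute_scalar hsc _ _ _ _
  | algebraMap r => exact (Algebra.commutes r _).symm
  | add x y _ _ hx hy => exact hx.add_right hy
  | mul x y _ _ hx hy => exact hx.mul_right hy

/-- The algebra homomorphism defined by a matrix solution of the `RTT`-relation. -/
def liftMatrix (M : Matrix (Idx c n) (Idx c n) A⟦X⟧) (h : IsRTT M) (h1 : IsUnital M) :
    ExtYangian c n →ₐ[ℂ] A :=
  lift (fun g => PowerSeries.coeff (g.2.2 + 1) (M g.1 g.2.1)) (by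
    rw [h1.genMatrix_eq]
    exact h)

theorem liftMatrix_gen (M : Matrix (Idx c n) (Idx c n) A⟦X⟧) (h : IsRTT M) (h1 : IsUnital M)
    (i j : Idx c n) (m : ℕ) :
    liftMatrix M h h1 (gen c n (i, j, m)) = PowerSeries.coeff (m + 1) (M i j) :=
  lift_gen _ _ _

theorem liftMatrix_T (M : Matrix (Idx c n) (Idx c n) A⟦X⟧) (h : IsRTT M) (h1 : IsUnital M) :
    (T c n).map (PowerSeries.map (liftMatrix M h h1 : ExtYangian c n →+* A)) = M := by
  ext i j r
  cases r with
  | zero =>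
    rw [h1 i j, Matrix.map_apply, PowerSeries.coeff_map, isUnital_T i j, RingHom.coe_coe,
      apply_ite (liftMatrix M h h1), map_one, map_zero]
  | succ r =>
    rw [Matrix.map_apply, PowerSeries.coeff_map, coeff_T]
    exact liftMatrix_gen M h h1 i j r

theorem normalize_T_map_scalar (hn : 1 ≤ n) (φ : ExtYangian c n →ₐ[ℂ] A)
    {M : Matrix (Idx c n) (Idx c n) A⟦X⟧} {g : A⟦X⟧}
    (hM : IsUnital M) (hg : ∀ m x, Commute (PowerSeries.coeff m g) x)
    (hg1 : PowerSeries.coeff 0 g = 1)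
    (h : (T c n).map (PowerSeries.map (φ : ExtYangian c n →+* A)) = g • M) :
    (normalize (T c n)).map (PowerSeries.map (φ : ExtYangian c n →+* A)) = normalize M := by
  rw [← map_normalize hn isUnital_T, h, normalize_smul hn hM hg hg1]

theorem mu_gen (f : ℂ⟦X⟧) (hf : PowerSeries.constantCoeff f = 1) (i j : Idx c n) (m : ℕ) :
    mu c n f hf (gen c n (i, j, m)) = PowerSeries.coeff (m + 1) (scaledT c n f i j) :=
  lift_gen _ _ _

theorem mu_T (f : ℂ⟦X⟧) (hf : PowerSeries.constantCoeff f = 1) :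
    (T c n).map (PowerSeries.map (mu c n f hf : ExtYangian c n →+* ExtYangian c n))
      = PowerSeries.map (algebraMap ℂ (ExtYangian c n)) f • T c n := by
  have h1 : IsUnital (scaledT c n f) := isUnital_T.smul (by
    rw [PowerSeries.coeff_map, PowerSeries.coeff_zero_eq_constantCoeff_apply, hf, map_one])
  exact liftMatrix_T (scaledT c n f) (rtt_scaledT c n f) h1

/-- The map `μ_f` multiplies `T(u)` by a scalar series, and the normalization is insensitive to
that. -/
theorem tauCoeff_mem_yangian (hn : 1 ≤ n) (i j : Idx c n) (m : ℕ) :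
    tauCoeff c n i j m ∈ yangian c n := by
  rw [yangian, Algebra.mem_iInf]
  rintro ⟨f, hf⟩
  rw [AlgHom.mem_equalizer]
  have := normalize_T_map_scalar hn (mu c n f hf) isUnital_T
    (fun m x => by rw [PowerSeries.coeff_map]; exact Algebra.commutes _ _)
    (by rw [PowerSeries.coeff_map, PowerSeries.coeff_zero_eq_constantCoeff_apply, hf, map_one])
    (mu_T f hf)
  have := congrArg (PowerSeries.coeff m) (congrFun (congrFun this i) j)
  rw [Matrix.map_apply, PowerSeries.coeff_map] at this
  exact this

/-- The homomorphism `T (u) ↦ y (u)⁻¹ T (u)`. -/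
def rho (hn : 1 ≤ n) (hκ : kappa c n ≠ 0) : ExtYangian c n →ₐ[ℂ] ExtYangian c n :=
  liftMatrix (normalize (T c n)) (normalize_isRTT isRTT_T (commute_z hn hκ))
    (normalize_isUnital isUnital_T)

theorem rho_gen (hn : 1 ≤ n) (hκ : kappa c n ≠ 0) (i j : Idx c n) (m : ℕ) :
    rho hn hκ (gen c n (i, j, m)) = tauCoeff c n i j (m + 1) :=
  liftMatrix_gen _ _ _ _ _ _

/-- The generic series `1 + x₀ u⁻¹ + x₁ u⁻² + …` -/
def genericSeries : (MvPolynomial ℕ ℂ)⟦X⟧ := PowerSeries.mk fun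
  | 0 => 1
  | m + 1 => MvPolynomial.X m

/-- The extended Yangian with polynomial coefficients. -/
abbrev Generic (c : ClassicalFamily) (n : ℕ) : Type := MvPolynomial ℕ ℂ ⊗[ℂ] ExtYangian c n

/-- The embedding of the polynomials. -/
abbrev genericLeft (c : ClassicalFamily) (n : ℕ) : MvPolynomial ℕ ℂ →ₐ[ℂ] Generic c n :=
  Algebra.TensorProduct.includeLeft

/-- The embedding of the extended Yangian. -/
abbrev genericRight (c : ClassicalFamily) (n : ℕ) : ExtYangian c n →ₐ[ℂ] Generic c n :=
  Algebra.TensorProduct.includeRight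

theorem commute_genericLeft_coeff (m : ℕ) (w : Generic c n) :
    Commute (PowerSeries.coeff m
      (PowerSeries.map (genericLeft c n : MvPolynomial ℕ ℂ →+* Generic c n) genericSeries)) w := by
  rw [PowerSeries.coeff_map]
  induction w using TensorProduct.induction_on with
  | zero => exact Commute.zero_right _
  | add x y hx hy => exact hx.add_right hy
  | tmul p x =>
    change (_ ⊗ₜ[ℂ] (1 : ExtYangian c n)) * (p ⊗ₜ[ℂ] x) = (p ⊗ₜ[ℂ] x) * (_ ⊗ₜ[ℂ] 1)
    rw [Algebra.TensorProduct.tmul_mul_tmul, Algebra.TensorProduct.tmul_mul_tmul, mul_comm,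
      one_mul, mul_one]

/-- The matrix `f (u) T (u)` for the generic series `f (u)`. -/
def genericScaled (c : ClassicalFamily) (n : ℕ) : Matrix (Idx c n) (Idx c n) (Generic c n)⟦X⟧ :=
  PowerSeries.map (genericLeft c n : MvPolynomial ℕ ℂ →+* Generic c n) genericSeries •
    (T c n).map (PowerSeries.map (genericRight c n : ExtYangian c n →+* Generic c n))

theorem genericScaled_isRTT : IsRTT (genericScaled c n) :=
  (isRTT_T.map (genericRight c n)).smul commute_genericLeft_coeff

theorem genericScaled_isUnital : IsUnital (genericScaled c n) := by
  refine (isUnital_T.map (genericRight c n : ExtYangian c n →+* Generic c n)).smul ?_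
  rw [PowerSeries.coeff_map, genericSeries, PowerSeries.coeff_mk]
  exact map_one _

/-- The homomorphism `T (u) ↦ f (u) T (u)` for the generic series `f (u)`. -/
def muGeneric (c : ClassicalFamily) (n : ℕ) : ExtYangian c n →ₐ[ℂ] Generic c n :=
  liftMatrix (genericScaled c n) genericScaled_isRTT genericScaled_isUnital

/-- The evaluation of polynomials, with values in the extended Yangian. -/
def evalGeneric (c : ClassicalFamily) (n : ℕ) (a : ℕ → ℂ) : MvPolynomial ℕ ℂ →ₐ[ℂ] ExtYangian c n :=
  (Algebra.ofId ℂ (ExtYangian c n)).comp (MvPolynomial.aeval a)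

theorem commute_evalGeneric (a : ℕ → ℂ) (p : MvPolynomial ℕ ℂ) (x : ExtYangian c n) :
    Commute (evalGeneric c n a p) x :=
  Algebra.commutes (MvPolynomial.aeval a p) x

/-- The specialization of the generic series. -/
def specialize (e : MvPolynomial ℕ ℂ →ₐ[ℂ] ExtYangian c n) (he : ∀ p x, Commute (e p) x) :
    Generic c n →ₐ[ℂ] ExtYangian c n :=
  Algebra.TensorProduct.lift e (AlgHom.id ℂ _) fun p x => he p x

theorem specialize_tmul (e : MvPolynomial ℕ ℂ →ₐ[ℂ] ExtYangian c n) (he : ∀ p x, Commute (e p) x)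
    (p : MvPolynomial ℕ ℂ) (x : ExtYangian c n) : specialize e he (p ⊗ₜ x) = e p * x :=
  Algebra.TensorProduct.lift_tmul e (AlgHom.id ℂ _) he p x

/-- The specialization `e` may be evaluation at complex numbers, which recovers `μ_f`, or at central
elements of the extended Yangian, which yields multiplication of `T(u)` by `y(u)⁻¹`. -/
theorem specialize_muGeneric (e : MvPolynomial ℕ ℂ →ₐ[ℂ] ExtYangian c n)
    (he : ∀ p x, Commute (e p) x) (i j : Idx c n) (m : ℕ) :
    specialize e he (muGeneric c n (gen c n (i, j, m))) =
      PowerSeries.coeff (m + 1) (PowerSeries.map (e : MvPolynomial ℕ ℂ →+* ExtYangian c n)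
        genericSeries * T c n i j) := by
  rw [muGeneric, liftMatrix_gen, genericScaled, Matrix.smul_apply, smul_eq_mul,
    PowerSeries.coeff_mul, PowerSeries.coeff_mul, map_sum]
  refine Finset.sum_congr rfl fun x _ => ?_
  rw [map_mul, Matrix.map_apply, PowerSeries.coeff_map, PowerSeries.coeff_map,
    PowerSeries.coeff_map]
  congr 1
  · change specialize e he (_ ⊗ₜ 1) = _
    rw [specialize_tmul, mul_one]
    rfl
  · change specialize e he (1 ⊗ₜ _) = _
    rw [specialize_tmul, map_one, one_mul]

/-- With respect to a basis of the extended Yangian over `ℂ` the coordinates of `w` are polynomials,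
and a polynomial over an infinite field that vanishes at all points is zero. -/
theorem eq_zero_of_specialize {w : Generic c n}
    (h : ∀ a : ℕ → ℂ, specialize (evalGeneric c n a) (commute_evalGeneric a) w = 0) : w = 0 := by
  let b := Module.Basis.ofVectorSpace ℂ (ExtYangian c n)
  let b' := Algebra.TensorProduct.basis (MvPolynomial ℕ ℂ) b
  have key : ∀ (a : ℕ → ℂ) w i, b.repr (specialize (evalGeneric c n a) (commute_evalGeneric a) w) i
        = MvPolynomial.aeval a (b'.repr w i) := by
    intro a w i
    induction w using TensorProduct.induction_on with
    | zero => simp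
    | add x y hx hy => simp only [map_add, Finsupp.add_apply, hx, hy]
    | tmul p x =>
      rw [specialize_tmul, Algebra.TensorProduct.basis_repr_tmul]
      simp [evalGeneric, Algebra.ofId_apply, ← Algebra.smul_def]
  refine b'.repr.map_eq_zero_iff.1 (Finsupp.ext fun i => MvPolynomial.funext fun a => ?_)
  have := key a w i
  rw [h a] at this
  simpa [MvPolynomial.aeval_eq_eval] using this.symm

/-- Invariance under `μ_f` is polynomial in the coefficients of `f`. Holding for all complex values,
it holds with indeterminate coefficients. -/
theorem muGeneric_of_mem {x : ExtYangian c n} (hx : x ∈ yangian c n) :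
    muGeneric c n x = 1 ⊗ₜ x := by
  rw [← sub_eq_zero]
  refine eq_zero_of_specialize fun a => ?_
  let f : ℂ⟦X⟧ := PowerSeries.map (MvPolynomial.aeval a : MvPolynomial ℕ ℂ →ₐ[ℂ] ℂ).toRingHom
    genericSeries
  have hf : PowerSeries.constantCoeff f = 1 := by
    simp [f, genericSeries, ← PowerSeries.coeff_zero_eq_constantCoeff_apply]
  have hcomp : (specialize (evalGeneric c n a) (commute_evalGeneric a)).comp (muGeneric c n)
      = mu c n f hf := by
    refine algHom_ext ?_
    rintro ⟨i, j, m⟩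
    rw [AlgHom.comp_apply, specialize_muGeneric, mu_gen, scaledT, Matrix.smul_apply, smul_eq_mul]
    rfl
  have h1 : mu c n f hf x = x := by
    have := (Algebra.mem_iInf.1 hx) ⟨f, hf⟩
    exact this
  rw [map_sub, ← AlgHom.comp_apply, hcomp, h1, specialize_tmul,
    map_one, one_mul, sub_self]

/-- `T (u) ↦ y (u)⁻¹ T (u)` is the identity on the Yangian. -/
theorem rho_of_mem (hn : 1 ≤ n) (hκ : kappa c n ≠ 0) {x : ExtYangian c n} (hx : x ∈ yangian c n) :
    rho hn hκ x = x := by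
  let w := PowerSeries.invOfUnit (y c n) 1
  have hw : ∀ m, PowerSeries.coeff m w ∈ Subalgebra.center ℂ (ExtYangian c n) := fun m =>
    coeff_invOfUnit_mem _ (coeff_halfSeries_mem _ _ fun m =>
      Subalgebra.mem_center_iff.2 fun b => (commute_z hn hκ m b).eq.symm) m
  -- The coefficients of `y(u)⁻¹` take the place of the indeterminate coefficients of `f`; they are
  -- central, so the evaluation is a homomorphism to the centre.
  let e : MvPolynomial ℕ ℂ →ₐ[ℂ] ExtYangian c n := (Subalgebra.center ℂ (ExtYangian c n)).val.comp
    (MvPolynomial.aeval fun m => (⟨PowerSeries.coeff (m + 1) w, hw (m + 1)⟩ :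
      Subalgebra.center ℂ (ExtYangian c n)))
  have he : ∀ p x, Commute (e p) x := fun p x =>
    (Subalgebra.mem_center_iff.1 (Subtype.prop (MvPolynomial.aeval (fun m =>
      (⟨PowerSeries.coeff (m + 1) w, hw (m + 1)⟩ : Subalgebra.center ℂ (ExtYangian c n))) p)) x).symm
  have hw2 : PowerSeries.map (e : MvPolynomial ℕ ℂ →+* ExtYangian c n) genericSeries = w := by
    ext m
    cases m with
    | zero => simp [genericSeries, w, PowerSeries.coeff_invOfUnit]
    | succ m => simp [genericSeries, e]
  have hcomp : (specialize e he).comp (muGeneric c n) = rho hn hκ := by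
    refine algHom_ext ?_
    rintro ⟨i, j, m⟩
    rw [AlgHom.comp_apply, specialize_muGeneric, rho_gen, hw2]
    rfl
  rw [← hcomp, AlgHom.comp_apply, muGeneric_of_mem hx, specialize_tmul, map_one, one_mul]

/-- The elements of the Yangian of degree at most `d` are combinations of monomials of degree at
most `d` in the generators `τ_{ij}^{(r)}`. -/
theorem mem_span_tau (hn : 1 ≤ n) (hκ : kappa c n ≠ 0) {x : ExtYangian c n} (hx : x ∈ yangian c n)
    {d : ℕ} (hd : x ∈ (filtX c n).toFun d) :
    x ∈ Submodule.span ℂ {x | ∃ l : List (GenIdx c n), (l.map fun g => g.2.2).sum ≤ d ∧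
      x = (l.map fun g => tauCoeff c n g.1 g.2.1 (g.2.2 + 1)).prod} := by
  rw [← rho_of_mem hn hκ hx]
  -- The homomorphism `rho` fixes `x` and takes a monomial in the `t_{ij}^{(r)}` to the
  -- corresponding one in the `τ_{ij}^{(r)}`. A presentation of `x` within degree `d` is therefore
  -- rewritten without raising the degree.
  have := Submodule.mem_map_of_mem (f := (rho hn hκ).toLinearMap) hd
  rw [filtX, Submodule.map_span] at this
  refine Submodule.span_mono ?_ this
  rintro _ ⟨_, ⟨l, hl, rfl⟩, rfl⟩
  refine ⟨l, hl, ?_⟩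
  rw [AlgHom.toLinearMap_apply, map_list_prod, List.map_map]
  congr 1
  refine List.map_congr_left fun g _ => ?_
  exact rho_gen hn hκ _ _ _

end ClassicalFamily

end

noncomputable section

/-! ## Filtrations indexed by the integers -/

/-- An ascending algebra filtration indexed by the integers. -/
structure IntFiltration (A : Type*) [Ring A] [Algebra ℂ A] where
  deg : ℤ → Submodule ℂ A
  mono : Monotone deg
  one_mem : (1 : A) ∈ deg 0
  mul_mem : ∀ {i j : ℤ} {a b : A}, a ∈ deg i → b ∈ deg j → a * b ∈ deg (i + j)

namespace IntFiltration

variable {A : Type*} [Ring A] [Algebra ℂ A]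

/-- The extension of a filtration by zero. -/
def ofAlg (F : AlgFiltration ℂ A) : IntFiltration A where
  deg e := if 0 ≤ e then F.toFun e.toNat else ⊥
  mono i j h := by
    dsimp only
    split_ifs with h1 h2
    · exact F.mono (by omega)
    · omega
    · exact bot_le
    · exact le_rfl
  one_mem := F.one_mem
  mul_mem {i j a b} ha hb := by
    split_ifs at ha hb with h1 h2 h2
    · rw [if_pos (by omega), show (i + j).toNat = i.toNat + j.toNat by omega]
      exact F.mul_mem ha hb
    · rw [(Submodule.mem_bot ℂ).1 hb, mul_zero]
      exact zero_mem _
    · rw [(Submodule.mem_bot ℂ).1 ha, zero_mul]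
      exact zero_mem _
    · rw [(Submodule.mem_bot ℂ).1 ha, zero_mul]
      exact zero_mem _

theorem mem_ofAlg_natCast (F : AlgFiltration ℂ A) {d : ℕ} {a : A} :
    a ∈ (ofAlg F).deg d ↔ a ∈ F.toFun d := by simp [ofAlg]

theorem mem_ofAlg_sub_one (F : AlgFiltration ℂ A) {d : ℕ} {a : A} :
    a ∈ (ofAlg F).deg (d - 1) ↔ a ∈ F.below d := by
  cases d with
  | zero => simp [ofAlg, AlgFiltration.below]
  | succ d =>
    rw [Nat.cast_succ, add_sub_cancel_right, mem_ofAlg_natCast]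
    rfl

variable (G : IntFiltration A)

theorem mul_mem_of_le {i j e : ℤ} (h : i + j ≤ e) {a b : A} (ha : a ∈ G.deg i) (hb : b ∈ G.deg j) :
    a * b ∈ G.deg e := G.mono h (G.mul_mem ha hb)

/-- The filtration of the series in `u⁻¹` where `u⁻¹` has degree `-1`. -/
def series : IntFiltration A⟦X⟧ where
  deg e :=
    { carrier := {f | ∀ r : ℕ, PowerSeries.coeff r f ∈ G.deg (r + e)}
      add_mem' := fun hf hg r => by
        rw [map_add]
        exact add_mem (hf r) (hg r)
      zero_mem' := fun r => by
        rw [map_zero]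
        exact zero_mem _
      smul_mem' := fun a f hf r => by
        rw [PowerSeries.coeff_smul]
        exact Submodule.smul_mem _ _ (hf r) }
  mono _ _ h f hf r := G.mono (by omega) (hf r)
  one_mem r := by
    rw [PowerSeries.coeff_one]
    split_ifs
    · exact G.mono (by omega) G.one_mem
    · exact zero_mem _
  mul_mem {i j f g} hf hg r := by
    rw [PowerSeries.coeff_mul]
    refine sum_mem fun x hx => G.mul_mem_of_le ?_ (hf _) (hg _)
    have := Finset.HasAntidiagonal.mem_antidiagonal.1 hx
    omega

variable {G}

theorem seriesShift_mem {e : ℤ} {f : A⟦X⟧} (κ : ℂ) (hf : f ∈ G.series.deg e) :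
    seriesShift κ f ∈ G.series.deg e := by
  intro m
  rw [coeff_seriesShift]
  refine add_mem (sum_mem fun r hr => Submodule.smul_mem _ _ (G.mono ?_ (hf r))) (hf m)
  have := Finset.mem_range.1 hr
  omega

/-- The coefficient of `u⁻ᵐ` in `f(u + κ) - f(u)` involves only coefficients of `f` of index less
than `m`, so one degree is gained. -/
theorem seriesShift_sub_mem {e : ℤ} {f : A⟦X⟧} (κ : ℂ) (hf : f ∈ G.series.deg e) :
    seriesShift κ f - f ∈ G.series.deg (e - 1) := by
  intro m
  rw [map_sub, coeff_seriesShift, add_sub_cancel_right]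
  refine sum_mem fun r hr => Submodule.smul_mem _ _ (G.mono ?_ (hf r))
  have := Finset.mem_range.1 hr
  omega

/-- With `w = y - 1` the equation reads `z - 1 = w(u) + w(u + κ) + w(u) w(u + κ)`. It expresses
twice the coefficient `w_r` through `z_r` and coefficients of `w` of smaller index. -/
theorem halfSeries_mem {f : A⟦X⟧} (κ : ℂ) (hf : f - 1 ∈ G.series.deg (-1))
    (hf0 : PowerSeries.coeff 0 f = 1) : halfSeries κ f - 1 ∈ G.series.deg (-1) := by
  have hy := halfSeries_mul_seriesShift κ f hf0
  have h0 : PowerSeries.coeff 0 (halfSeries κ f - 1) = 0 := by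
    rw [map_sub, coeff_zero_halfSeries, PowerSeries.coeff_one, if_pos rfl, sub_self]
  set w := halfSeries κ f - 1 with hw
  have hf' : f - 1 = w + seriesShift κ w + w * seriesShift κ w := by
    rw [← hy, show halfSeries κ f = 1 + w by rw [hw]; abel, ← shiftHom_apply, map_add, map_one,
      shiftHom_apply]
    noncomm_ring
  intro r
  induction r using Nat.strong_induction_on with
  | _ r ih =>
    have key := congrArg (PowerSeries.coeff r) hf'
    rw [map_add, map_add, coeff_seriesShift, PowerSeries.coeff_mul] at key
    have e1 : ∑ s ∈ Finset.range r, PowerSeries.coeff r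
        ((PowerSeries.X * (1 + PowerSeries.C κ * PowerSeries.X)⁻¹) ^ s : ℂ⟦X⟧)
        • PowerSeries.coeff s w ∈ G.deg (r + -1) := by
      refine sum_mem fun s hs => Submodule.smul_mem _ _ (G.mono ?_ (ih s (Finset.mem_range.1 hs)))
      have := Finset.mem_range.1 hs
      omega
    have e2 : ∑ x ∈ Finset.HasAntidiagonal.antidiagonal r,
        PowerSeries.coeff x.1 w * PowerSeries.coeff x.2 (seriesShift κ w) ∈ G.deg (r + -1) := by
      refine sum_mem fun x hx => ?_
      have hx' := Finset.HasAntidiagonal.mem_antidiagonal.1 hx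
      -- Since `w` has no constant term, both factors of every nonzero product have index strictly
      -- less than `r`.
      rcases Nat.eq_zero_or_pos x.1 with h | h
      · rw [h, h0, zero_mul]
        exact zero_mem _
      rcases Nat.eq_zero_or_pos x.2 with h' | h'
      · rw [h', coeff_zero_seriesShift, h0, mul_zero]
        exact zero_mem _
      refine G.mul_mem_of_le (i := x.1 + -1) (j := x.2 + -1) (by omega) (ih _ (by omega)) ?_
      rw [coeff_seriesShift]
      refine add_mem (sum_mem fun s hs => Submodule.smul_mem _ _ (G.mono ?_ (ih s ?_)))
        (ih _ (by omega))
      · have := Finset.mem_range.1 hs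
        omega
      · have := Finset.mem_range.1 hs
        omega
    have e3 : PowerSeries.coeff r w = (1 / 2 : ℂ) • (PowerSeries.coeff r (f - 1)
        - ∑ s ∈ Finset.range r, PowerSeries.coeff r
          ((PowerSeries.X * (1 + PowerSeries.C κ * PowerSeries.X)⁻¹) ^ s : ℂ⟦X⟧)
          • PowerSeries.coeff s w
        - ∑ x ∈ Finset.HasAntidiagonal.antidiagonal r,
          PowerSeries.coeff x.1 w * PowerSeries.coeff x.2 (seriesShift κ w)) := by
      rw [key]
      module
    rw [e3]
    exact Submodule.smul_mem _ _ (sub_mem (sub_mem (hf r) e1) e2)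

/-- The shift and the quadratic term affect only degree `-2`, so `y - 1` is half of `z - 1` in
leading order. -/
theorem halfSeries_sub_mem {f : A⟦X⟧} (κ : ℂ) (hf : f - 1 ∈ G.series.deg (-1))
    (hf0 : PowerSeries.coeff 0 f = 1) :
    halfSeries κ f - 1 - (1 / 2 : ℂ) • (f - 1) ∈ G.series.deg (-2) := by
  have hw := halfSeries_mem κ hf hf0
  have hy := halfSeries_mul_seriesShift κ f hf0
  generalize halfSeries κ f = y at hw hy
  have h1 := seriesShift_sub_mem κ hw
  have h2 := G.series.mul_mem hw (seriesShift_mem κ hw)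
  have : y - 1 - (1 / 2 : ℂ) • (f - 1) = -(1 / 2 : ℂ) •
      ((seriesShift κ (y - 1) - (y - 1)) + (y - 1) * seriesShift κ (y - 1)) := by
    rw [← hy, ← shiftHom_apply, ← shiftHom_apply, map_sub, map_one, mul_sub, sub_mul, mul_one,
      one_mul]
    module
  rw [this]
  exact Submodule.smul_mem _ _ (add_mem h1 h2)

theorem invOfUnit_mem {f : A⟦X⟧} (hf : f - 1 ∈ G.series.deg (-1))
    (hf0 : PowerSeries.constantCoeff f = 1) :
    PowerSeries.invOfUnit f 1 - 1 ∈ G.series.deg (-1) := by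
  have hy := PowerSeries.invOfUnit_mul f 1 (by simpa using hf0)
  have h0 : PowerSeries.coeff 0 (f - 1) = 0 := by simp [hf0]
  generalize PowerSeries.invOfUnit f 1 = y at hy
  have hy' : y - 1 = -(f - 1) - (y - 1) * (f - 1) := by
    rw [mul_sub, sub_mul, hy]
    noncomm_ring
  generalize f - 1 = w at hy' hf h0
  generalize y - 1 = x at hy'
  intro r
  induction r using Nat.strong_induction_on with
  | _ r ih =>
    rw [hy', map_sub, map_neg, PowerSeries.coeff_mul]
    refine sub_mem (neg_mem (hf r)) (sum_mem fun p hp => ?_)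
    have hp' := Finset.HasAntidiagonal.mem_antidiagonal.1 hp
    rcases Nat.eq_zero_or_pos p.2 with h | h
    · rw [h, h0, mul_zero]
      exact zero_mem _
    · exact G.mul_mem_of_le (by omega) (ih p.1 (by omega)) (hf p.2)

theorem invOfUnit_add_mem {f : A⟦X⟧} (hf : f - 1 ∈ G.series.deg (-1))
    (hf0 : PowerSeries.constantCoeff f = 1) :
    PowerSeries.invOfUnit f 1 - 1 + (f - 1) ∈ G.series.deg (-2) := by
  have h := G.series.mul_mem (invOfUnit_mem hf hf0) hf
  have hy := PowerSeries.invOfUnit_mul f 1 (by simpa using hf0)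
  have : PowerSeries.invOfUnit f 1 - 1 + (f - 1)
      = -((PowerSeries.invOfUnit f 1 - 1) * (f - 1)) := by
    rw [mul_sub, sub_mul, hy]
    noncomm_ring
  rw [this]
  exact neg_mem h

end IntFiltration

namespace ClassicalFamily

open IntFiltration

variable {c : ClassicalFamily} {n : ℕ} {A : Type*} [Ring A] [Algebra ℂ A] {G : IntFiltration A}
  {T : Matrix (Idx c n) (Idx c n) A⟦X⟧}

/-! ## The leading terms of a solution of the `RTT`-relation -/

/-- Linearization of `Tᵗ(u+κ) T(u)` at `T = 1`: the term quadratic in `T - 1` has degree `-2`, and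
dropping the shift in the linear term costs an error of degree `-2`. -/
theorem transShift_mul_sub_mem (hT : ∀ i j, (T - 1) i j ∈ G.series.deg (-1)) (i j : Idx c n) :
    (transShift T * T - 1) i j - ((T - 1) i j + theta i j • (T - 1) (-j) (-i))
      ∈ G.series.deg (-2) := by
  have h1 : transShift T = 1 + transShift (T - 1) := by
    ext1 k l
    have hkl : (-k = -l) = (k = l) := by
      rw [Idx.neg_eq_iff, Idx.neg_neg]
    simp only [transShift, Matrix.add_apply, Matrix.of_apply, Matrix.sub_apply, ← shiftHom_apply,
      map_sub, Matrix.one_apply, eq_comm (a := -l), hkl]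
    split_ifs with h
    · subst h
      simp [theta_self]
    · simp
  have h2 : (transShift T * T - 1) i j - ((T - 1) i j + theta i j • (T - 1) (-j) (-i))
      = theta i j • (seriesShift (kappa c n) ((T - 1) (-j) (-i)) - (T - 1) (-j) (-i))
        + (transShift (T - 1) * (T - 1) : Matrix (Idx c n) (Idx c n) A⟦X⟧) i j := by
    have : transShift T * T - 1 = (T - 1) + transShift (T - 1)
        + transShift (T - 1) * (T - 1) := by
      rw [h1]
      noncomm_ring
    have e : transShift (T - 1) i j
        = theta i j • seriesShift (kappa c n) ((T - 1) (-j) (-i)) := rfl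
    rw [this, Matrix.add_apply, Matrix.add_apply, e, smul_sub]
    abel
  rw [h2]
  refine add_mem (Submodule.smul_mem _ _ (seriesShift_sub_mem _ (hT _ _))) ?_
  rw [Matrix.mul_apply]
  exact sum_mem fun m _ => G.series.mul_mem
    (Submodule.smul_mem _ _ (seriesShift_mem _ (hT _ _))) (hT _ _)

theorem zSeries_sub_mem (hn : 1 ≤ n) (hκ : kappa c n ≠ 0) (h : IsRTT T)
    (hT : ∀ i j, (T - 1) i j ∈ G.series.deg (-1)) : zSeries T - 1 ∈ G.series.deg (-1) := by
  have hc : 0 < Fintype.card (Idx c n) := by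
    have := size_ne_zero (c := c) hn
    rw [card_idx]
    exact Nat.pos_of_ne_zero (by exact_mod_cast this)
  obtain ⟨i⟩ := Fintype.card_pos_iff.1 hc
  have h1 := transShift_mul_sub_mem hT i i
  rw [(h.transShift_mul hn hκ).1] at h1
  have h2 := add_mem (G.series.mono (show (-2 : ℤ) ≤ -1 by norm_num) h1)
    (add_mem (hT i i) (Submodule.smul_mem _ (theta i i) (hT (-i) (-i))))
  simpa [zSeries] using h2

/-- Write `E = T - 1`. In leading order the normalization subtracts `(z - 1)/2` on the diagonal, and
the scalar matrix `z - 1` equals `E_{ij} + θ_{ij} E_{-j,-i}`. The difference is the projection of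
`𝔤𝔩_N` onto `𝔞`. -/
theorem normalize_sub_mem (hn : 1 ≤ n) (hκ : kappa c n ≠ 0) (h : IsRTT T) (h1 : IsUnital T)
    (hT : ∀ i j, (T - 1) i j ∈ G.series.deg (-1)) (i j : Idx c n) :
    (normalize T - 1) i j - (1 / 2 : ℂ) • ((T - 1) i j - theta i j • (T - 1) (-j) (-i))
      ∈ G.series.deg (-2) := by
  have hz := zSeries_sub_mem hn hκ h hT
  have hz0 := h1.coeff_zero_zSeries hn
  have hy := halfSeries_mem (kappa c n) hz hz0
  have hy0 := constantCoeff_halfSeries (kappa c n) (zSeries T)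
  have hw := G.series.mul_mem (invOfUnit_mem hy hy0) (hT i j)
  have hw' := add_mem (invOfUnit_add_mem hy hy0)
    (neg_mem (halfSeries_sub_mem (kappa c n) hz hz0))
  have hs := transShift_mul_sub_mem hT i j
  rw [(h.transShift_mul hn hκ).1, ← zSeries] at hs
  rw [normalize]
  generalize PowerSeries.invOfUnit (halfSeries (kappa c n) (zSeries T)) 1 = w at hw hw' ⊢
  have e : (w • T - 1) i j - (1 / 2 : ℂ) • ((T - 1) i j - theta i j • (T - 1) (-j) (-i))
      = (w - 1) * (T - 1) i j + (if i = j then (w - 1 + (halfSeries (kappa c n) (zSeries T) - 1)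
        + -(halfSeries (kappa c n) (zSeries T) - 1 - (1 / 2 : ℂ) • (zSeries T - 1))) else 0)
        - (1 / 2 : ℂ) • ((Matrix.scalar (Idx c n) (zSeries T) - 1 :
          Matrix (Idx c n) (Idx c n) A⟦X⟧) i j
          - ((T - 1) i j + theta i j • (T - 1) (-j) (-i))) := by
    have : (w • T - 1) i j = (w - 1) * (T - 1) i j + (T - 1) i j + if i = j then w - 1 else 0 := by
      simp only [Matrix.sub_apply, Matrix.smul_apply, smul_eq_mul, Matrix.one_apply]
      split_ifs <;> noncomm_ring
    rw [this, Matrix.sub_apply (Matrix.scalar _ _), Matrix.scalar_apply, Matrix.diagonal_apply,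
      Matrix.one_apply]
    split_ifs
    · module
    · module
  rw [e]
  refine sub_mem (add_mem hw ?_) (Submodule.smul_mem _ _ hs)
  split_ifs
  · exact hw'
  · exact zero_mem _

theorem normalize_sub_one_mem (hn : 1 ≤ n) (hκ : kappa c n ≠ 0) (h : IsRTT T) (h1 : IsUnital T)
    (hT : ∀ i j, (T - 1) i j ∈ G.series.deg (-1)) (i j : Idx c n) :
    (normalize T - 1) i j ∈ G.series.deg (-1) := by
  have := add_mem (G.series.mono (show (-2 : ℤ) ≤ -1 by norm_num)
    (normalize_sub_mem hn hκ h h1 hT i j)) (Submodule.smul_mem _ (1 / 2 : ℂ)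
      (sub_mem (hT i j) (Submodule.smul_mem _ (theta i j) (hT (-j) (-i)))))
  simpa using this

/-- The linear part of the relation `Tᵗ(u+κ) T(u) = 1`. -/
theorem antisymm_mem (hT : ∀ i j, (T - 1) i j ∈ G.series.deg (-1)) (h : transShift T * T = 1)
    (i j : Idx c n) : (T - 1) i j + theta i j • (T - 1) (-j) (-i) ∈ G.series.deg (-2) := by
  have := transShift_mul_sub_mem hT i j
  rw [h, sub_self, Matrix.zero_apply, zero_sub] at this
  exact neg_mem_iff.1 this

end ClassicalFamily

end

noncomputable section

namespace ClassicalFamily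

open IntFiltration

variable {c : ClassicalFamily} {n : ℕ} {A : Type*} [Ring A] [Algebra ℂ A] {G : IntFiltration A}
  {T : Matrix (Idx c n) (Idx c n) A⟦X⟧}

/-! ## Leading terms of the commutators -/

theorem inU_mem {e : ℤ} {f : A⟦X⟧} (hf : f ∈ G.series.deg e) : inU f ∈ G.series.series.deg e := by
  intro s
  rw [inU, PowerSeries.coeff_C]
  split_ifs
  · exact G.series.mono (by omega) hf
  · exact zero_mem _

theorem inV_mem {e : ℤ} {f : A⟦X⟧} (hf : f ∈ G.series.deg e) : inV f ∈ G.series.series.deg e := by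
  intro s r
  rw [inV, PowerSeries.coeff_map, PowerSeries.coeff_C]
  split_ifs
  · exact G.mono (by omega) (hf s)
  · exact zero_mem _

theorem X_mem : (PowerSeries.X : A⟦X⟧) ∈ G.series.deg (-1) := by
  intro r
  rw [PowerSeries.coeff_X]
  split_ifs
  · exact G.mono (by omega) G.one_mem
  · exact zero_mem _

theorem uInv_mem : uInv A ∈ G.series.series.deg (-1) := inU_mem X_mem

theorem vInv_mem : vInv A ∈ G.series.series.deg (-1) := X_mem

theorem den₁_mem : den₁ A ∈ G.series.series.deg (-1) := sub_mem vInv_mem uInv_mem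

theorem uvInv_mem : uInv A * vInv A ∈ G.series.series.deg (-2) :=
  G.series.series.mul_mem_of_le (by norm_num) uInv_mem vInv_mem

theorem den₂_mem : den₂ c n A ∈ G.series.series.deg (-1) :=
  sub_mem den₁_mem (Submodule.smul_mem _ _ (G.series.series.mono (by norm_num) uvInv_mem))

theorem coeff_uInv_mul (f : A⟦X⟧⟦X⟧) (r s : ℕ) :
    PowerSeries.coeff r (PowerSeries.coeff s (uInv A * f)) =
      if r = 0 then 0 else PowerSeries.coeff (r - 1) (PowerSeries.coeff s f) := by
  rw [uInv, PowerSeries.coeff_C_mul]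
  cases r with
  | zero => simp
  | succ r => simp [PowerSeries.coeff_succ_X_mul]

theorem coeff_vInv_mul (f : A⟦X⟧⟦X⟧) (r s : ℕ) :
    PowerSeries.coeff r (PowerSeries.coeff s (vInv A * f)) =
      if s = 0 then 0 else PowerSeries.coeff r (PowerSeries.coeff (s - 1) f) := by
  rw [vInv]
  cases s with
  | zero => simp
  | succ s => simp [PowerSeries.coeff_succ_X_mul]

/-- In the product, the coefficient at `u⁻ʳ v⁻⁽ˢ⁺¹⁾` is the coefficient of `f` at `u⁻ʳ v⁻ˢ` plus
terms with exponent `r - 1` of `u⁻¹`, so the coefficients of `f` are recovered by induction on `r`.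
Division by `u - v - κ` in cleared form thus raises the degree by just one. -/
theorem mem_of_den_mul_mem (κ : ℂ) {f : A⟦X⟧⟦X⟧} {e : ℤ}
    (h : (den₁ A - κ • (uInv A * vInv A)) * f ∈ G.series.series.deg (e - 1)) :
    f ∈ G.series.series.deg e := by
  have key : ∀ r s : ℕ, PowerSeries.coeff r (PowerSeries.coeff s f) ∈ G.deg (r + (s + e)) := by
    intro r
    induction r with
    | zero =>
      intro s
      have := h (s + 1) 0
      rw [sub_mul, smul_mul_assoc, den₁, sub_mul, mul_assoc, map_sub, map_sub, map_sub, map_sub,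
        PowerSeries.coeff_smul, PowerSeries.coeff_smul, coeff_vInv_mul, coeff_uInv_mul,
        coeff_uInv_mul] at this
      simp only [Nat.add_sub_cancel, if_true, smul_zero, sub_zero, Nat.add_eq_zero_iff,
        one_ne_zero, and_false, if_false] at this
      exact G.mono (by push_cast; omega) this
    | succ r ih =>
      intro s
      have := h (s + 1) (r + 1)
      rw [sub_mul, smul_mul_assoc, den₁, sub_mul, mul_assoc, map_sub, map_sub, map_sub, map_sub,
        PowerSeries.coeff_smul, PowerSeries.coeff_smul, coeff_vInv_mul, coeff_uInv_mul,
        coeff_uInv_mul, coeff_vInv_mul] at this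
      simp only [Nat.add_sub_cancel, Nat.add_eq_zero_iff, one_ne_zero, and_false,
        if_false] at this
      have h1 := add_mem this (add_mem (G.mono (show _ ≤ ((r + 1 : ℕ) : ℤ) +
        (((s + 1 : ℕ) : ℤ) + (e - 1)) by push_cast; omega) (ih (s + 1)))
        (Submodule.smul_mem _ κ (G.mono (show _ ≤ ((r + 1 : ℕ) : ℤ) +
        (((s + 1 : ℕ) : ℤ) + (e - 1)) by push_cast; omega) (ih s))))
      have h2 : ∀ x y z : A, x - y - z + (y + z) = x := fun x y z => by abel
      rw [h2] at h1
      exact G.mono (by push_cast; omega) h1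
  exact fun s r => key r s

theorem mem_of_den₁_mul_mem {f : A⟦X⟧⟦X⟧} {e : ℤ} (h : den₁ A * f ∈ G.series.series.deg (e - 1)) :
    f ∈ G.series.series.deg e :=
  mem_of_den_mul_mem 0 (by rwa [zero_smul, sub_zero])

theorem mem_of_den₂_mul_mem {f : A⟦X⟧⟦X⟧} {e : ℤ}
    (h : den₂ c n A * f ∈ G.series.series.deg (e - 1)) : f ∈ G.series.series.deg e :=
  mem_of_den_mul_mem (kappa c n) h

/-- The series `(f (v) - f (u)) / (u - v)`. -/
def divDiff (f : A⟦X⟧) : A⟦X⟧⟦X⟧ := PowerSeries.mk fun s => PowerSeries.mk fun r =>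
  if r = 0 ∨ s = 0 then 0 else PowerSeries.coeff (r + s - 1) f

theorem coeff_divDiff (f : A⟦X⟧) (r s : ℕ) : PowerSeries.coeff r (PowerSeries.coeff s (divDiff f)) =
    if r = 0 ∨ s = 0 then 0 else PowerSeries.coeff (r + s - 1) f := by
  rw [divDiff, PowerSeries.coeff_mk, PowerSeries.coeff_mk]

/-- Telescoping: `(v⁻ᵐ - u⁻ᵐ) / (u - v)` is the sum of `u⁻ʳ v⁻ˢ` over `r, s ≥ 1` with `r + s = m +
1`. -/
theorem den₁_mul_divDiff (f : A⟦X⟧) :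
    den₁ A * divDiff f = uInv A * vInv A * (inV f - inU f) := by
  ext s r
  have hU : ∀ r s, PowerSeries.coeff r (PowerSeries.coeff s (inU f))
      = if s = 0 then PowerSeries.coeff r f else 0 := fun r s => by
    rw [inU, PowerSeries.coeff_C]
    split_ifs <;> simp
  have hV : ∀ r s, PowerSeries.coeff r (PowerSeries.coeff s (inV f))
      = if r = 0 then PowerSeries.coeff s f else 0 := fun r s => by
    rw [inV, PowerSeries.coeff_map, PowerSeries.coeff_C]
  rw [den₁, sub_mul, mul_assoc, map_sub, map_sub, coeff_vInv_mul, coeff_uInv_mul, coeff_uInv_mul,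
    coeff_vInv_mul, coeff_divDiff, coeff_divDiff, map_sub, map_sub, hU, hV]
  rcases r with _ | _ | r <;> rcases s with _ | _ | s <;> simp
  rw [show r + 1 + 1 + s = r + 1 + (s + 1) by omega, sub_self]

theorem divDiff_mem {f : A⟦X⟧} {e : ℤ} (hf : f ∈ G.series.deg e) :
    divDiff f ∈ G.series.series.deg (e - 1) := by
  intro s r
  rw [coeff_divDiff]
  split_ifs with h
  · exact zero_mem _
  · exact G.mono (by omega) (hf _)

theorem smul_inU (a : ℂ) (f : A⟦X⟧) : inU (a • f) = a • inU f := by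
  ext1 s
  rw [PowerSeries.coeff_smul, inU, PowerSeries.coeff_C, PowerSeries.coeff_C]
  split_ifs
  · rfl
  · rw [smul_zero]

theorem smul_inV (a : ℂ) (f : A⟦X⟧) : inV (a • f) = a • inV f := by
  ext s r
  rw [PowerSeries.coeff_smul, PowerSeries.coeff_smul, inV, PowerSeries.coeff_map,
    PowerSeries.coeff_map, PowerSeries.coeff_smul, PowerSeries.coeff_C, PowerSeries.coeff_C]
  split_ifs
  · rfl
  · rw [smul_zero]

/-- The main terms of the commutator `[t_{ij} (u), t_{kl} (v)]`. -/
def commLead (E : Idx c n → Idx c n → A⟦X⟧) (i j k l : Idx c n) : A⟦X⟧⟦X⟧ :=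
  ((if k = j then divDiff (E i l) else 0) - (if i = l then divDiff (E k j) else 0))
    - ((if k = -i then theta i j • divDiff (E (-j) l) else 0)
      - (if l = -j then theta i j • divDiff (E k (-i)) else 0))

/-- Here `x₁ - y₁` is the commutator and `x₂ - y₂`, `x₃ - y₃` come from `P` and `Q`. The `Q`-terms
carry the denominator `d`, the `P`-terms the denominator `a`. The relation `a - d = κ p` trades one
for the other, so that all leading terms are divided differences over `u - v`, at the price of the
last term on the right. -/
theorem reduce_commutator {R : Type*} [Ring R] [Algebra ℂ R] {a d p : R} {κ : ℂ}
    (hp : ∀ x, Commute p x) (ha : ∀ x, Commute a x) (hda : a - d = κ • p)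
    {x₁ x₂ x₃ y₁ y₂ y₃ g₀ g h₀ w DG DH : R}
    (key : a * d * x₁ - p * d * x₂ + p * a * x₃ = a * d * y₁ - p * d * y₂ + p * a * y₃)
    (hG : x₂ - y₂ = g₀ + g) (hH : x₃ - y₃ = h₀ + w) (eG : p * g₀ = a * DG) (eH : p * h₀ = a * DH) :
    a * (d * (x₁ - y₁ - (DG - DH))) = p * d * g - p * a * w - κ • (a * p * DH) := by
  have e1 : a * d * (x₁ - y₁) = p * d * (x₂ - y₂) - p * a * (x₃ - y₃) := by
    rw [← sub_eq_zero] at key ⊢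
    rw [← key]
    noncomm_ring
  rw [← mul_assoc, mul_sub, e1, hG, hH, mul_add (p * d), mul_add (p * a), (hp d).eq, mul_assoc d p,
    eG, (hp a).eq, mul_assoc a p, eH, ← mul_assoc d a, ← (ha d).eq, mul_sub (a * d) DG,
    ← smul_mul_assoc, ← mul_smul_comm, ← hda]
  noncomm_ring

theorem reduced_mem {R : Type*} [Ring R] [Algebra ℂ R] {G₂ : IntFiltration R} {a d p g w D : R}
    {κ : ℂ} (hp : p ∈ G₂.deg (-2)) (ha : a ∈ G₂.deg (-1)) (hd : d ∈ G₂.deg (-1))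
    (hg : g ∈ G₂.deg (-2)) (hw : w ∈ G₂.deg (-2)) (hD : D ∈ G₂.deg (-2)) :
    p * d * g - p * a * w - κ • (a * p * D) ∈ G₂.deg (-3 - 1 - 1) := by
  refine sub_mem (sub_mem ?_ ?_) (Submodule.smul_mem _ _ ?_)
  · exact G₂.mul_mem_of_le (i := -3) (by norm_num) (G₂.mul_mem_of_le (by norm_num) hp hd) hg
  · exact G₂.mul_mem_of_le (i := -3) (by norm_num) (G₂.mul_mem_of_le (by norm_num) hp ha) hw
  · exact G₂.mul_mem_of_le (i := -3) (by norm_num) (G₂.mul_mem_of_le (by norm_num) ha hp) hD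

/-- Put `T = 1 + E` and expand. Products of two entries of `E` have degree `-2`; after
multiplication by `u⁻¹ v⁻¹` and division by a denominator they only reach degree `-3`. The terms
linear in `E` combine into differences `E(v) - E(u)`, which the division turns into `divDiff`. -/
theorem commutator_sub_mem (h : IsRTT T) (hT : ∀ i j, (T - 1) i j ∈ G.series.deg (-1))
    (ha : ∀ i j, (T - 1) i j + theta i j • (T - 1) (-j) (-i) ∈ G.series.deg (-2))
    (i j k l : Idx c n) :
    inU (T i j) * inV (T k l) - inV (T k l) * inU (T i j) - commLead (T - 1) i j k l
      ∈ G.series.series.deg (-3) := by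
  set G₂ := G.series.series with hG₂
  set E : Matrix (Idx c n) (Idx c n) A⟦X⟧ := T - 1 with hE
  set a := den₁ A with ha'
  set d := den₂ c n A with hd'
  set p := uInv A * vInv A with hp'
  have hTE : ∀ i j, T i j = (if i = j then 1 else 0) + E i j := fun i j => by
    rw [hE, Matrix.sub_apply, Matrix.one_apply]
    abel
  have hUV : ∀ i j k l, inU (E i j) * inV (E k l) ∈ G₂.deg (-2) := fun i j k l =>
    G₂.mul_mem_of_le (by norm_num) (inU_mem (hT i j)) (inV_mem (hT k l))
  have hVU : ∀ i j k l, inV (E k l) * inU (E i j) ∈ G₂.deg (-2) := fun i j k l =>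
    G₂.mul_mem_of_le (by norm_num) (inV_mem (hT k l)) (inU_mem (hT i j))
  have hTu : ∀ i j, inU (T i j) = (if i = j then 1 else 0) + inU (E i j) := fun i j => by
    rw [hTE, map_add, apply_ite inU, map_one, map_zero]
  have hTv : ∀ i j, inV (T i j) = (if i = j then 1 else 0) + inV (E i j) := fun i j => by
    rw [hTE, map_add, apply_ite inV, map_one, map_zero]
  -- the terms with `P`
  obtain ⟨g, hg, hG⟩ : ∃ g ∈ G₂.deg (-2), inU (T k j) * inV (T i l) - inV (T k j) * inU (T i l)
      = (if k = j then inV (E i l) - inU (E i l) else 0)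
        - (if i = l then inV (E k j) - inU (E k j) else 0) + g := by
    refine ⟨_, sub_mem (hUV k j i l) (hVU i l k j), ?_⟩
    rw [hTu, hTv, hTu, hTv]
    split_ifs <;> noncomm_ring
  -- the terms with `Q`
  obtain ⟨h₁, hh₁, hH₁⟩ : ∃ h₁ ∈ G₂.deg (-2), ∑ m, theta i m • (inU (T m j) * inV (T (-m) l))
      = (if l = -j then theta i j • 1 else 0) + theta i j • (inV (E (-j) l) - inU (E (-j) l))
        + h₁ := by
    -- The sum produces `E_{-j,l}` at `v` but `E_{-l,j}` at `u`. Antisymmetry replaces `θ_{i,-l}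
    -- E_{-l,j}(u)` by `-θ_{ij} E_{-j,l}(u)` up to degree `-2`, which completes the difference.
    have hx := inU_mem (Submodule.smul_mem _ (theta i (-l)) (ha (-l) j))
    refine ⟨_, add_mem hx (sum_mem (t := Finset.univ) fun m _ =>
      Submodule.smul_mem _ (theta i m) (hUV m j (-m) l)), ?_⟩
    have e1 : ∀ m, inU (T m j) * inV (T (-m) l) = (if m = j then inV (T (-m) l) else 0)
        + (if m = -l then inU (E m j) else 0) + inU (E m j) * inV (E (-m) l) := fun m => by
      simp only [hTu, hTv, Idx.neg_eq_iff]
      split_ifs <;> noncomm_ring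
    simp only [e1, smul_add, Finset.sum_add_distrib, smul_ite, smul_zero, Finset.sum_ite_eq',
      Finset.mem_univ, if_true]
    rw [hTv, smul_add, map_add, smul_inU, smul_inU, smul_inU, smul_smul, theta_mul_theta,
      Idx.neg_neg]
    simp only [eq_comm (a := l)]
    split_ifs
    · module
    · module
  obtain ⟨h₂, hh₂, hH₂⟩ : ∃ h₂ ∈ G₂.deg (-2), ∑ m, theta m j • (inV (T k (-m)) * inU (T i m))
      = (if k = -i then theta i j • 1 else 0) + theta i j • (inV (E k (-i)) - inU (E k (-i)))
        + h₂ := by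
    have hx := inU_mem (Submodule.smul_mem _ (theta (-k) j) (ha i (-k)))
    refine ⟨_, add_mem hx (sum_mem (t := Finset.univ) fun m _ =>
      Submodule.smul_mem _ (theta m j) (hVU i m k (-m))), ?_⟩
    have e1 : ∀ m, inV (T k (-m)) * inU (T i m) = (if i = m then inV (T k (-m)) else 0)
        + (if -k = m then inU (E i m) else 0) + inV (E k (-m)) * inU (E i m) := fun m => by
      simp only [hTu, hTv, Idx.neg_eq_iff]
      split_ifs <;> noncomm_ring
    simp only [e1, smul_add, Finset.sum_add_distrib, smul_ite, smul_zero, Finset.sum_ite_eq,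
      Finset.mem_univ, if_true]
    rw [hTv, smul_add, map_add, smul_inU, smul_inU, smul_inU, smul_smul,
      mul_comm (theta (-k) j), theta_mul_theta, Idx.neg_neg]
    split_ifs
    · module
    · module
  -- The constant terms of the two sums cancel: each survives precisely when both `k = -i` and `l =
  -- -j`.
  have hH : ∃ w ∈ G₂.deg (-2),
      (if k = -i then ∑ m, theta i m • (inU (T m j) * inV (T (-m) l)) else 0)
      - (if l = -j then ∑ m, theta m j • (inV (T k (-m)) * inU (T i m)) else 0)
      = (if k = -i then theta i j • (inV (E (-j) l) - inU (E (-j) l)) else 0)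
        - (if l = -j then theta i j • (inV (E k (-i)) - inU (E k (-i))) else 0) + w := by
    rw [hH₁, hH₂]
    refine ⟨(if k = -i then h₁ else 0) - (if l = -j then h₂ else 0), sub_mem ?_ ?_, ?_⟩
    · split_ifs
      exacts [hh₁, zero_mem _]
    · split_ifs
      exacts [hh₂, zero_mem _]
    · split_ifs <;> module
  obtain ⟨w, hw, hH⟩ := hH
  set DG : A⟦X⟧⟦X⟧ := (if k = j then divDiff (E i l) else 0)
    - (if i = l then divDiff (E k j) else 0) with hDG
  set DH : A⟦X⟧⟦X⟧ := (if k = -i then theta i j • divDiff (E (-j) l) else 0)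
      - (if l = -j then theta i j • divDiff (E k (-i)) else 0) with hDH
  have eG : p * ((if k = j then inV (E i l) - inU (E i l) else 0)
        - (if i = l then inV (E k j) - inU (E k j) else 0)) = a * DG := by
    rw [hDG, mul_sub, mul_sub, mul_ite, mul_ite, mul_ite, mul_ite, ha', den₁_mul_divDiff,
      den₁_mul_divDiff, mul_zero, mul_zero]
  have eH : p * ((if k = -i then theta i j • (inV (E (-j) l) - inU (E (-j) l)) else 0)
        - (if l = -j then theta i j • (inV (E k (-i)) - inU (E k (-i))) else 0)) = a * DH := by
    rw [hDH, mul_sub, mul_sub, mul_ite, mul_ite, mul_ite, mul_ite, mul_smul_comm, mul_smul_comm,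
      mul_smul_comm, mul_smul_comm, ha', den₁_mul_divDiff, den₁_mul_divDiff, mul_zero, mul_zero]
  have hD : ∀ i j, divDiff (E i j) ∈ G₂.deg (-2) := fun i j =>
    G₂.mono (by norm_num) (divDiff_mem (hT i j))
  have hDHm : DH ∈ G₂.deg (-2) := by
    refine sub_mem ?_ ?_ <;> split_ifs
    exacts [Submodule.smul_mem _ _ (hD _ _), zero_mem _,
      Submodule.smul_mem _ _ (hD _ _), zero_mem _]
  have key := isRTT_iff.1 h i k j l
  rw [rttLeft_apply, rttRight_apply, ← ha', ← hd', ← hp'] at key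
  have hda : a - d = kappa c n • p := by
    rw [hd', den₂, ← den₁, ← ha', ← hp']
    abel
  have main := reduce_commutator (fun x => commute_uvInv x) (fun x => commute_den₁ x) hda key hG hH
    eG eH
  have mem1 := reduced_mem (G₂ := G₂) (κ := kappa c n) uvInv_mem den₁_mem
    (den₂_mem (c := c) (n := n)) hg hw hDHm
  rw [← main] at mem1
  exact mem_of_den₂_mul_mem (mem_of_den₁_mul_mem mem1)

/-- The commutation relations in leading order. -/
theorem coeff_commutator_sub_mem (h : IsRTT T) (hT : ∀ i j, (T - 1) i j ∈ G.series.deg (-1))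
    (ha : ∀ i j, (T - 1) i j + theta i j • (T - 1) (-j) (-i) ∈ G.series.deg (-2))
    (i j k l : Idx c n) (r s : ℕ) :
    ⁅PowerSeries.coeff (r + 1) (T i j), PowerSeries.coeff (s + 1) (T k l)⁆ -
      (((if k = j then PowerSeries.coeff (r + s + 1) (T i l) else 0)
        - (if i = l then PowerSeries.coeff (r + s + 1) (T k j) else 0))
      - ((if k = -i then theta i j • PowerSeries.coeff (r + s + 1) (T (-j) l) else 0)
        - (if l = -j then theta i j • PowerSeries.coeff (r + s + 1) (T k (-i)) else 0)))
      ∈ G.deg (r + s - 1) := by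
  have key := commutator_sub_mem h hT ha i j k l (s + 1) (r + 1)
  have hE : ∀ i j, PowerSeries.coeff (r + 1) (PowerSeries.coeff (s + 1) (divDiff ((T - 1) i j)))
      = PowerSeries.coeff (r + s + 1) (T i j) := fun i j => by
    rw [coeff_divDiff, if_neg (by omega), Matrix.sub_apply, map_sub, Matrix.one_apply,
      show r + 1 + (s + 1) - 1 = r + s + 1 by omega]
    split_ifs <;> simp [PowerSeries.coeff_one]
  have e1 : ∀ f g : A⟦X⟧, PowerSeries.coeff (r + 1) (PowerSeries.coeff (s + 1) (inU f * inV g))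
      = PowerSeries.coeff (r + 1) f * PowerSeries.coeff (s + 1) g := fun f g => by
    rw [inU, inV, PowerSeries.coeff_C_mul, PowerSeries.coeff_map, PowerSeries.coeff_mul_C]
  have e2 : ∀ f g : A⟦X⟧, PowerSeries.coeff (r + 1) (PowerSeries.coeff (s + 1) (inV g * inU f))
      = PowerSeries.coeff (s + 1) g * PowerSeries.coeff (r + 1) f := fun f g => by
    rw [inU, inV, PowerSeries.coeff_mul_C, PowerSeries.coeff_map, PowerSeries.coeff_C_mul]
  have e3 : ∀ (P : Prop) [Decidable P] (x : A⟦X⟧⟦X⟧), PowerSeries.coeff (r + 1)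
      (PowerSeries.coeff (s + 1) (if P then x else 0))
        = if P then PowerSeries.coeff (r + 1) (PowerSeries.coeff (s + 1) x) else 0 :=
    fun P _ x => by split_ifs <;> simp
  simp only [commLead, map_sub, e1, e2, e3, PowerSeries.coeff_smul] at key
  erw [hE, hE, hE, hE] at key
  rw [Ring.lie_def]
  have hle : ((r + 1 : ℕ) : ℤ) + (((s + 1 : ℕ) : ℤ) + -3) ≤ r + s - 1 := by
    push_cast
    omega
  exact G.mono hle key

end ClassicalFamily

end

noncomputable section

/-! ## The Yang–Baxter equation -/

/-- The relations of the Brauer algebra with three strands, in a quotient where the generators of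
the second pair of strands are conjugate to those of the first pair. -/
structure BrauerRelations {K M : Type*} [CommRing K] [Ring M] [Algebra K M] (σ N : K)
    (s t q : M) : Prop where
  ss : s * s = 1
  tt : t * t = 1
  tst : t * (s * t) = s * (t * s)
  sq : s * q = σ • q
  qs : q * s = σ • q
  qq : q * q = N • q
  qtq : q * (t * q) = q

/-- With `s = P₁₂`, `t = P₂₃` and `q = Q₁₂` the remaining operators are conjugates: `P₁₃ = s t s`,
`Q₁₃ = t q t` and `Q₂₃ = s (t q t) s`. Both sides are reduced to combinations of words by the Brauer
relations, and then coefficients are compared. The elements `U`, `V` stand for `u⁻¹`, `v⁻¹`, and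
`a`, `b` for the cleared differences with the third spectral parameter. -/
theorem BrauerRelations.yangBaxter {K M : Type*} [CommRing K] [Ring M] [Algebra K M] {σ N κ : K}
    {s t q : M} (h : BrauerRelations σ N s t q) (hσ : σ = 1 ∨ σ = -1) (hN : N = 2 * κ + 2 * σ)
    (U V a b : K) :
    let a' := a - κ * U
    let b' := b - κ * V
    let p := U * V
    let x := a * V - b * U
    let x' := x - κ * p
    let R₁₂ := (x * x') • (1 : M) - (p * x') • s + (p * x) • q
    let R₁₃ := (a * a') • (1 : M) - (U * a') • (s * t * s) + (U * a) • (t * q * t)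
    let R₂₃ := (b * b') • (1 : M) - (V * b') • t + (V * b) • (s * (t * q * t) * s)
    R₁₂ * R₁₃ * R₂₃ = R₂₃ * R₁₃ * R₁₂ := by
  obtain ⟨ss, tt, tst, sq, qs, qq, qtq⟩ := h
  -- The relations multiplied by an arbitrary element on the right, so that they also apply inside
  -- longer words.
  have ss' : ∀ z, s * (s * z) = z := fun z => by rw [← mul_assoc, ss, one_mul]
  have tt' : ∀ z, t * (t * z) = z := fun z => by rw [← mul_assoc, tt, one_mul]
  have tst' : ∀ z, t * (s * (t * z)) = s * (t * (s * z)) := fun z => by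
    have := congrArg (· * z) tst
    simpa only [mul_assoc] using this
  have sq' : ∀ z, s * (q * z) = σ • (q * z) := fun z => by rw [← mul_assoc, sq, smul_mul_assoc]
  have qs' : ∀ z, q * (s * z) = σ • (q * z) := fun z => by rw [← mul_assoc, qs, smul_mul_assoc]
  have qq' : ∀ z, q * (q * z) = N • (q * z) := fun z => by rw [← mul_assoc, qq, smul_mul_assoc]
  have qtq' : ∀ z, q * (t * (q * z)) = q * z := fun z => by
    have := congrArg (· * z) qtq
    simpa only [mul_assoc] using this
  intro a' b' p x x' R₁₂ R₁₃ R₂₃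
  simp only [R₁₂, R₁₃, R₂₃, mul_add, add_mul, mul_sub, sub_mul, smul_mul_smul_comm, mul_one,
    one_mul, mul_assoc]
  simp only [ss, tt, tst, sq, qs, qq, qtq, ss', tt', tst', sq', qs', qq', qtq', smul_smul,
    mul_smul_comm, mul_one, mul_assoc]
  simp only [x', x, a', b', p]
  -- The comparison of coefficients needs `σ² = 1`, so the two signs are substituted separately.
  rcases hσ with rfl | rfl
  · subst hN
    module
  · subst hN
    module

end

noncomputable section

namespace ClassicalFamily

variable {c : ClassicalFamily} {n : ℕ} {A B : Type*} [Ring A] [Algebra ℂ A] [Ring B] [Algebra ℂ B]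

/-! ## The vector representation -/

/-- A system of matrix units, indexed by the indices of the vector representation. -/
structure IsMatrixUnits {R : Type*} [Ring R] (E : Idx c n → Idx c n → R) : Prop where
  mul : ∀ i j k l, E i j * E k l = if j = k then E i l else 0
  sum : ∑ i, E i i = 1

variable {E : Idx c n → Idx c n → A⟦X⟧⟦X⟧}

/-- The permutation operator of the second and third tensor factors. -/
def permTwoThree (E : Idx c n → Idx c n → A⟦X⟧⟦X⟧) :
    Matrix (Idx c n × Idx c n) (Idx c n × Idx c n) A⟦X⟧⟦X⟧ :=
  Matrix.of fun p q => if p.1 = q.1 then E q.2 p.2 else 0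

theorem permTwoThree_mul_apply (M : Matrix (Idx c n × Idx c n) (Idx c n × Idx c n) A⟦X⟧⟦X⟧)
    (i k : Idx c n) (q : Idx c n × Idx c n) :
    (permTwoThree E * M) (i, k) q = ∑ m, E m k * M (i, m) q := by
  rw [Matrix.mul_apply, Fintype.sum_prod_type, Finset.sum_eq_single i]
  · simp [permTwoThree]
  · intro b _ hb
    simp [permTwoThree, hb.symm]
  · simp

theorem map_smul_map (x : ℂ) (m : Matrix (Idx c n × Idx c n) (Idx c n × Idx c n) ℂ) :
    (x • m).map (algebraMap ℂ A⟦X⟧⟦X⟧)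
      = algebraMap ℂ A⟦X⟧⟦X⟧ x • m.map (algebraMap ℂ A⟦X⟧⟦X⟧) := by
  ext1 i j
  exact map_mul (algebraMap ℂ A⟦X⟧⟦X⟧) _ _

theorem opP_mul_permTwoThree_mul_opP_apply (i k j l : Idx c n) :
    ((opP c n).map (algebraMap ℂ A⟦X⟧⟦X⟧) * permTwoThree E *
      (opP c n).map (algebraMap ℂ A⟦X⟧⟦X⟧)) (i, k) (j, l) = if k = l then E j i else 0 := by
  rw [mul_opP_apply, opP_mul_apply]
  simp [permTwoThree]

theorem IsMatrixUnits.permTwoThree_mul_opQ_mul_apply (h : IsMatrixUnits E) (i k j l : Idx c n) :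
    (permTwoThree E * (opQ c n).map (algebraMap ℂ A⟦X⟧⟦X⟧) * permTwoThree E) (i, k) (j, l)
      = if k = l then theta i j • E (-i) (-j) else 0 := by
  rw [mul_assoc, permTwoThree_mul_apply, Finset.sum_eq_single (-i)]
  · rw [opQ_mul_apply, if_pos rfl, Finset.sum_eq_single j]
    · simp [permTwoThree, h.mul]
    · intro b _ hb
      simp [permTwoThree, hb]
    · simp
  · intro b _ hb
    rw [opQ_mul_apply, if_neg hb, mul_zero]
  · simp

theorem IsMatrixUnits.opP_mul_mul_opP_apply (h : IsMatrixUnits E) (i k j l : Idx c n) :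
    ((opP c n).map (algebraMap ℂ A⟦X⟧⟦X⟧) *
      (permTwoThree E * (opQ c n).map (algebraMap ℂ A⟦X⟧⟦X⟧) * permTwoThree E) *
      (opP c n).map (algebraMap ℂ A⟦X⟧⟦X⟧)) (i, k) (j, l)
      = if i = j then theta k l • E (-k) (-l) else 0 := by
  rw [mul_opP_apply, opP_mul_apply, h.permTwoThree_mul_opQ_mul_apply]

theorem IsMatrixUnits.permTwoThree_mul_self (h : IsMatrixUnits E) :
    permTwoThree E * permTwoThree E = 1 := by
  ext1 ⟨i, k⟩ ⟨j, l⟩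
  rw [permTwoThree_mul_apply]
  by_cases h1 : i = j <;> by_cases h2 : k = l <;>
    simp [permTwoThree, h.mul, Matrix.one_apply, h1, h2, h.sum]

theorem IsMatrixUnits.braid (h : IsMatrixUnits E) :
    permTwoThree E * ((opP c n).map (algebraMap ℂ A⟦X⟧⟦X⟧) * permTwoThree E)
      = (opP c n).map (algebraMap ℂ A⟦X⟧⟦X⟧) *
        (permTwoThree E * (opP c n).map (algebraMap ℂ A⟦X⟧⟦X⟧)) := by
  ext1 ⟨i, k⟩ ⟨j, l⟩
  rw [← mul_assoc ((opP c n).map _), opP_mul_permTwoThree_mul_opP_apply, permTwoThree_mul_apply,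
    Finset.sum_eq_single j]
  · simp [opP_mul_apply, permTwoThree, h.mul]
  · intro b _ hb
    simp [opP_mul_apply, permTwoThree, hb]
  · simp

/-- The sum between the two copies of `Q` straightens to `∑ E_{mm} = 1`. -/
theorem IsMatrixUnits.opQ_mul_mul_opQ (h : IsMatrixUnits E) :
    (opQ c n).map (algebraMap ℂ A⟦X⟧⟦X⟧) *
      (permTwoThree E * (opQ c n).map (algebraMap ℂ A⟦X⟧⟦X⟧))
      = (opQ c n).map (algebraMap ℂ A⟦X⟧⟦X⟧) := by
  ext1 ⟨i, k⟩ ⟨j, l⟩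
  rw [opQ_mul_apply, Matrix.map_apply, opQ_apply]
  have : ∀ m, (permTwoThree E * (opQ c n).map (algebraMap ℂ A⟦X⟧⟦X⟧)) (m, -m) (j, l)
      = if l = -j then theta m j • E (-m) (-m) else 0 := fun m => by
    rw [mul_opQ_apply]
    congr 1
    rw [Finset.sum_eq_single m]
    · simp [permTwoThree]
    · intro b _ hb
      simp [permTwoThree, hb.symm]
    · simp
  simp only [this]
  by_cases h1 : k = -i <;> by_cases h2 : l = -j <;> simp only [h1, h2, if_true, if_false, smul_zero,
    Finset.sum_const_zero, and_true, and_false, and_self, map_zero, smul_smul, theta_mul_theta]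
  rw [← Finset.smul_sum, sum_neg fun m => E m m, h.sum, Algebra.algebraMap_eq_smul_one]

/-- The cleared form of the solution `1 - P / (u - a) + Q / (u - a - κ)` of the `RTT`-relation. -/
def vectorCleared (E : Idx c n → Idx c n → A) (a : A) : Matrix (Idx c n) (Idx c n) A⟦X⟧ :=
  let α : A⟦X⟧ := 1 - PowerSeries.C a * PowerSeries.X
  let α' : A⟦X⟧ := α - kappa c n • PowerSeries.X
  Matrix.of fun i j => (if i = j then α * α' else 0)
    - PowerSeries.X * α' * PowerSeries.C (E j i)
    + theta i j • (PowerSeries.X * α * PowerSeries.C (E (-i) (-j)))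

/-- This is the Yang–Baxter equation for `R₁₂(u - v)`, `R₁₃(u - a)`, `R₂₃(v - a)`, with the third
tensor factor absorbed into the coefficient ring through the matrix units `E`. -/
theorem vectorCleared_isRTT {E : Idx c n → Idx c n → A} (hE : IsMatrixUnits E) {a : A}
    (ha : ∀ x, Commute a x) : IsRTT (vectorCleared E a) := by
  -- The central element `a` is the image of an indeterminate, so the scalars of the identity live
  -- in a commutative ring.
  let φ : ℂ[X] →ₐ[ℂ] A := Polynomial.aeval a
  have hφ : ∀ p x, Commute (φ p) x := fun p x => by
    induction p using Polynomial.induction_on' with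
    | add p q hp hq =>
      rw [map_add]
      exact hp.add_left hq
    | monomial m r =>
      rw [Polynomial.aeval_monomial]
      exact Commute.mul_left (Algebra.commutes r x) ((ha x).pow_left m)
  let _ := scalarAlgebra φ hφ (Idx c n × Idx c n)
  let M := Matrix (Idx c n × Idx c n) (Idx c n × Idx c n) A⟦X⟧⟦X⟧
  have hs : ∀ (x : ℂ[X]⟦X⟧⟦X⟧) (m : M), x • m = map₂ φ x • m :=
    fun x m => scalarAlgebra_smul φ hφ x m
  let E₂ : Idx c n → Idx c n → A⟦X⟧⟦X⟧ := fun i j => inU (PowerSeries.C (E i j))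
  have hE₂ : IsMatrixUnits E₂ := by
    constructor
    · intro i j k l
      simp only [E₂]
      rw [← map_mul, ← map_mul, hE.mul]
      split_ifs
      · rfl
      · rw [map_zero, map_zero]
    · simp only [E₂]
      rw [← map_sum, ← map_sum, hE.sum, map_one, map_one]
  have hmap : ∀ (x : ℂ) (m : Matrix (Idx c n × Idx c n) (Idx c n × Idx c n) ℂ),
      (x • m).map (algebraMap ℂ A⟦X⟧⟦X⟧)
        = algebraMap ℂ ℂ[X]⟦X⟧⟦X⟧ x • (m.map (algebraMap ℂ A⟦X⟧⟦X⟧) : M) := by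
    intro x m
    rw [hs, map₂_algebraMap, map_smul_map]
  let s : M := (opP c n).map (algebraMap ℂ A⟦X⟧⟦X⟧)
  let q : M := (opQ c n).map (algebraMap ℂ A⟦X⟧⟦X⟧)
  let t : M := permTwoThree E₂
  have hB : BrauerRelations (algebraMap ℂ ℂ[X]⟦X⟧⟦X⟧ (sgn c))
      (algebraMap ℂ ℂ[X]⟦X⟧⟦X⟧ (size c n)) s t q :=
    { ss := by
        rw [← Matrix.map_mul, opP_mul_opP, Matrix.map_one _ (map_zero _) (map_one _)]
      tt := hE₂.permTwoThree_mul_self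
      tst := hE₂.braid
      sq := by rw [← Matrix.map_mul, opP_mul_opQ, hmap]
      qs := by rw [← Matrix.map_mul, opQ_mul_opP, hmap]
      qq := by rw [← Matrix.map_mul, opQ_mul_opQ, hmap]
      qtq := hE₂.opQ_mul_mul_opQ }
  have hσ : algebraMap ℂ ℂ[X]⟦X⟧⟦X⟧ (sgn c) = 1 ∨ algebraMap ℂ ℂ[X]⟦X⟧⟦X⟧ (sgn c) = -1 := by
    unfold sgn
    split_ifs
    · exact Or.inr (by rw [map_neg, map_one])
    · exact Or.inl (map_one _)
  let κ : ℂ[X]⟦X⟧⟦X⟧ := algebraMap ℂ _ (kappa c n)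
  have hN : algebraMap ℂ ℂ[X]⟦X⟧⟦X⟧ (size c n)
      = 2 * κ + 2 * algebraMap ℂ ℂ[X]⟦X⟧⟦X⟧ (sgn c) := by
    rw [← kappa_eq, map_add, map_mul, map_mul, map_ofNat]
  let U : ℂ[X]⟦X⟧⟦X⟧ := uInv ℂ[X]
  let V : ℂ[X]⟦X⟧⟦X⟧ := vInv ℂ[X]
  let τ : ℂ[X]⟦X⟧⟦X⟧ := inU (PowerSeries.C Polynomial.X)
  -- The differences `u - τ` and `v - τ` are cleared to `1 - τ u⁻¹` and `1 - τ v⁻¹`; the combination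
  -- playing the role of `u - v` is then `v⁻¹ - u⁻¹`, independent of `τ`.
  have key := hB.yangBaxter hσ hN U V (1 - τ * U) (1 - τ * V)
  have hx : (1 - τ * U) * V - (1 - τ * V) * U = den₁ ℂ[X] := by
    rw [den₁]
    ring
  have hx' : den₁ ℂ[X] - κ * (U * V) = den₂ c n ℂ[X] := by rw [den₂, Algebra.smul_def]; rfl
  have hU : map₂ φ U = uInv A := map₂_uInv φ
  have hV : map₂ φ V = vInv A := map₂_vInv φ
  have hτ : map₂ φ τ = inU (PowerSeries.C a) := by
    simp only [τ, inU, PowerSeries.map_C]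
    rw [RingHom.coe_coe, Polynomial.aeval_X]
  have hκ : map₂ φ κ = algebraMap ℂ A⟦X⟧⟦X⟧ (kappa c n) := map₂_algebraMap φ _
  simp only [hx, hx', hs, map_mul (map₂ φ), map_sub (map₂ φ), map_one, map₂_den₁, map₂_den₂, hκ,
    hU, hV, hτ] at key
  have hR : clearedR c n A = (den₁ A * den₂ c n A) • (1 : M)
      - (uInv A * vInv A * den₂ c n A) • s + (uInv A * vInv A * den₁ A) • q := rfl
  rw [← hR] at key
  have h1 : T₁ (vectorCleared E a) = ((1 - inU (PowerSeries.C a) * uInv A) *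
      (1 - inU (PowerSeries.C a) * uInv A - algebraMap ℂ A⟦X⟧⟦X⟧ (kappa c n) * uInv A)) • (1 : M)
      - (uInv A * (1 - inU (PowerSeries.C a) * uInv A - algebraMap ℂ A⟦X⟧⟦X⟧ (kappa c n) * uInv A)) • (s * t * s)
      + (uInv A * (1 - inU (PowerSeries.C a) * uInv A)) • (t * q * t) := by
    ext1 ⟨i, k⟩ ⟨j, l⟩
    have e1 : (s * t * s) (i, k) (j, l) = _ := opP_mul_permTwoThree_mul_opP_apply i k j l
    have e2 : (t * q * t) (i, k) (j, l) = _ := hE₂.permTwoThree_mul_opQ_mul_apply i k j l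
    have e0 : (1 : M) (i, k) (j, l) = if (i, k) = (j, l) then 1 else 0 := Matrix.one_apply
    have e3 : inU PowerSeries.X = uInv A := rfl
    rw [Matrix.add_apply, Matrix.sub_apply, Matrix.smul_apply, Matrix.smul_apply,
      Matrix.smul_apply, e0, e1, e2, T₁_apply, vectorCleared, Matrix.of_apply]
    simp only [map_add, map_sub, map_mul, smul_inU, e3, map_one, apply_ite inU, map_zero,
      ← Algebra.smul_def, Prod.mk.injEq, smul_eq_mul]
    by_cases h1 : k = l <;> by_cases h2 : i = j <;> simp [h1, h2, E₂]
  have h2 : T₂ (vectorCleared E a) = ((1 - inU (PowerSeries.C a) * vInv A) *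
      (1 - inU (PowerSeries.C a) * vInv A - algebraMap ℂ A⟦X⟧⟦X⟧ (kappa c n) * vInv A)) • (1 : M)
      - (vInv A * (1 - inU (PowerSeries.C a) * vInv A - algebraMap ℂ A⟦X⟧⟦X⟧ (kappa c n) * vInv A)) • t
      + (vInv A * (1 - inU (PowerSeries.C a) * vInv A)) • (s * (t * q * t) * s) := by
    ext1 ⟨i, k⟩ ⟨j, l⟩
    have e1 : t (i, k) (j, l) = if i = j then E₂ l k else 0 := rfl
    have e2 : (s * (t * q * t) * s) (i, k) (j, l) = _ := hE₂.opP_mul_mul_opP_apply i k j l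
    have e0 : (1 : M) (i, k) (j, l) = if (i, k) = (j, l) then 1 else 0 := Matrix.one_apply
    have e3 : inV PowerSeries.X = vInv A := PowerSeries.map_X _
    have e4 : ∀ x : A, inV (PowerSeries.C x) = inU (PowerSeries.C x) := fun x => PowerSeries.map_C _ _
    rw [Matrix.add_apply, Matrix.sub_apply, Matrix.smul_apply, Matrix.smul_apply,
      Matrix.smul_apply, e0, e1, e2, T₂_apply, vectorCleared, Matrix.of_apply]
    simp only [map_add, map_sub, map_mul, smul_inV, e3, e4, map_one, apply_ite inV, map_zero,
      ← Algebra.smul_def, Prod.mk.injEq, smul_eq_mul]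
    by_cases h1 : k = l <;> by_cases h2 : i = j <;> simp [h1, h2, E₂]
  rw [← h1, ← h2] at key
  exact key

end ClassicalFamily

end

/-! ### The normalized vector solution and its leading coefficients -/

noncomputable section

namespace ClassicalFamily

variable {c : ClassicalFamily} {n : ℕ} {A B : Type*} [Ring A] [Algebra ℂ A] [Ring B] [Algebra ℂ B]

theorem C_mem {G : IntFiltration A} {e : ℤ} {x : A} (hx : x ∈ G.deg e) :
    (PowerSeries.C x : A⟦X⟧) ∈ G.series.deg e := by
  intro r
  rw [PowerSeries.coeff_C]
  split_ifs
  · exact G.mono (by omega) hx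
  · exact zero_mem _

theorem invOfUnit_mem_zero {G : IntFiltration A} {f : A⟦X⟧} (hf : f ∈ G.series.deg 0) :
    PowerSeries.invOfUnit f 1 ∈ G.series.deg 0 := by
  intro m
  induction m using Nat.strong_induction_on with
  | _ m ih =>
    rw [PowerSeries.coeff_invOfUnit]
    split_ifs
    · simpa using G.mono (by omega) G.one_mem
    · rw [inv_one, Units.val_one, neg_mul, one_mul]
      refine neg_mem (sum_mem fun x hx => ?_)
      split_ifs with h
      · have := Finset.HasAntidiagonal.mem_antidiagonal.1 hx
        exact G.mul_mem_of_le (by omega) (hf _) (ih _ h)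
      · exact zero_mem _

/-- The solution `1 - P / (u - a) + Q / (u - a - κ)` of the `RTT`-relation. -/
def vectorSolution (E : Idx c n → Idx c n → A) (a : A) : Matrix (Idx c n) (Idx c n) A⟦X⟧ :=
  let α : A⟦X⟧ := 1 - PowerSeries.C a * PowerSeries.X
  let α' : A⟦X⟧ := α - kappa c n • PowerSeries.X
  PowerSeries.invOfUnit (α * α') 1 • vectorCleared E a

variable {E : Idx c n → Idx c n → A} {a : A}

theorem coeff_mem_center_of_commute (ha : ∀ x, Commute a x) :
    let α : A⟦X⟧ := 1 - PowerSeries.C a * PowerSeries.X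
    let α' : A⟦X⟧ := α - kappa c n • PowerSeries.X
    (∀ m, PowerSeries.coeff m α ∈ Subalgebra.center ℂ A) ∧
      ∀ m, PowerSeries.coeff m α' ∈ Subalgebra.center ℂ A := by
  intro α α'
  have haS : a ∈ Subalgebra.center ℂ A := Subalgebra.mem_center_iff.2 fun b => (ha b).eq.symm
  have h1 : ∀ m, PowerSeries.coeff m (1 : A⟦X⟧) ∈ Subalgebra.center ℂ A := fun m => by
    rw [PowerSeries.coeff_one]
    split_ifs
    exacts [one_mem _, zero_mem _]
  have hX : ∀ m, PowerSeries.coeff m (PowerSeries.X : A⟦X⟧) ∈ Subalgebra.center ℂ A := fun m => by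
    rw [PowerSeries.coeff_X]
    split_ifs
    exacts [one_mem _, zero_mem _]
  have hα : ∀ m, PowerSeries.coeff m α ∈ Subalgebra.center ℂ A := fun m => by
    simp only [α, map_sub, PowerSeries.coeff_C_mul]
    exact sub_mem (h1 m) (mul_mem haS (hX m))
  refine ⟨hα, fun m => ?_⟩
  simp only [α', map_sub, PowerSeries.coeff_smul]
  exact sub_mem (hα m) ((Subalgebra.center ℂ A).smul_mem (hX m) _)

theorem vectorSolution_isRTT (hE : IsMatrixUnits E) (ha : ∀ x, Commute a x) :
    IsRTT (vectorSolution E a) := by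
  obtain ⟨h1, h2⟩ := coeff_mem_center_of_commute (c := c) (n := n) ha
  refine (vectorCleared_isRTT hE ha).smul fun m x => ?_
  exact (Subalgebra.mem_center_iff.1 (coeff_invOfUnit_mem _ (coeff_mul_mem _ h1 h2) m) x).symm

theorem vectorSolution_isUnital : IsUnital (vectorSolution E a) := by
  refine IsUnital.smul (fun i j => ?_) (by simp [PowerSeries.coeff_invOfUnit])
  by_cases h : i = j <;> simp [vectorCleared, h]

/-- Expanding `1 - P/(u - a) + Q/(u - a - κ)` in `u⁻¹`, the coefficient at `u⁻⁽ᵐ⁺¹⁾` is `aᵐ (Q - P)`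
plus terms in which `κ` replaces at least one factor `a`. As `a` has degree `1`, these have smaller
degree. -/
theorem coeff_vectorSolution_sub_mem {G : IntFiltration A} (ha : ∀ x, Commute a x)
    (haG : a ∈ G.deg 1) (hEG : ∀ i j, E i j ∈ G.deg 0) (i j : Idx c n) (m : ℕ) :
    PowerSeries.coeff (m + 1) (vectorSolution E a i j) -
      a ^ m * (theta i j • E (-i) (-j) - E j i) ∈ G.deg (m - 1) := by
  obtain ⟨h1, h2⟩ := coeff_mem_center_of_commute (c := c) (n := n) ha
  have hc : ∀ f : A⟦X⟧, (∀ m, PowerSeries.coeff m f ∈ Subalgebra.center ℂ A) → ∀ x, Commute f x :=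
    fun f hf x => commute_of_coeff (fun m x => (Subalgebra.mem_center_iff.1 (hf m) x).symm) x
  set α : A⟦X⟧ := 1 - PowerSeries.C a * PowerSeries.X with hα
  set α' : A⟦X⟧ := α - kappa c n • PowerSeries.X with hα'
  set g : A⟦X⟧ := PowerSeries.invOfUnit (α * α') 1 with hg
  have hgc := hc g (coeff_invOfUnit_mem _ (coeff_mul_mem _ h1 h2))
  have hα0 : PowerSeries.constantCoeff (α * α') = 1 := by
    simp [α, α', Algebra.smul_def]
  have hg1 : α * α' * g = 1 := PowerSeries.mul_invOfUnit _ _ (by simpa using hα0)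
  have hg2 : g * (α * α') = 1 := by rw [(hgc _).eq, hg1]
  let S : A⟦X⟧ := PowerSeries.mk fun m => a ^ m
  have hS : S * α = 1 := by
    ext m
    rw [hα, mul_sub, mul_one, map_sub, ← mul_assoc]
    cases m with
    | zero => simp [S]
    | succ m =>
      rw [PowerSeries.coeff_succ_mul_X, PowerSeries.coeff_mul_C]
      simp [S, PowerSeries.coeff_one, pow_succ]
  -- As `g` inverts `α α'`, the product `g α'` is the geometric series `S` inverting `α`; replacing
  -- `α'` by `α` adds `κ u⁻¹ g`.
  have e1 : g * α' = S := by
    calc g * α' = S * α * (g * α') := by rw [hS, one_mul]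
      _ = S * (α * α' * g) := by rw [(hgc α').eq]; noncomm_ring
      _ = S := by rw [hg1, mul_one]
  have e2 : g * α = S + kappa c n • (g * PowerSeries.X) := by
    rw [← e1, ← mul_smul_comm, ← mul_add, hα', sub_add_cancel]
  have hX : ∀ f : A⟦X⟧, PowerSeries.X * f = f * PowerSeries.X := fun f =>
    (PowerSeries.commute_X f).symm.eq
  have e3 : vectorSolution E a i j = (if i = j then 1 else 0)
      + S * PowerSeries.C (theta i j • E (-i) (-j) - E j i) * PowerSeries.X
      + (kappa c n * theta i j) •
        (g * PowerSeries.X * PowerSeries.X * PowerSeries.C (E (-i) (-j))) := by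
    have : vectorSolution E a i j = g * ((if i = j then α * α' else 0)
      - PowerSeries.X * α' * PowerSeries.C (E j i)
      + theta i j • (PowerSeries.X * α * PowerSeries.C (E (-i) (-j)))) := rfl
    rw [this, mul_add, mul_sub, mul_ite, mul_zero, hg2]
    have f1 : g * (PowerSeries.X * α' * PowerSeries.C (E j i))
        = S * PowerSeries.C (E j i) * PowerSeries.X := by
      rw [hX α', ← mul_assoc, ← mul_assoc, e1, mul_assoc, hX, mul_assoc]
    have f2 : g * (PowerSeries.X * α * PowerSeries.C (E (-i) (-j)))
        = S * PowerSeries.C (E (-i) (-j)) * PowerSeries.X +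
          kappa c n • (g * PowerSeries.X * PowerSeries.X * PowerSeries.C (E (-i) (-j))) := by
      rw [hX α, ← mul_assoc, ← mul_assoc, e2, add_mul, add_mul, mul_assoc S, hX, smul_mul_assoc,
        smul_mul_assoc, mul_assoc S]
    have f3 : PowerSeries.C (theta i j • E (-i) (-j) - E j i) =
        theta i j • PowerSeries.C (E (-i) (-j)) - PowerSeries.C (E j i) := by
      rw [map_sub]
      congr 1
      ext m
      rw [PowerSeries.coeff_smul, PowerSeries.coeff_C, PowerSeries.coeff_C]
      split_ifs
      · rfl
      · rw [smul_zero]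
    rw [mul_smul_comm, f1, f2, f3, mul_sub, sub_mul, mul_smul_comm, smul_mul_assoc, smul_add,
      smul_smul, mul_comm (theta i j)]
    abel
  have hg0 : g ∈ G.series.deg 0 := by
    refine invOfUnit_mem_zero ?_
    have hCa : PowerSeries.C a * PowerSeries.X ∈ G.series.deg 0 :=
      G.series.mul_mem (i := 1) (j := -1) (C_mem haG) X_mem
    have hα : α ∈ G.series.deg 0 := sub_mem G.series.one_mem hCa
    exact G.series.mul_mem (i := 0) (j := 0) hα (sub_mem hα (Submodule.smul_mem _ _
      (G.series.mono (by norm_num) X_mem)))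
  have hr : g * PowerSeries.X * PowerSeries.X * PowerSeries.C (E (-i) (-j)) ∈ G.series.deg (-2) :=
    G.series.mul_mem_of_le (i := -2) (by norm_num) (G.series.mul_mem_of_le (i := -1) (by norm_num)
      (G.series.mul_mem_of_le (by norm_num) hg0 X_mem) X_mem) (C_mem (hEG _ _))
  have e4 : PowerSeries.coeff (m + 1) (vectorSolution E a i j)
      = a ^ m * (theta i j • E (-i) (-j) - E j i) + (kappa c n * theta i j) •
        PowerSeries.coeff (m + 1)
          (g * PowerSeries.X * PowerSeries.X * PowerSeries.C (E (-i) (-j))) := by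
    rw [e3, map_add, map_add, PowerSeries.coeff_smul, PowerSeries.coeff_succ_mul_X,
      PowerSeries.coeff_mul_C, PowerSeries.coeff_mk]
    have : PowerSeries.coeff (m + 1) (if i = j then (1 : A⟦X⟧) else 0) = 0 := by
      split_ifs <;> simp [PowerSeries.coeff_one]
    rw [this, zero_add]
  rw [e4, add_sub_cancel_left]
  refine Submodule.smul_mem _ _ (G.mono ?_ (hr (m + 1)))
  push_cast
  omega

end ClassicalFamily

end

noncomputable section

/-! ## Separation of symmetric words -/

/-- The ways of picking an entry of a list, with the list of the remaining entries. -/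
def picks {ι : Type*} : List ι → List (ι × List ι)
  | [] => []
  | g :: l => (g, l) :: (picks l).map fun p => (p.1, g :: p.2)

theorem perm_of_mem_picks {ι : Type*} {l : List ι} {p : ι × List ι} (hp : p ∈ picks l) :
    (p.1 :: p.2).Perm l := by
  induction l generalizing p with
  | nil => simp [picks] at hp
  | cons g l ih =>
    rw [picks, List.mem_cons, List.mem_map] at hp
    obtain rfl | ⟨q, hq, rfl⟩ := hp
    · rfl
    · exact (List.Perm.swap _ _ _).trans ((ih hq).cons g)

theorem exists_mem_picks {ι : Type*} {l : List ι} {a : ι} (ha : a ∈ l) : ∃ p ∈ picks l, p.1 = a := by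
  induction l with
  | nil => simp at ha
  | cons g l ih =>
    obtain rfl | h := List.mem_cons.1 ha
    · exact ⟨(a, l), by simp [picks], rfl⟩
    · obtain ⟨p, hp, rfl⟩ := ih h
      exact ⟨(p.1, g :: p.2), by simp [picks, hp], rfl⟩

section Separation

variable {ι A B : Type*} [Ring A] [Algebra ℂ A] [Ring B] [Algebra ℂ B]

/-- The functional `Φ` separates the words in the elements `δ g` which are rearrangements of `w` from
the other words of at most the same length. -/
def Separates (δ : ι → A) (Φ : A →ₗ[ℂ] ℂ) (w : List ι) : Prop :=
  ∃ N : List ι → ℕ, ∀ l : List ι, l.length ≤ w.length →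
    Φ (l.map δ).prod = N l ∧ (N l ≠ 0 ↔ l.Perm w)

/-- The terms of degree at most one in `v` of the product of the elements `δ g ⊗ 1 + 1 ⊗ v g`. -/
theorem prod_coproduct_sub_mem (δ : ι → A) (v : ι → B) (l : List ι) :
    (l.map fun g => δ g ⊗ₜ[ℂ] (1 : B) + (1 : A) ⊗ₜ[ℂ] v g).prod - (l.map δ).prod ⊗ₜ[ℂ] 1
      - ((picks l).map fun p => (p.2.map δ).prod ⊗ₜ[ℂ] v p.1).sum
      ∈ Submodule.span ℂ {x : A ⊗[ℂ] B | ∃ l' : List ι, ∃ b : B, l'.length + 2 ≤ l.length ∧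
        x = (l'.map δ).prod ⊗ₜ[ℂ] b} := by
  induction l with
  | nil => simp [picks, Algebra.TensorProduct.one_def]
  | cons g l ih =>
    set W := Submodule.span ℂ {x : A ⊗[ℂ] B | ∃ l' : List ι, ∃ b : B,
      l'.length + 2 ≤ (g :: l).length ∧ x = (l'.map δ).prod ⊗ₜ[ℂ] b} with hW
    set P := (l.map fun g => δ g ⊗ₜ[ℂ] (1 : B) + (1 : A) ⊗ₜ[ℂ] v g).prod
    set S := ((picks l).map fun p => (p.2.map δ).prod ⊗ₜ[ℂ] v p.1).sum with hS
    have h1 : δ g ⊗ₜ[ℂ] (1 : B) * (P - (l.map δ).prod ⊗ₜ[ℂ] 1 - S) ∈ W := by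
      refine Submodule.span_induction (p := fun x _ => δ g ⊗ₜ[ℂ] (1 : B) * x ∈ W) ?_ ?_ ?_ ?_ ih
      · rintro _ ⟨l', b, hl, rfl⟩
        refine Submodule.subset_span ⟨g :: l', b, by simpa using hl, ?_⟩
        simp [Algebra.TensorProduct.tmul_mul_tmul]
      · simp
      · intro x y _ _ hx hy
        rw [mul_add]
        exact add_mem hx hy
      · intro r x _ hx
        rw [mul_smul_comm]
        exact W.smul_mem r hx
    have h2 : (1 : A) ⊗ₜ[ℂ] v g * (P - (l.map δ).prod ⊗ₜ[ℂ] 1 - S) ∈ W := by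
      refine Submodule.span_induction (p := fun x _ => (1 : A) ⊗ₜ[ℂ] v g * x ∈ W) ?_ ?_ ?_ ?_ ih
      · rintro _ ⟨l', b, hl, rfl⟩
        refine Submodule.subset_span ⟨l', v g * b, hl.trans (by simp), ?_⟩
        simp [Algebra.TensorProduct.tmul_mul_tmul]
      · simp
      · intro x y _ _ hx hy
        rw [mul_add]
        exact add_mem hx hy
      · intro r x _ hx
        rw [mul_smul_comm]
        exact W.smul_mem r hx
    have h3 : (1 : A) ⊗ₜ[ℂ] v g * S ∈ W := by
      rw [hS, ← List.sum_map_mul_left]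
      refine list_sum_mem fun x hx => ?_
      obtain ⟨p, hp, rfl⟩ := List.mem_map.1 hx
      refine Submodule.subset_span ⟨p.2, v g * v p.1, ?_, ?_⟩
      · have := (perm_of_mem_picks hp).length_eq
        simp only [List.length_cons] at this ⊢
        omega
      · simp [Algebra.TensorProduct.tmul_mul_tmul]
    have h4 : ((picks (g :: l)).map fun p => (p.2.map δ).prod ⊗ₜ[ℂ] v p.1).sum
        = (l.map δ).prod ⊗ₜ[ℂ] v g + δ g ⊗ₜ[ℂ] (1 : B) * S := by
      rw [picks, List.map_cons, List.sum_cons, List.map_map, hS, ← List.sum_map_mul_left]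
      simp [Algebra.TensorProduct.tmul_mul_tmul, Function.comp_def]
    have h5 : δ g ⊗ₜ[ℂ] (1 : B) * ((l.map δ).prod ⊗ₜ[ℂ] (1 : B))
        = ((g :: l).map δ).prod ⊗ₜ[ℂ] (1 : B) := by
      simp [Algebra.TensorProduct.tmul_mul_tmul]
    have h6 : (1 : A) ⊗ₜ[ℂ] v g * ((l.map δ).prod ⊗ₜ[ℂ] (1 : B)) = (l.map δ).prod ⊗ₜ[ℂ] v g := by
      simp [Algebra.TensorProduct.tmul_mul_tmul]
    have := add_mem (add_mem h1 h2) h3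
    rw [List.map_cons, List.prod_cons, h4, ← h5]
    convert this using 1
    rw [mul_sub, mul_sub, mul_sub, mul_sub, h6, add_mul]
    abel

/-- Expand the product over the letters of a word. Since `φ 1 = 0`, the term without `v` is killed.
In the terms with at least two factors `v` the other tensor factor is a word shorter than `w`, on
which `Φ` vanishes. There remain the terms where one letter `g` is picked for `φ`, and these are
nonzero only if `g = a` and the other letters rearrange `w`. All values are natural numbers, so the
contributions of different picks cannot cancel. -/
theorem Separates.tensor {δ : ι → A} {Φ : A →ₗ[ℂ] ℂ} {w : List ι} (h : Separates δ Φ w)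
    (v : ι → B) {φ : B →ₗ[ℂ] ℂ} (hφ : φ 1 = 0) {a : ι} {K : ι → ℕ} (hv : ∀ g, φ (v g) = K g)
    (hK : ∀ g, K g ≠ 0 ↔ g = a) :
    Separates (fun g => δ g ⊗ₜ[ℂ] (1 : B) + (1 : A) ⊗ₜ[ℂ] v g)
      (LinearMap.mul' ℂ ℂ ∘ₗ TensorProduct.map Φ φ) (a :: w) := by
  obtain ⟨N, hN⟩ := h
  refine ⟨fun l => ((picks l).map fun p => N p.2 * K p.1).sum, fun l hl => ⟨?_, ?_⟩⟩
  · have key := prod_coproduct_sub_mem δ v l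
    set Ψ := LinearMap.mul' ℂ ℂ ∘ₗ TensorProduct.map Φ φ with hΨ
    have hΨt : ∀ x y, Ψ (x ⊗ₜ y) = Φ x * φ y := fun x y => by simp [Ψ]
    have h0 : ∀ x ∈ Submodule.span ℂ {x : A ⊗[ℂ] B | ∃ l' : List ι, ∃ b : B,
        l'.length + 2 ≤ l.length ∧ x = (l'.map δ).prod ⊗ₜ[ℂ] b}, Ψ x = 0 := by
      intro x hx
      refine LinearMap.mem_ker.1 (Submodule.span_le.2 ?_ hx)
      rintro _ ⟨l', b, hl', rfl⟩
      rw [SetLike.mem_coe, LinearMap.mem_ker, hΨt]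
      have hlt : l'.length < w.length := by
        rw [List.length_cons] at hl
        omega
      obtain ⟨e1, e2⟩ := hN l' hlt.le
      have : N l' = 0 := by
        by_contra hne
        exact hlt.ne (e2.1 hne).length_eq
      rw [e1, this, Nat.cast_zero, zero_mul]
    have := h0 _ key
    rw [map_sub, map_sub, hΨt, hφ, mul_zero, sub_zero, sub_eq_zero] at this
    rw [this, map_list_sum, List.map_map, Nat.cast_list_sum, List.map_map]
    congr 1
    refine List.map_congr_left fun p hp => ?_
    have hlen := (perm_of_mem_picks hp).length_eq
    rw [Function.comp_apply, Function.comp_apply, hΨt, hv, (hN p.2 ?_).1, Nat.cast_mul]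
    simp only [List.length_cons] at hlen hl
    omega
  · have hlen : ∀ p ∈ picks l, p.2.length ≤ w.length := fun p hp => by
      have := (perm_of_mem_picks hp).length_eq
      simp only [List.length_cons] at this hl
      omega
    -- A sum of natural numbers vanishes only if all its terms do.
    rw [Ne, List.sum_eq_zero_iff, not_forall]
    constructor
    · rintro ⟨x, hx⟩
      obtain ⟨hx1, hx2⟩ := Classical.not_imp.1 hx
      obtain ⟨p, hp, rfl⟩ := List.mem_map.1 hx1
      have e1 := ((hN p.2 (hlen p hp)).2.1 (left_ne_zero_of_mul hx2))
      have e2 := (hK p.1).1 (right_ne_zero_of_mul hx2)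
      refine (perm_of_mem_picks hp).symm.trans ?_
      rw [e2]
      exact e1.cons a
    · intro hperm
      obtain ⟨p, hp, hpa⟩ := exists_mem_picks (hperm.mem_iff.2 List.mem_cons_self)
      refine ⟨N p.2 * K p.1, Classical.not_imp.2 ⟨List.mem_map.2 ⟨p, hp, rfl⟩, ?_⟩⟩
      refine mul_ne_zero ((hN p.2 (hlen p hp)).2.2 ?_) ((hK _).2 hpa)
      have := (perm_of_mem_picks hp).trans hperm
      rw [hpa] at this
      exact (List.perm_cons a).1 this

theorem separates_nil (δ : ι → ℂ) : Separates δ LinearMap.id [] :=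
  ⟨fun _ => 1, fun l hl => by
    obtain rfl : l = [] := by simpa using hl
    simp⟩

end Separation

/-! ## The filtration by degree -/

/-- The filtration of the polynomials by degree. -/
def degFiltration (A : Type*) [Ring A] [Algebra ℂ A] : IntFiltration A[X] where
  deg e :=
    { carrier := {p | ∀ m : ℕ, e < m → p.coeff m = 0}
      add_mem' := fun hp hq m hm => by rw [Polynomial.coeff_add, hp m hm, hq m hm, add_zero]
      zero_mem' := fun m _ => Polynomial.coeff_zero m
      smul_mem' := fun r p hp m hm => by rw [Polynomial.coeff_smul, hp m hm, smul_zero] }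
  mono _ _ h p hp m hm := hp m (by omega)
  one_mem m hm := by
    rw [Polynomial.coeff_one, if_neg (by omega)]
  mul_mem {i j p q} hp hq m hm := by
    rw [Polynomial.coeff_mul]
    refine Finset.sum_eq_zero fun x hx => ?_
    have := Finset.HasAntidiagonal.mem_antidiagonal.1 hx
    by_cases h : i < x.1
    · rw [hp _ h, zero_mul]
    · rw [hq _ (by omega), mul_zero]

section DegFiltration

variable {A B : Type*} [Ring A] [Algebra ℂ A] [Ring B] [Algebra ℂ B]

theorem C_mul_X_pow_mem (x : A) (m : ℕ) :
    Polynomial.C x * Polynomial.X ^ m ∈ (degFiltration A).deg m := fun k hk => by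
  rw [Polynomial.coeff_C_mul_X_pow, if_neg (by omega)]

theorem mapAlgHom_mem (f : A →ₐ[ℂ] B) {e : ℤ} {p : A[X]} (hp : p ∈ (degFiltration A).deg e) :
    Polynomial.mapAlgHom f p ∈ (degFiltration B).deg e := fun m hm => by
  rw [Polynomial.coe_mapAlgHom, Polynomial.coeff_map, hp m hm, map_zero]

theorem coeff_list_prod_of_mem {ι : Type*} (f : ι → A[X]) (d : ι → ℕ)
    (hf : ∀ g, f g ∈ (degFiltration A).deg (d g)) (l : List ι) :
    (l.map f).prod ∈ (degFiltration A).deg ((l.map d).sum : ℕ) ∧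
      (l.map f).prod.coeff (l.map d).sum = (l.map fun g => (f g).coeff (d g)).prod := by
  induction l with
  | nil => exact ⟨(degFiltration A).one_mem, by simp⟩
  | cons g l ih =>
    simp only [List.map_cons, List.prod_cons, List.sum_cons]
    have nd : ∀ {p : A[X]} {k : ℕ}, p ∈ (degFiltration A).deg k → p.natDegree ≤ k := fun hp =>
      Polynomial.natDegree_le_iff_coeff_eq_zero.2 fun m hm => hp m (by exact_mod_cast hm)
    refine ⟨?_, ?_⟩
    · rw [Nat.cast_add]
      exact (degFiltration A).mul_mem (hf g) ih.1
    · rw [Polynomial.coeff_mul_add_eq_of_natDegree_le (nd (hf g)) (nd ih.1), ih.2]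

end DegFiltration

end

noncomputable section

namespace ClassicalFamily

variable {c : ClassicalFamily} {n : ℕ} {A B : Type*} [Ring A] [Algebra ℂ A] [Ring B] [Algebra ℂ B]

/-! ## Tensor products of vector representations -/

/-- `T (u)` is a solution of the `RTT`-relation over `A[x]`, and the leading coefficient of
`t_{ij}^{(m + 1)}` with respect to the degree in `x` is `D i j m`. -/
structure IsGradedSolution (T : Matrix (Idx c n) (Idx c n) A[X]⟦X⟧) (D : Idx c n → Idx c n → ℕ → A) :
    Prop where
  isRTT : IsRTT T
  isUnital : IsUnital T
  coeff_sub_mem : ∀ i j (m : ℕ), PowerSeries.coeff (m + 1) (T i j)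
    - Polynomial.C (D i j m) * Polynomial.X ^ m ∈ (degFiltration A).deg (m - 1)

theorem IsGradedSolution.coeff_mem {T : Matrix (Idx c n) (Idx c n) A[X]⟦X⟧}
    {D : Idx c n → Idx c n → ℕ → A} (h : IsGradedSolution T D) (i j : Idx c n) (m : ℕ) :
    PowerSeries.coeff (m + 1) (T i j) ∈ (degFiltration A).deg m := by
  have := add_mem ((degFiltration A).mono (show (m : ℤ) - 1 ≤ m by omega) (h.coeff_sub_mem i j m))
    (C_mul_X_pow_mem (D i j m) m)
  rwa [sub_add_cancel] at this

theorem coeff_succ_one_apply {R : Type*} [Ring R] (i j : Idx c n) (m : ℕ) :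
    PowerSeries.coeff (m + 1) ((1 : Matrix (Idx c n) (Idx c n) R⟦X⟧) i j) = 0 := by
  rw [Matrix.one_apply]
  split_ifs <;> simp [PowerSeries.coeff_one]

theorem isUnital_one {R : Type*} [Ring R] :
    IsUnital (1 : Matrix (Idx c n) (Idx c n) R⟦X⟧) := fun i j => by
  rw [Matrix.one_apply]
  split_ifs <;> simp

theorem IsUnital.sub_one_mem {G : IntFiltration A} {T : Matrix (Idx c n) (Idx c n) A⟦X⟧}
    (h : IsUnital T) {i j : Idx c n} (hT : ∀ m : ℕ, PowerSeries.coeff (m + 1) (T i j) ∈ G.deg m) :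
    (T - 1) i j ∈ G.series.deg (-1) := by
  intro m
  rw [Matrix.sub_apply, map_sub]
  cases m with
  | zero =>
    rw [h i j, isUnital_one i j, sub_self]
    exact zero_mem _
  | succ m =>
    rw [coeff_succ_one_apply, sub_zero]
    exact G.mono (by push_cast; omega) (hT m)

theorem isGradedSolution_one :
    IsGradedSolution (1 : Matrix (Idx c n) (Idx c n) A[X]⟦X⟧) (0 : Idx c n → Idx c n → ℕ → A) where
  isRTT := isRTT_one
  isUnital := isUnital_one
  coeff_sub_mem i j m := by
    rw [coeff_succ_one_apply]
    simp

theorem commute_mapAlgHom {R : Type*} [Ring R] [Algebra ℂ R] (f : A →ₐ[ℂ] R) (g : B →ₐ[ℂ] R)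
    (h : ∀ a b, Commute (f a) (g b)) (p : A[X]) (q : B[X]) :
    Commute (Polynomial.mapAlgHom f p) (Polynomial.mapAlgHom g q) := by
  ext m
  rw [Polynomial.coeff_mul, Polynomial.coeff_mul, ← Finset.Nat.sum_antidiagonal_swap]
  refine Finset.sum_congr rfl fun x _ => ?_
  simp only [Polynomial.coe_mapAlgHom, Polynomial.coeff_map]
  exact (h (p.coeff x.2) (q.coeff x.1)).eq

/-- The tensor product of two graded solutions. -/
theorem IsGradedSolution.tensor {T : Matrix (Idx c n) (Idx c n) A[X]⟦X⟧}
    {D : Idx c n → Idx c n → ℕ → A} (h : IsGradedSolution T D)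
    {T' : Matrix (Idx c n) (Idx c n) B[X]⟦X⟧} {D' : Idx c n → Idx c n → ℕ → B}
    (h' : IsGradedSolution T' D') :
    IsGradedSolution
      (T.map (PowerSeries.map ((Polynomial.mapAlgHom
          (Algebra.TensorProduct.includeLeft : A →ₐ[ℂ] A ⊗[ℂ] B) : A[X] →ₐ[ℂ] (A ⊗[ℂ] B)[X]) :
            A[X] →+* (A ⊗[ℂ] B)[X])) *
        T'.map (PowerSeries.map ((Polynomial.mapAlgHom
          (Algebra.TensorProduct.includeRight : B →ₐ[ℂ] A ⊗[ℂ] B) : B[X] →ₐ[ℂ] (A ⊗[ℂ] B)[X]) :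
            B[X] →+* (A ⊗[ℂ] B)[X])))
      (fun i j m => D i j m ⊗ₜ 1 + 1 ⊗ₜ D' i j m) := by
  set f := (Polynomial.mapAlgHom
    (Algebra.TensorProduct.includeLeft : A →ₐ[ℂ] A ⊗[ℂ] B) : A[X] →ₐ[ℂ] (A ⊗[ℂ] B)[X]) with hf
  set g := (Polynomial.mapAlgHom
    (Algebra.TensorProduct.includeRight : B →ₐ[ℂ] A ⊗[ℂ] B) : B[X] →ₐ[ℂ] (A ⊗[ℂ] B)[X]) with hg
  set S := T.map (PowerSeries.map (f : A[X] →+* (A ⊗[ℂ] B)[X])) with hS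
  set S' := T'.map (PowerSeries.map (g : B[X] →+* (A ⊗[ℂ] B)[X])) with hS'
  set G := degFiltration (A ⊗[ℂ] B)
  have hfg : ∀ p q, Commute (f p) (g q) := commute_mapAlgHom _ _ fun a b => by
    rw [Commute, SemiconjBy]
    simp
  have hU : IsUnital S := h.isUnital.map _
  have hU' : IsUnital S' := h'.isUnital.map _
  have hm : ∀ i j, (S - 1) i j ∈ G.series.deg (-1) := fun i j => by
    refine hU.sub_one_mem fun m => ?_
    rw [hS, Matrix.map_apply, PowerSeries.coeff_map]
    exact mapAlgHom_mem _ (h.coeff_mem i j m)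
  have hm' : ∀ i j, (S' - 1) i j ∈ G.series.deg (-1) := fun i j => by
    refine hU'.sub_one_mem fun m => ?_
    rw [hS', Matrix.map_apply, PowerSeries.coeff_map]
    exact mapAlgHom_mem _ (h'.coeff_mem i j m)
  have hprod : ∀ i j, ((S - 1) * (S' - 1)) i j ∈ G.series.deg (-2) := fun i j => by
    rw [Matrix.mul_apply]
    exact sum_mem fun k _ => G.series.mul_mem_of_le (by norm_num) (hm i k) (hm' k j)
  -- The last product has degree `-2`, so leading coefficients add, as under the coproduct of an
  -- enveloping algebra.
  have hdec : S * S' = S + S' - 1 + (S - 1) * (S' - 1) := by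
    rw [sub_mul, mul_sub, mul_one, one_mul]
    abel
  refine ⟨?_, ?_, ?_⟩
  · refine (h.isRTT.map f).mul (h'.isRTT.map g) fun i j k l r s => ?_
    simp only [Matrix.map_apply, PowerSeries.coeff_map]
    exact hfg _ _
  · intro i j
    rw [Matrix.mul_apply, map_sum, Finset.sum_eq_single i]
    · rw [PowerSeries.coeff_mul, Finset.Nat.antidiagonal_zero, Finset.sum_singleton, hU, hU',
        if_pos rfl, one_mul]
    · intro k _ hk
      rw [PowerSeries.coeff_mul, Finset.Nat.antidiagonal_zero, Finset.sum_singleton, hU,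
        if_neg hk.symm, zero_mul]
    · simp
  · intro i j m
    have e1 : f (Polynomial.C (D i j m) * Polynomial.X ^ m)
        = Polynomial.C (D i j m ⊗ₜ 1) * Polynomial.X ^ m := by simp [f]
    have e2 : g (Polynomial.C (D' i j m) * Polynomial.X ^ m)
        = Polynomial.C (1 ⊗ₜ D' i j m) * Polynomial.X ^ m := by simp [g]
    have m1 := mapAlgHom_mem (Algebra.TensorProduct.includeLeft : A →ₐ[ℂ] A ⊗[ℂ] B)
      (h.coeff_sub_mem i j m)
    have m2 := mapAlgHom_mem (Algebra.TensorProduct.includeRight : B →ₐ[ℂ] A ⊗[ℂ] B)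
      (h'.coeff_sub_mem i j m)
    rw [← hf, map_sub, e1] at m1
    rw [← hg, map_sub, e2] at m2
    have m3 := hprod i j (m + 1)
    have m4 := add_mem (add_mem m1 m2)
      (G.mono (show ((m + 1 : ℕ) : ℤ) + -2 ≤ m - 1 by push_cast; omega) m3)
    rw [hdec, Matrix.add_apply, Matrix.sub_apply, Matrix.add_apply, map_add, map_sub, map_add,
      coeff_succ_one_apply, hS, hS', Matrix.map_apply, Matrix.map_apply, PowerSeries.coeff_map, PowerSeries.coeff_map,
      map_add, add_mul]
    convert m4 using 1
    simp only [RingHom.coe_coe]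
    abel

/-! ### The vector representation over `ℂ[x]` -/

/-- The leading coefficients of the vector representation. -/
def vectorLead (i j : Idx c n) (m : ℕ) : Matrix (Idx c n) (Idx c n) ℂ[X] :=
  (Polynomial.X ^ m : ℂ[X]) • (theta i j • Matrix.single (-i) (-j) 1 - Matrix.single j i 1)

/-- Two indeterminates are needed: the outer one records the degree, and the one inside the matrix
entries keeps different powers `xᵐ` apart after leading coefficients are taken. The spectral
parameter `a` is their product. -/
theorem exists_vector_isGradedSolution :
    ∃ T : Matrix (Idx c n) (Idx c n) (Matrix (Idx c n) (Idx c n) ℂ[X])[X]⟦X⟧,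
      IsGradedSolution T vectorLead := by
  let E : Idx c n → Idx c n → (Matrix (Idx c n) (Idx c n) ℂ[X])[X] := fun i j =>
    Polynomial.C (Matrix.single i j 1)
  have hE : IsMatrixUnits E := by
    constructor
    · intro i j k l
      simp only [E]
      rw [← Polynomial.C_mul]
      split_ifs with h
      · rw [h, Matrix.single_mul_single_same, one_mul]
      · rw [Matrix.single_mul_single_of_ne _ _ _ _ h, Polynomial.C_0]
    · simp only [E]
      rw [← map_sum, Matrix.sum_single_one, Polynomial.C_1]
  let a : (Matrix (Idx c n) (Idx c n) ℂ[X])[X] :=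
    Polynomial.C (Matrix.scalar (Idx c n) Polynomial.X) * Polynomial.X
  have ha : ∀ x, Commute a x := fun x => by
    refine Commute.mul_left ?_ (Polynomial.commute_X x)
    ext1 m
    rw [Polynomial.coeff_C_mul, Polynomial.coeff_mul_C]
    exact (Matrix.scalar_commute _ (fun r => Commute.all _ r) _).eq
  have haG : a ∈ (degFiltration (Matrix (Idx c n) (Idx c n) ℂ[X])).deg 1 := by
    have := C_mul_X_pow_mem (Matrix.scalar (Idx c n) (Polynomial.X : ℂ[X])) 1
    simpa [a] using this
  have hEG : ∀ i j, E i j ∈ (degFiltration (Matrix (Idx c n) (Idx c n) ℂ[X])).deg 0 := fun i j => by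
    have := C_mul_X_pow_mem (Matrix.single i j (1 : ℂ[X])) 0
    simpa [E] using this
  refine ⟨vectorSolution E a, vectorSolution_isRTT hE ha, vectorSolution_isUnital, fun i j m => ?_⟩
  have key := coeff_vectorSolution_sub_mem ha haG hEG i j m
  convert key using 2
  have e1 : a ^ m = Polynomial.C (Matrix.scalar (Idx c n) (Polynomial.X ^ m)) * Polynomial.X ^ m := by
    rw [Commute.mul_pow (Polynomial.commute_X _).symm, ← Polynomial.C_pow, ← map_pow]
  have e2 : theta i j • E (-i) (-j) - E j i
      = Polynomial.C (theta i j • Matrix.single (-i) (-j) 1 - Matrix.single j i 1) := by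
    rw [Polynomial.C_sub]
    congr 1
    ext m
    simp [E, Polynomial.coeff_C]
  rw [e1, e2, mul_assoc, Polynomial.X_pow_mul_C, ← mul_assoc, ← Polynomial.C_mul, vectorLead,
    Matrix.scalar_apply, Matrix.smul_eq_diagonal_mul]

end ClassicalFamily

end

noncomputable section

namespace ClassicalFamily

variable {c : ClassicalFamily} {n : ℕ} {A B : Type*} [Ring A] [Algebra ℂ A] [Ring B] [Algebra ℂ B]

/-! ## Independence of the ordered monomials -/

/-- The antisymmetrization of a family of leading coefficients. -/
def antisymm (D : Idx c n → Idx c n → ℕ → A) (i j : Idx c n) (m : ℕ) : A :=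
  (1 / 2 : ℂ) • (D i j m - theta i j • D (-j) (-i) m)

theorem theta_neg_neg_swap (i j : Idx c n) : theta (-j) (-i) = theta i j := by
  rw [theta_neg_neg, theta_comm]

theorem antisymm_vectorLead (i j : Idx c n) (m : ℕ) :
    antisymm vectorLead i j m = (Polynomial.X ^ m : ℂ[X]) •
      (theta i j • Matrix.single (-i) (-j) 1 - Matrix.single j i 1 :
        Matrix (Idx c n) (Idx c n) ℂ[X]) := by
  rw [antisymm, vectorLead, vectorLead, Idx.neg_neg, Idx.neg_neg, smul_comm (theta i j), ← smul_sub,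
    smul_comm (1 / 2 : ℂ), theta_neg_neg_swap, smul_sub (theta i j), smul_smul (theta i j),
    theta_mul_theta_self]
  congr 1
  module

/-- A functional detecting the leading coefficient of a single generator. -/
def detect (g : PBWIdx c n) : Matrix (Idx c n) (Idx c n) ℂ[X] →ₗ[ℂ] ℂ :=
  theta g.i g.j • (Polynomial.lcoeff ℂ g.m ∘ₗ Matrix.entryLinearMap ℂ ℂ[X] (-g.i) (-g.j))
    - Polynomial.lcoeff ℂ g.m ∘ₗ Matrix.entryLinearMap ℂ ℂ[X] g.j g.i

theorem detect_apply (g : PBWIdx c n) (M : Matrix (Idx c n) (Idx c n) ℂ[X]) :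
    detect g M = theta g.i g.j * (M (-g.i) (-g.j)).coeff g.m - (M g.j g.i).coeff g.m := rfl

theorem Idx.neg_inj {i j : Idx c n} : -i = -j ↔ i = j := by
  rw [Idx.neg_eq_iff, Idx.neg_neg]

theorem detect_one (g : PBWIdx c n) : detect g 1 = 0 := by
  rw [detect_apply, Matrix.one_apply, Matrix.one_apply]
  by_cases h : g.i = g.j
  · simp [h, theta_self]
  · simp [Idx.neg_inj, h, Ne.symm h]

/-- Two labels cannot be exchanged by `(i, j) ↦ (-j, -i)`, unless they are equal. -/
theorem PBWIdx.eq_of_neg {g h : PBWIdx c n} (h1 : g.i = -h.j) (h2 : g.j = -h.i) (hm : g.m = h.m) :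
    g = h ∧ c = C ∧ g.j = -g.i := by
  have v : ∀ i : Idx c n, (-i).val = -i.val := fun i => rfl
  have hv : ∀ i j : Idx c n, i.val = j.val → i = j := fun i j h => Subtype.ext h
  obtain ⟨i, j, m, hg⟩ := g
  obtain ⟨i', j', m', hg'⟩ := h
  dsimp only at h1 h2 hm hg hg' ⊢
  subst h1 h2 hm
  rw [v, v] at hg
  split_ifs at hg hg' with hc
  · have e : -j' = i' := hv _ _ (by rw [v]; omega)
    have e' : -i' = j' := by rw [← e, Idx.neg_neg]
    refine ⟨?_, hc, ?_⟩
    · congr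
    · rw [Idx.neg_neg, e']
  · omega

/-- The leading coefficient has two nonzero entries, and each contributes `1`. If `j = -i`, possible
only in the symplectic case, the two matrix units coincide and both entries read by `detect` are
`-2`, hence the value `4`. Only the vanishing pattern and the fact that the values are natural
numbers matter later. -/
theorem detect_antisymm_vectorLead (g h : PBWIdx c n) [Decidable (h = g)] :
    detect g (antisymm vectorLead h.i h.j h.m)
      = ((if h = g then if g.j = -g.i then 4 else 2 else 0 : ℕ) : ℂ) := by
  have hX : ∀ (P : Prop) [Decidable P], ((Polynomial.X ^ h.m : ℂ[X]) * if P then 1 else 0).coeff g.m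
      = if g.m = h.m ∧ P then 1 else 0 := fun P _ => by
    rw [mul_ite, mul_one, mul_zero]
    by_cases hP : P <;> simp [hP, Polynomial.coeff_X_pow]
  have hX' : ∀ (r : ℂ) (P : Prop) [Decidable P],
      ((Polynomial.X ^ h.m : ℂ[X]) * (r • if P then 1 else 0)).coeff g.m
      = if g.m = h.m ∧ P then r else 0 := fun r P _ => by
    rw [mul_smul_comm, Polynomial.coeff_smul, hX]
    simp
  rw [antisymm_vectorLead, detect_apply]
  simp only [Matrix.smul_apply, Matrix.sub_apply, Matrix.single_apply, smul_eq_mul, mul_sub,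
    Polynomial.coeff_sub, hX, hX', Idx.neg_inj]
  by_cases h1 : h = g
  · subst h1
    by_cases h2 : h.j = -h.i
    · have h3 : h.i = -h.j := by rw [h2, Idx.neg_neg]
      have hθ : theta h.i h.j = -1 := by
        rw [h2, theta_neg_self, sgn, if_pos (PBWIdx.eq_of_neg h3 h2 rfl).2.1]
      rw [hθ, if_pos rfl, if_pos h2, if_pos ⟨rfl, rfl, rfl⟩, if_pos ⟨rfl, h2, h3⟩,
        if_pos ⟨rfl, h2.symm, h3.symm⟩, if_pos ⟨rfl, rfl, rfl⟩]
      norm_num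
    · have h3 : ¬ (h.i = -h.j) := fun h3 => h2 (by rw [h3, Idx.neg_neg])
      have h4 : ¬ (h.j = -h.i) := h2
      have h5 : ¬ (-h.i = h.j) := fun h3 => h2 h3.symm
      have h6 : ¬ (-h.j = h.i) := fun h5 => h3 h5.symm
      simp [h2, h3, h5, h6, theta_mul_theta_self]
      norm_num
  · have h2 : ¬ (g.m = h.m ∧ h.i = g.i ∧ h.j = g.j) := by
      rintro ⟨e1, e2, e3⟩
      refine h1 ?_
      cases g
      cases h
      simp_all
    have h3 : ¬ (g.m = h.m ∧ h.j = g.j ∧ h.i = g.i) := fun h3 => h2 ⟨h3.1, h3.2.2, h3.2.1⟩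
    have h4 : ¬ (g.m = h.m ∧ h.j = -g.i ∧ h.i = -g.j) := fun h4 =>
      h1 (PBWIdx.eq_of_neg h4.2.2 h4.2.1 h4.1.symm).1
    have h5 : ¬ (g.m = h.m ∧ -h.i = g.j ∧ -h.j = g.i) := fun h5 =>
      h4 ⟨h5.1, by rw [← h5.2.2, Idx.neg_neg], by rw [← h5.2.1, Idx.neg_neg]⟩
    simp [h1, h2, h3, h4, h5]

/-- There are solutions whose leading coefficients separate the words with a given
rearrangement class. -/
theorem exists_separating_solution (w : List (PBWIdx c n)) :
    ∃ (A : Type) (_ : Ring A) (_ : Algebra ℂ A) (T : Matrix (Idx c n) (Idx c n) A[X]⟦X⟧)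
      (D : Idx c n → Idx c n → ℕ → A) (Φ : A →ₗ[ℂ] ℂ), IsGradedSolution T D ∧
        Separates (fun g : PBWIdx c n => antisymm D g.i g.j g.m) Φ w := by
  classical
  induction w with
  | nil => exact ⟨ℂ, inferInstance, inferInstance, 1, 0, LinearMap.id, isGradedSolution_one,
      separates_nil _⟩
  | cons a w ih =>
    obtain ⟨A, _, _, T, D, Φ, hT, hΦ⟩ := ih
    obtain ⟨T', hT'⟩ := exists_vector_isGradedSolution (c := c) (n := n)
    refine ⟨A ⊗[ℂ] Matrix (Idx c n) (Idx c n) ℂ[X], inferInstance, inferInstance, _, _,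
      LinearMap.mul' ℂ ℂ ∘ₗ TensorProduct.map Φ (detect a), hT.tensor hT', ?_⟩
    have := hΦ.tensor (fun g : PBWIdx c n => antisymm vectorLead g.i g.j g.m) (detect_one a)
      (K := fun h => if h = a then if a.j = -a.i then 4 else 2 else 0)
      (fun g => detect_antisymm_vectorLead a g) (a := a) (fun g => by split_ifs <;> simp_all)
    convert this using 2 with g
    simp only [antisymm, TensorProduct.smul_tmul', TensorProduct.sub_tmul, TensorProduct.tmul_sub,
      TensorProduct.tmul_smul, smul_add, smul_sub]
    abel

end ClassicalFamily

end

noncomputable section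

namespace ClassicalFamily

variable {c : ClassicalFamily} {n : ℕ} {A B : Type*} [Ring A] [Algebra ℂ A] [Ring B] [Algebra ℂ B]

theorem IsGradedSolution.coeff_normalize_sub_mem (hn : 1 ≤ n) (hκ : kappa c n ≠ 0)
    {T : Matrix (Idx c n) (Idx c n) A[X]⟦X⟧} {D : Idx c n → Idx c n → ℕ → A}
    (h : IsGradedSolution T D) (i j : Idx c n) (m : ℕ) :
    PowerSeries.coeff (m + 1) (normalize T i j)
      - Polynomial.C (antisymm D i j m) * Polynomial.X ^ m ∈ (degFiltration A).deg (m - 1) := by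
  have key := normalize_sub_mem hn hκ h.isRTT h.isUnital
    (fun i j => h.isUnital.sub_one_mem (G := degFiltration A) (h.coeff_mem i j)) i j (m + 1)
  simp only [Matrix.sub_apply, map_sub, PowerSeries.coeff_smul, coeff_succ_one_apply,
    sub_zero] at key
  have hle : ((m + 1 : ℕ) : ℤ) + -2 ≤ m - 1 := by
    push_cast
    omega
  have := add_mem ((degFiltration A).mono hle key) (Submodule.smul_mem _ (1 / 2 : ℂ)
    (sub_mem (h.coeff_sub_mem i j m) (Submodule.smul_mem _ (theta i j)
      (h.coeff_sub_mem (-j) (-i) m))))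
  convert this using 1
  rw [antisymm, ← Polynomial.smul_C, Polynomial.C_sub, ← Polynomial.smul_C, smul_mul_assoc, sub_mul,
    smul_mul_assoc]
  module

variable {T : Matrix (Idx c n) (Idx c n) A[X]⟦X⟧} {D : Idx c n → Idx c n → ℕ → A}

/-- The homomorphism given by a graded solution. -/
def IsGradedSolution.hom (h : IsGradedSolution T D) : ExtYangian c n →ₐ[ℂ] A[X] :=
  liftMatrix T h.isRTT h.isUnital

theorem IsGradedSolution.hom_mem (h : IsGradedSolution T D) {d : ℕ} {x : ExtYangian c n}
    (hx : x ∈ (filtX c n).toFun d) : h.hom x ∈ (degFiltration A).deg d := by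
  have : (filtX c n).toFun d ≤ ((degFiltration A).deg d).comap h.hom.toLinearMap := by
    refine Submodule.span_le.2 ?_
    rintro _ ⟨l, hl, rfl⟩
    rw [SetLike.mem_coe, Submodule.mem_comap, AlgHom.toLinearMap_apply, map_list_prod,
      List.map_map]
    refine (degFiltration A).mono (by exact_mod_cast hl)
      (coeff_list_prod_of_mem (h.hom ∘ gen c n) (fun g => g.2.2) ?_ l).1
    rintro ⟨i, j, m⟩
    rw [Function.comp_apply, IsGradedSolution.hom, liftMatrix_gen]
    exact h.coeff_mem i j m
  exact this hx

theorem IsGradedSolution.hom_tauCoeff_sub_mem (hn : 1 ≤ n) (hκ : kappa c n ≠ 0)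
    (h : IsGradedSolution T D) (i j : Idx c n) (m : ℕ) :
    h.hom (tauCoeff c n i j (m + 1)) - Polynomial.C (antisymm D i j m) * Polynomial.X ^ m
      ∈ (degFiltration A).deg (m - 1) := by
  have := h.coeff_normalize_sub_mem hn hκ i j m
  rwa [← liftMatrix_T T h.isRTT h.isUnital, map_normalize hn isUnital_T, Matrix.map_apply,
    PowerSeries.coeff_map] at this

theorem IsGradedSolution.hom_tauCoeff (hn : 1 ≤ n) (hκ : kappa c n ≠ 0)
    (h : IsGradedSolution T D) (i j : Idx c n) (m : ℕ) :
    h.hom (tauCoeff c n i j (m + 1)) ∈ (degFiltration A).deg m ∧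
      (h.hom (tauCoeff c n i j (m + 1))).coeff m = antisymm D i j m := by
  have key := h.hom_tauCoeff_sub_mem hn hκ i j m
  refine ⟨?_, ?_⟩
  · have := add_mem ((degFiltration A).mono (show (m : ℤ) - 1 ≤ m by omega) key)
      (C_mul_X_pow_mem (antisymm D i j m) m)
    rwa [sub_add_cancel] at this
  · have := key m (by omega)
    rwa [Polynomial.coeff_sub, Polynomial.coeff_C_mul_X_pow, if_pos rfl, sub_eq_zero] at this

/-- The degree of an ordered monomial. -/
def weight (s : Multiset (PBWIdx c n)) : ℕ := (s.map fun g => g.m).sum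

/-- The ordered monomials. -/
def monomial (_ : LinearOrder (PBWIdx c n)) (s : Multiset (PBWIdx c n)) : ExtYangian c n :=
  (s.sort.map fun g => tauCoeff c n g.i g.j (g.m + 1)).prod

theorem sum_map_sort (_ : LinearOrder (PBWIdx c n)) (s : Multiset (PBWIdx c n)) :
    (s.sort.map fun g => g.m).sum = weight s := by
  rw [weight, ← Multiset.sum_coe, ← Multiset.map_coe, Multiset.sort_eq]

/-- The ordered monomials of degree `d` are independent modulo elements of lower degree. -/
theorem weight_ne_of_sum_mem (hn : 1 ≤ n) (hκ : kappa c n ≠ 0) (o : LinearOrder (PBWIdx c n))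
    (f : Multiset (PBWIdx c n) →₀ ℂ) {d : ℕ} (hd : ∀ s ∈ f.support, weight s ≤ d)
    (h : f.sum (fun s r => r • monomial o s) ∈ (filtX c n).below d) :
    ∀ s ∈ f.support, weight s ≠ d := by
  by_contra! hne
  obtain ⟨t, ht, htd⟩ := hne
  -- Among the monomials of degree `d`, take one with the largest number of factors. The others of
  -- this degree are then words of at most the same length, the range in which `Separates` gives
  -- information.
  obtain ⟨s, hs, hmax⟩ := (f.support.filter fun s => weight s = d).exists_max_image Multiset.card
    ⟨t, Finset.mem_filter.2 ⟨ht, htd⟩⟩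
  obtain ⟨hs, hsd⟩ := Finset.mem_filter.1 hs
  obtain ⟨A, _, _, T, D, Φ, hT, N, hN⟩ := exists_separating_solution s.toList
  have h0 : (hT.hom (f.sum fun s r => r • monomial o s)).coeff d = 0 := by
    cases d with
    | zero =>
      rw [(Submodule.mem_bot ℂ).1 h, map_zero, Polynomial.coeff_zero]
    | succ d => exact hT.hom_mem (d := d) h (d + 1) (by push_cast; omega)
  -- The top coefficient of the image of a monomial is the product of the antisymmetrized leading
  -- coefficients of its factors.
  have h1 : ∀ t, hT.hom (monomial o t) ∈ (degFiltration A).deg (weight t) ∧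
      (hT.hom (monomial o t)).coeff (weight t)
        = (t.sort.map fun g => antisymm D g.i g.j g.m).prod := fun t => by
    have := coeff_list_prod_of_mem (fun g : PBWIdx c n => hT.hom (tauCoeff c n g.i g.j (g.m + 1)))
      (fun g => g.m) (fun g => (hT.hom_tauCoeff hn hκ g.i g.j g.m).1) t.sort
    rw [sum_map_sort] at this
    rw [monomial, map_list_prod, List.map_map]
    refine ⟨this.1, this.2.trans ?_⟩
    congr 1
    exact List.map_congr_left fun g _ => (hT.hom_tauCoeff hn hκ g.i g.j g.m).2
  -- Monomials of lower degree have no coefficient at `d`. Those of degree `d` other than `s` are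
  -- not rearrangements of `s`, because a multiset determines its sorted word, so `Φ` kills them.
  have h2 : ∀ t ∈ f.support, t ≠ s → Φ (f t • (hT.hom (monomial o t)).coeff d) = 0 := by
    intro t ht hts
    by_cases htd : weight t = d
    · rw [map_smul, ← htd, (h1 t).2]
      have hlen : t.sort.length ≤ s.toList.length := by
        simpa using hmax t (Finset.mem_filter.2 ⟨ht, htd⟩)
      obtain ⟨e1, e2⟩ := hN _ hlen
      have : N t.sort = 0 := by
        by_contra hne
        have := Multiset.coe_eq_coe.2 (e2.1 hne)
        rw [Multiset.sort_eq, Multiset.coe_toList] at this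
        exact hts this
      rw [e1, this, Nat.cast_zero, smul_zero]
    · rw [(h1 t).1 d (by exact_mod_cast lt_of_le_of_ne (hd t ht) htd), smul_zero, map_zero]
  have h3 : Φ (f s • (hT.hom (monomial o s)).coeff d) = 0 := by
    have := congrArg Φ h0
    rw [Finsupp.sum, map_sum, Polynomial.finsetSum_coeff, map_sum, map_zero,
      Finset.sum_eq_single s] at this
    · simpa using this
    · intro t ht hts
      have := h2 t ht hts
      simpa using this
    · exact fun hs' => absurd hs hs'
  rw [map_smul, ← hsd, (h1 s).2] at h3
  obtain ⟨e1, e2⟩ := hN s.sort (by simp)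
  rw [e1, smul_eq_mul, mul_eq_zero, Nat.cast_eq_zero] at h3
  obtain h3 | h3 := h3
  · exact Finsupp.mem_support_iff.1 hs h3
  · refine e2.2 ?_ h3
    rw [← Multiset.coe_eq_coe, Multiset.sort_eq, Multiset.coe_toList]

end ClassicalFamily

end

noncomputable section

/-! ## Ordered monomials -/

/-- If the span of the generators of an algebra is closed under commutators, then the ordered
monomials in the generators span the algebra. -/
theorem span_ordered_eq_top {k R ι : Type*} [CommRing k] [Ring R] [Algebra k R] (_ : LinearOrder ι)
    (x : ι → R) (hx : Algebra.adjoin k (Set.range x) = ⊤)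
    (hc : ∀ a b, x a * x b - x b * x a ∈ Submodule.span k (Set.range x)) :
    Submodule.span k (Set.range fun s : Multiset ι => (s.sort.map x).prod) = ⊤ := by
  let S : ℕ → Submodule k R := fun p =>
    Submodule.span k {y | ∃ l : List ι, l.length ≤ p ∧ y = (l.map x).prod}
  have hS : ∀ (l : List ι), (l.map x).prod ∈ S l.length := fun l =>
    Submodule.subset_span ⟨l, le_rfl, rfl⟩
  have mono : Monotone S := fun p q h => Submodule.span_mono fun y ⟨l, hl, hy⟩ =>
    ⟨l, hl.trans h, hy⟩
  have hmul : ∀ (a : ι) {p : ℕ} {y : R}, y ∈ S p → x a * y ∈ S (p + 1) := by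
    intro a p y hy
    have : S p ≤ (S (p + 1)).comap (LinearMap.mulLeft k (x a)) := by
      refine Submodule.span_le.2 ?_
      rintro _ ⟨l, hl, rfl⟩
      exact Submodule.subset_span ⟨a :: l, by simpa using hl, by simp⟩
    exact this hy
  -- A transposition of neighbouring letters changes a product by a commutator, which is linear in
  -- the generators; the correction has one letter fewer. For the empty word the truncated
  -- difference is harmless, as there is nothing to correct.
  have hperm : ∀ {l l' : List ι}, l.Perm l' →
      (l.map x).prod - (l'.map x).prod ∈ S (l.length - 1) := by
    intro l l' h
    induction h with
    | nil => simp
    | @cons a l l' hp ih =>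
      rw [List.map_cons, List.map_cons, List.prod_cons, List.prod_cons, ← mul_sub]
      cases l with
      | nil =>
        rw [List.nil_perm.1 hp]
        simp
      | cons b l => exact hmul a ih
    | swap a b l =>
      have e : ((b :: a :: l).map x).prod - ((a :: b :: l).map x).prod
          = (x b * x a - x a * x b) * (l.map x).prod := by
        simp only [List.map_cons, List.prod_cons]
        noncomm_ring
      rw [e]
      have : Submodule.span k (Set.range x)
          ≤ (S (l.length + 1)).comap (LinearMap.mulRight k (l.map x).prod) := by
        refine Submodule.span_le.2 ?_
        rintro _ ⟨g, rfl⟩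
        exact hmul g (hS l)
      exact this (hc b a)
    | @trans l₁ l₂ l₃ h₁ h₂ ih₁ ih₂ =>
      rw [h₁.length_eq.symm] at ih₂
      have := add_mem ih₁ ih₂
      rwa [sub_add_sub_cancel] at this
  set O := Submodule.span k (Set.range fun s : Multiset ι => (s.sort.map x).prod) with hO
  have hSO : ∀ p, S p ≤ O := by
    intro p
    induction p with
    | zero =>
      refine Submodule.span_le.2 ?_
      rintro _ ⟨l, hl, rfl⟩
      obtain rfl : l = [] := by simpa using hl
      exact Submodule.subset_span ⟨0, by simp⟩
    | succ p ih =>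
      refine Submodule.span_le.2 ?_
      rintro _ ⟨l, hl, rfl⟩
      have h1 : l.Perm (l : Multiset ι).sort := by
        rw [← Multiset.coe_eq_coe, Multiset.sort_eq]
      have h2 := ih (mono (show l.length - 1 ≤ p by omega) (hperm h1))
      have h3 : ((l : Multiset ι).sort.map x).prod ∈ O := Submodule.subset_span ⟨l, rfl⟩
      have := add_mem h2 h3
      rwa [sub_add_cancel] at this
  refine eq_top_iff.2 fun y _ => ?_
  have hy : y ∈ Subalgebra.toSubmodule (Algebra.adjoin k (Set.range x)) := by
    rw [hx]
    trivial
  rw [Algebra.adjoin_eq_span] at hy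
  refine Submodule.span_le.2 ?_ hy
  intro z hz
  obtain ⟨l, rfl⟩ : ∃ l : List ι, z = (l.map x).prod := by
    induction hz using Submonoid.closure_induction with
    | mem z hz =>
      obtain ⟨a, rfl⟩ := hz
      exact ⟨[a], by simp⟩
    | one => exact ⟨[], by simp⟩
    | mul z z' _ _ h h' =>
      obtain ⟨l, rfl⟩ := h
      obtain ⟨l', rfl⟩ := h'
      exact ⟨l ++ l', by simp⟩
  exact hSO _ (hS l)

namespace ClassicalFamily

variable {c : ClassicalFamily} {n : ℕ}

/-! ## The generators in the associated graded algebra -/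

theorem gen_mem_filtX (g : GenIdx c n) : gen c n g ∈ (filtX c n).toFun g.2.2 :=
  Submodule.subset_span ⟨[g], by simp, by simp⟩

theorem T_sub_one_mem (i j : Idx c n) :
    (T c n - 1) i j ∈ (IntFiltration.ofAlg (filtX c n)).series.deg (-1) :=
  isUnital_T.sub_one_mem fun m => by
    rw [coeff_T]
    exact (IntFiltration.mem_ofAlg_natCast _).2 (gen_mem_filtX (i, j, m))

theorem normalize_T_sub_one_mem (hn : 1 ≤ n) (hκ : kappa c n ≠ 0) (i j : Idx c n) :
    (normalize (T c n) - 1) i j ∈ (IntFiltration.ofAlg (filtX c n)).series.deg (-1) :=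
  normalize_sub_one_mem hn hκ isRTT_T isUnital_T T_sub_one_mem i j

theorem tauCoeff_mem_filtX (hn : 1 ≤ n) (hκ : kappa c n ≠ 0) (i j : Idx c n) (m : ℕ) :
    tauCoeff c n i j (m + 1) ∈ (filtX c n).toFun m := by
  have := normalize_T_sub_one_mem hn hκ i j (m + 1)
  rw [Matrix.sub_apply, map_sub, coeff_succ_one_apply, sub_zero,
    show ((m + 1 : ℕ) : ℤ) + -1 = m by push_cast; omega] at this
  exact (IntFiltration.mem_ofAlg_natCast _).1 this

theorem tauCoeff_add_mem_below (hn : 1 ≤ n) (hκ : kappa c n ≠ 0) (i j : Idx c n) (m : ℕ) :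
    tauCoeff c n i j (m + 1) + theta i j • tauCoeff c n (-j) (-i) (m + 1)
      ∈ (filtX c n).below m := by
  have := antisymm_mem (normalize_T_sub_one_mem hn hκ)
    (transShift_normalize_mul hn hκ isRTT_T isUnital_T (commute_z hn hκ)) i j (m + 1)
  rw [Matrix.sub_apply, Matrix.sub_apply, map_add, map_sub, PowerSeries.coeff_smul, map_sub,
    coeff_succ_one_apply, coeff_succ_one_apply, sub_zero, sub_zero,
    show ((m + 1 : ℕ) : ℤ) + -2 = m - 1 by push_cast; omega] at this
  exact (IntFiltration.mem_ofAlg_sub_one _).1 this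

theorem commutator_tauCoeff_sub_mem_below (hn : 1 ≤ n) (hκ : kappa c n ≠ 0) (i j k l : Idx c n)
    (r s : ℕ) :
    tauCoeff c n i j (r + 1) * tauCoeff c n k l (s + 1)
      - tauCoeff c n k l (s + 1) * tauCoeff c n i j (r + 1)
      - (((if k = j then tauCoeff c n i l (r + s + 1) else 0)
        - (if i = l then tauCoeff c n k j (r + s + 1) else 0))
      - ((if k = -i then theta i j • tauCoeff c n (-j) l (r + s + 1) else 0)
        - (if l = -j then theta i j • tauCoeff c n k (-i) (r + s + 1) else 0)))
      ∈ (filtX c n).below (r + s) := by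
  have := coeff_commutator_sub_mem (normalize_isRTT isRTT_T (commute_z hn hκ))
    (normalize_T_sub_one_mem hn hκ) (antisymm_mem (normalize_T_sub_one_mem hn hκ)
    (transShift_normalize_mul hn hκ isRTT_T isUnital_T (commute_z hn hκ))) i j k l r s
  rw [← Nat.cast_add, IntFiltration.mem_ofAlg_sub_one] at this
  exact this

end ClassicalFamily

/-! ### Products and components in the associated graded algebra -/

namespace AlgFiltration

variable {k A : Type*} [CommRing k] [Ring A] [Algebra k A] (F : AlgFiltration k A)

theorem toGr_mul {i j : ℕ} (a : F.toFun i) (b : F.toFun j) :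
    F.toGr i a * F.toGr j b = F.toGr (i + j) ⟨(a : A) * b, F.mul_mem a.2 b.2⟩ :=
  DirectSum.of_mul_of _ _

theorem toGr_one : F.toGr 0 ⟨1, F.one_mem⟩ = 1 := rfl

/-- The map `F d → gr A` as a linear map. -/
def toGrHom (d : ℕ) : F.toFun d →ₗ[k] F.Gr where
  toFun := F.toGr d
  map_add' a b := by
    rw [toGr, map_add, map_add]
    rfl
  map_smul' r a := by
    rw [toGr, map_smul, ← DirectSum.lof_eq_of k, map_smul]
    rfl

theorem toGrHom_apply (d : ℕ) (a : F.toFun d) : F.toGrHom d a = F.toGr d a := rfl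

theorem toGr_eq_zero_iff {d : ℕ} {a : F.toFun d} : F.toGr d a = 0 ↔ (a : A) ∈ F.below d := by
  have h1 : F.toGr d a = 0 ↔ F.symbol d a = 0 :=
    ⟨fun h => DirectSum.of_injective d (h.trans (map_zero _).symm), fun h => by
      rw [toGr, h]
      exact map_zero _⟩
  rw [h1]
  exact (Submodule.Quotient.mk_eq_zero _).trans Iff.rfl

theorem toGr_congr {d e : ℕ} (h : d = e) {a : F.toFun d} {b : F.toFun e} (hab : (a : A) = b) :
    F.toGr d a = F.toGr e b := by
  subst h
  rw [Subtype.ext hab]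

theorem list_prod_mem {ι : Type*} (f : ι → A) (d : ι → ℕ) (hf : ∀ g, f g ∈ F.toFun (d g))
    (l : List ι) : (l.map f).prod ∈ F.toFun (l.map d).sum := by
  induction l with
  | nil => exact F.one_mem
  | cons g l ih => exact F.mul_mem (hf g) ih

theorem toGr_list_prod {ι : Type*} (f : ι → A) (d : ι → ℕ) (hf : ∀ g, f g ∈ F.toFun (d g))
    (l : List ι) : (l.map fun g => F.toGr (d g) ⟨f g, hf g⟩).prod
      = F.toGr (l.map d).sum ⟨(l.map f).prod, F.list_prod_mem f d hf l⟩ := by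
  induction l with
  | nil => exact F.toGr_one
  | cons g l ih =>
    rw [List.map_cons, List.prod_cons, ih, toGr_mul]
    exact F.toGr_congr rfl rfl

theorem induction_on_gr {p : F.Gr → Prop} (x : F.Gr) (h0 : p 0)
    (hof : ∀ d a, p (F.toGr d a)) (hadd : ∀ x y, p x → p y → p (x + y)) : p x := by
  refine DirectSum.induction_on (motive := p) x h0 (fun d y => ?_) hadd
  obtain ⟨a, rfl⟩ := F.symbol_surjective d y
  exact hof d a

/-- The homogeneous components. -/
def component (d : ℕ) : F.Gr →+ F.Piece d :=
  (DFinsupp.evalAddMonoidHom d : (Π₀ d, F.Piece d) →+ F.Piece d)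

theorem component_toGr_same (d : ℕ) (a : F.toFun d) : F.component d (F.toGr d a) = F.symbol d a :=
  DirectSum.of_eq_same (β := F.Piece) d (F.symbol d a)

theorem component_toGr_of_ne {d e : ℕ} (h : e ≠ d) (a : F.toFun e) :
    F.component d (F.toGr e a) = 0 :=
  DirectSum.of_eq_of_ne (β := F.Piece) e d (F.symbol e a) h.symm

end AlgFiltration

end

noncomputable section

namespace AlgFiltration

/-- The ring structure of the associated graded algebra. -/
abbrev grRing {k A : Type*} [CommRing k] [Ring A] [Algebra k A] (F : AlgFiltration k A) :
    Ring F.Gr := Algebra.semiringToRing k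

end AlgFiltration

namespace ClassicalFamily

variable {c : ClassicalFamily} {n : ℕ}

attribute [local instance] AlgFiltration.grRing

/-! ## The homomorphism `U(𝔞[x]) → gr Y(𝔞)` -/

theorem mem_below_filtY {d : ℕ} {a : yangian c n} :
    a ∈ (filtY c n).below d ↔ (a : ExtYangian c n) ∈ (filtX c n).below d := by
  cases d with
  | zero =>
    change a ∈ (⊥ : Submodule ℂ (yangian c n)) ↔ (a : ExtYangian c n) ∈ (⊥ : Submodule ℂ _)
    rw [Submodule.mem_bot, Submodule.mem_bot, ZeroMemClass.coe_eq_zero]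
  | succ d => rfl

/-- The generator `τ_{ij}^{(m+1)}` as an element of degree `m` of the Yangian. -/
def tauY (hn : 1 ≤ n) (hκ : kappa c n ≠ 0) (i j : Idx c n) (m : ℕ) : (filtY c n).toFun m :=
  ⟨⟨tauCoeff c n i j (m + 1), tauCoeff_mem_yangian hn i j (m + 1)⟩, tauCoeff_mem_filtX hn hκ i j m⟩

/-- The symbol of `τ_{ij}^{(m+1)}`. -/
def tauBar (hn : 1 ≤ n) (hκ : kappa c n ≠ 0) (i j : Idx c n) (m : ℕ) : (filtY c n).Gr :=
  (filtY c n).toGr m (tauY hn hκ i j m)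

variable (hn : 1 ≤ n) (hκ : kappa c n ≠ 0)

theorem tauBar_antisymm (i j : Idx c n) (m : ℕ) :
    theta i j • tauBar hn hκ (-j) (-i) m = -tauBar hn hκ i j m := by
  rw [eq_neg_iff_add_eq_zero, add_comm]
  have : (filtY c n).toGrHom m (tauY hn hκ i j m + theta i j • tauY hn hκ (-j) (-i) m) = 0 :=
    (filtY c n).toGr_eq_zero_iff.2 (mem_below_filtY.2 (tauCoeff_add_mem_below hn hκ i j m))
  rwa [map_add, map_smul] at this

theorem tauBar_lie (i j k l : Idx c n) (r s : ℕ) :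
    tauBar hn hκ i j r * tauBar hn hκ k l s - tauBar hn hκ k l s * tauBar hn hκ i j r
      = ((if k = j then tauBar hn hκ i l (r + s) else 0)
        - (if i = l then tauBar hn hκ k j (r + s) else 0))
      - ((if k = -i then theta i j • tauBar hn hκ (-j) l (r + s) else 0)
        - (if l = -j then theta i j • tauBar hn hκ k (-i) (r + s) else 0)) := by
  set F := filtY c n with hF
  let t : Idx c n → Idx c n → ∀ m, F.toFun m := tauY hn hκ
  let b₁ : F.toFun (r + s) := ⟨_, F.mul_mem (t i j r).2 (t k l s).2⟩
  let b₂ : F.toFun (r + s) := ⟨(t k l s : yangian c n) * (t i j r : yangian c n), by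
    rw [add_comm]
    exact F.mul_mem (t k l s).2 (t i j r).2⟩
  have e1 : tauBar hn hκ i j r * tauBar hn hκ k l s = F.toGrHom (r + s) b₁ := F.toGr_mul _ _
  have e2 : tauBar hn hκ k l s * tauBar hn hκ i j r = F.toGrHom (r + s) b₂ :=
    (F.toGr_mul _ _).trans (F.toGr_congr (add_comm s r) rfl)
  have key : F.toGrHom (r + s) (b₁ - b₂ - (((if k = j then t i l (r + s) else 0)
        - (if i = l then t k j (r + s) else 0))
      - ((if k = -i then theta i j • t (-j) l (r + s) else 0)
        - (if l = -j then theta i j • t k (-i) (r + s) else 0)))) = 0 := by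
    refine F.toGr_eq_zero_iff.2 (mem_below_filtY.2 ?_)
    convert commutator_tauCoeff_sub_mem_below hn hκ i j k l r s using 1
    simp only [AddSubgroupClass.coe_sub, apply_ite (Subtype.val : F.toFun (r + s) → _),
      apply_ite (Subtype.val : yangian c n → _)]
    rfl
  rw [e1, e2, ← sub_eq_zero]
  refine Eq.trans ?_ key
  simp only [map_sub, apply_ite (F.toGrHom (r + s)), map_zero, map_smul]
  rfl

/-! ### The Lie algebra -/

theorem F_antisymm (i j : Idx c n) : theta i j • F c n (-j) (-i) = -F c n i j := by
  refine Subtype.ext ?_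
  change theta i j • FMat c n (-j) (-i) = -FMat c n i j
  rw [FMat, FMat, Idx.neg_neg, Idx.neg_neg, theta_neg_neg_swap, smul_sub, smul_smul,
    theta_mul_theta_self, one_smul, neg_sub]

/-- The right-hand side has the same shape as that of `tauBar_lie`, which makes the symbol map a
homomorphism of Lie algebras. -/
theorem F_lie (i j k l : Idx c n) : ⁅F c n i j, F c n k l⁆ =
    ((if k = j then F c n i l else 0) - (if i = l then F c n k j else 0))
      - ((if k = -i then theta i j • F c n (-j) l else 0)
        - (if l = -j then theta i j • F c n k (-i) else 0)) := by
  refine Subtype.ext ?_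
  have h0 : ∀ (P : Prop) [Decidable P] (x : lieAlg c n),
      ((if P then x else 0 : lieAlg c n) : Matrix (Idx c n) (Idx c n) ℂ) = if P then ↑x else 0 :=
    fun P _ x => by split_ifs <;> rfl
  have h1 : ∀ i j, (F c n i j : Matrix (Idx c n) (Idx c n) ℂ)
      = Matrix.single i j 1 - theta i j • Matrix.single (-j) (-i) 1 := fun _ _ => rfl
  have h2 : ∀ i j k l : Idx c n, Matrix.single i j (1 : ℂ) * Matrix.single k l 1
      = if j = k then Matrix.single i l 1 else 0 := fun i j k l => by
    split_ifs with h
    · rw [h, Matrix.single_mul_single_same, one_mul]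
    · rw [Matrix.single_mul_single_of_ne _ _ _ _ h]
  have ht : ∀ k j l : Idx c n, theta (-k) j * theta (-j) l = theta k l := fun k j l => by
    rw [theta_neg_left, theta_mul_theta]
  have hχ : ∀ (P : Prop) [Decidable P] (M : Matrix (Idx c n) (Idx c n) ℂ),
      (if P then M else 0) = (if P then 1 else 0 : ℂ) • M := fun P _ M => by
    split_ifs <;> simp
  have c1 : (j = k) = (k = j) := propext eq_comm
  have c2 : (l = i) = (i = l) := propext eq_comm
  have c3 : (j = -l) = (l = -j) := propext ⟨fun h => by rw [h, Idx.neg_neg], fun h => by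
    rw [h, Idx.neg_neg]⟩
  have c4 : (-i = k) = (k = -i) := propext eq_comm
  have c5 : (-k = i) = (k = -i) := propext Idx.neg_eq_iff
  have c6 : (-i = -l) = (i = l) := propext Idx.neg_inj
  have c7 : (-k = -j) = (k = j) := propext Idx.neg_inj
  -- The Kronecker symbols force the sign identities that identify the remaining matrix units, so
  -- the claim becomes a linear combination of four such identities.
  have f1 : (if k = j then 1 else 0 : ℂ) * (theta i j * theta k l - theta i l) = 0 := by
    split_ifs with h
    · rw [h, theta_mul_theta, sub_self, mul_zero]
    · rw [zero_mul]
  have f2 : (if i = l then 1 else 0 : ℂ) * (theta i j * theta k l - theta k j) = 0 := by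
    split_ifs with h
    · rw [h, mul_comm (theta l j), theta_mul_theta, sub_self, mul_zero]
    · rw [zero_mul]
  have f3 : (if k = -i then 1 else 0 : ℂ) * (theta i j * theta (-j) l - theta k l) = 0 := by
    split_ifs with h
    · rw [← ht k j l, h, Idx.neg_neg, sub_self, mul_zero]
    · rw [zero_mul]
  have f4 : (if l = -j then 1 else 0 : ℂ) * (theta i j * theta k (-i) - theta k l) = 0 := by
    split_ifs with h
    · rw [h, theta_comm i j, ← theta_neg_left k i, ← theta_neg_left k j, theta_comm (-k) i,
        theta_comm (-k) j, theta_mul_theta, sub_self, mul_zero]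
    · rw [zero_mul]
  rw [LieSubalgebra.coe_bracket, Ring.lie_def]
  simp only [AddSubgroupClass.coe_sub, SetLike.val_smul, h0, h1, mul_sub, sub_mul,
    smul_mul_assoc, mul_smul_comm, h2, Idx.neg_neg]
  simp only [c1, c2, c3, c4, c5, c6, c7, hχ (_ = _)]
  linear_combination (norm := module) (-1 : ℂ) • (f1 • Matrix.single (-l) (-i) (1 : ℂ))
    + f2 • Matrix.single (-j) (-k) (1 : ℂ) - f3 • Matrix.single (-l) j (1 : ℂ)
    + f4 • Matrix.single i (-k) (1 : ℂ)

end ClassicalFamily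

end

/-! ### The current Lie algebra and its map to the associated graded algebra -/

noncomputable section

/-- A linear map of Lie algebras preserving the brackets of a spanning family is a homomorphism. -/
theorem map_lie_of_span {k ι L M : Type*} [CommRing k] [LieRing L] [LieAlgebra k L] [LieRing M]
    [LieAlgebra k M] {g : ι → L} (hg : Submodule.span k (Set.range g) = ⊤) (f : L →ₗ[k] M)
    (h : ∀ a b, f ⁅g a, g b⁆ = ⁅f (g a), f (g b)⁆) (x y : L) : f ⁅x, y⁆ = ⁅f x, f y⁆ := by
  have hx : x ∈ Submodule.span k (Set.range g) := hg ▸ Submodule.mem_top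
  have hy : y ∈ Submodule.span k (Set.range g) := hg ▸ Submodule.mem_top
  induction hx using Submodule.span_induction with
  | zero => simp
  | add x x' _ _ h h' => rw [add_lie, map_add, h, h', map_add, add_lie]
  | smul r x _ h => rw [smul_lie, map_smul, h, map_smul, smul_lie]
  | mem x hx =>
    obtain ⟨a, rfl⟩ := hx
    induction hy using Submodule.span_induction with
    | zero => simp
    | add y y' _ _ h h' => rw [lie_add, map_add, h, h', map_add, lie_add]
    | smul r y _ h => rw [lie_smul, map_smul, h, map_smul, lie_smul]
    | mem y hy =>
      obtain ⟨b, rfl⟩ := hy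
      exact h a b

namespace ClassicalFamily

variable {c : ClassicalFamily} {n : ℕ}

attribute [local instance] AlgFiltration.grRing

theorem lieAlg_apply (M : lieAlg c n) (i j : Idx c n) :
    (M : Matrix (Idx c n) (Idx c n) ℂ) i j
      = -(theta i j * (M : Matrix (Idx c n) (Idx c n) ℂ) (-j) (-i)) := by
  have h : (M : Matrix (Idx c n) (Idx c n) ℂ)ᵀ * form c n
      = form c n * -(M : Matrix (Idx c n) (Idx c n) ℂ) := by
    have := M.2
    rw [mem_skewAdjointMatricesLieSubalgebra, mem_skewAdjointMatricesSubmodule] at this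
    exact this
  have h1 := congrFun (congrFun h j) (-i)
  have e1 : ((M : Matrix (Idx c n) (Idx c n) ℂ)ᵀ * form c n) j (-i)
      = (M : Matrix (Idx c n) (Idx c n) ℂ) i j * eps i := by
    rw [Matrix.mul_apply, Finset.sum_eq_single i]
    · simp [form]
    · intro b _ hb
      simp [form, Idx.neg_inj, hb.symm]
    · simp
  have e2 : (form c n * -(M : Matrix (Idx c n) (Idx c n) ℂ)) j (-i)
      = -(eps j * (M : Matrix (Idx c n) (Idx c n) ℂ) (-j) (-i)) := by
    rw [Matrix.mul_apply, Finset.sum_eq_single (-j)]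
    · simp [form]
    · intro b _ hb
      simp [form, hb]
    · simp
  rw [e1, e2] at h1
  rw [theta]
  linear_combination eps i * h1 - (M : Matrix (Idx c n) (Idx c n) ℂ) i j * eps_mul_self i

/-- Since `F_{ij}` and `F_{-j,-i}` are proportional, the sum over all pairs counts every element
twice. The formula depends linearly on the matrix entries, so it defines maps out of `𝔞` without the
choice of a basis. -/
theorem eq_sum_F (M : lieAlg c n) :
    M = (1 / 2 : ℂ) • ∑ i, ∑ j, (M : Matrix (Idx c n) (Idx c n) ℂ) i j • F c n i j := by
  refine Subtype.ext ?_
  ext a b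
  have h1 : ∀ i j, (F c n i j : Matrix (Idx c n) (Idx c n) ℂ)
      = Matrix.single i j 1 - theta i j • Matrix.single (-j) (-i) 1 := fun _ _ => rfl
  rw [SetLike.val_smul, AddSubmonoidClass.coe_finsetSum]
  simp only [AddSubmonoidClass.coe_finsetSum, SetLike.val_smul, h1, Matrix.smul_apply,
    Matrix.sum_apply, Matrix.sub_apply, Matrix.single_apply, smul_eq_mul, mul_sub,
    Finset.sum_sub_distrib, Idx.neg_eq_iff]
  have e1 : ∑ x, ∑ y, (M : Matrix (Idx c n) (Idx c n) ℂ) x y * (if x = a ∧ y = b then 1 else 0)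
      = (M : Matrix (Idx c n) (Idx c n) ℂ) a b := by
    rw [Finset.sum_eq_single a, Finset.sum_eq_single b] <;> simp +contextual
  have e2 : ∑ x, ∑ y, (M : Matrix (Idx c n) (Idx c n) ℂ) x y *
      (theta x y * if y = -a ∧ x = -b then 1 else 0)
      = (M : Matrix (Idx c n) (Idx c n) ℂ) (-b) (-a) * theta a b := by
    rw [Finset.sum_eq_single (-b), Finset.sum_eq_single (-a)] <;>
      simp +contextual [theta_neg_neg_swap]
  rw [e1, e2]
  linear_combination (1 / 2) * lieAlg_apply M a b

/-- The basic generators of the current algebra. -/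
def cur (i j : Idx c n) (m : ℕ) : Current c n := (Polynomial.X ^ m : ℂ[X]) ⊗ₜ[ℂ] F c n i j

theorem cur_antisymm (i j : Idx c n) (m : ℕ) : theta i j • cur (-j) (-i) m = -cur i j m := by
  rw [cur, cur, ← TensorProduct.tmul_smul, F_antisymm, TensorProduct.tmul_neg]

theorem cur_lie (i j k l : Idx c n) (r s : ℕ) : ⁅cur i j r, cur k l s⁆ =
    ((if k = j then cur i l (r + s) else 0) - (if i = l then cur k j (r + s) else 0))
      - ((if k = -i then theta i j • cur (-j) l (r + s) else 0)
        - (if l = -j then theta i j • cur k (-i) (r + s) else 0)) := by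
  have h : ∀ (P : Prop) [Decidable P] (x : lieAlg c n),
      (Polynomial.X ^ (r + s) : ℂ[X]) ⊗ₜ[ℂ] (if P then x else 0)
        = if P then (Polynomial.X ^ (r + s) : ℂ[X]) ⊗ₜ[ℂ] x else 0 := fun P _ x => by
    split_ifs <;> simp
  simp only [cur]
  rw [LieAlgebra.ExtendScalars.bracket_tmul, ← pow_add, F_lie]
  simp only [TensorProduct.tmul_sub, h, TensorProduct.tmul_smul]

theorem span_cur : Submodule.span ℂ
    (Set.range fun g : GenIdx c n => (cur g.1 g.2.1 g.2.2 : Current c n)) = ⊤ := by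
  refine eq_top_iff.2 fun x _ => ?_
  induction x using TensorProduct.induction_on with
  | zero => exact zero_mem _
  | add x y hx hy => exact add_mem (hx trivial) (hy trivial)
  | tmul p M =>
    induction p using Polynomial.induction_on' with
    | add p q hp hq =>
      rw [TensorProduct.add_tmul]
      exact add_mem (hp trivial) (hq trivial)
    | monomial m r =>
      rw [← Polynomial.C_mul_X_pow_eq_monomial, ← Polynomial.smul_eq_C_mul,
        ← TensorProduct.smul_tmul', eq_sum_F M, TensorProduct.tmul_smul, TensorProduct.tmul_sum]
      refine Submodule.smul_mem _ _ (Submodule.smul_mem _ _ (sum_mem fun i _ => ?_))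
      rw [TensorProduct.tmul_sum]
      refine sum_mem fun j _ => ?_
      rw [TensorProduct.tmul_smul]
      exact Submodule.smul_mem _ _ (Submodule.subset_span ⟨(i, j, m), rfl⟩)

/-- The symmetry `(i, j) ↦ (-j, -i)` changes the sign of `i + j`, so up to a scalar every generator
has a label in the chosen half. On the line `i + j = 0` the elements `F_{i,-i}` vanish in the
orthogonal case. -/
theorem span_cur_pbw : Submodule.span ℂ
    (Set.range fun g : PBWIdx c n => (cur g.i g.j g.m : Current c n)) = ⊤ := by
  rw [eq_top_iff, ← span_cur, Submodule.span_le]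
  rintro _ ⟨⟨i, j, m⟩, rfl⟩
  have v : ∀ i : Idx c n, (-i).val = -i.val := fun i => rfl
  dsimp only
  by_cases h : if c = C then 0 ≤ i.val + j.val else 0 < i.val + j.val
  · exact Submodule.subset_span ⟨⟨i, j, m, h⟩, rfl⟩
  by_cases h' : if c = C then 0 ≤ (-j).val + (-i).val else 0 < (-j).val + (-i).val
  · rw [← neg_neg (cur i j m), ← cur_antisymm]
    exact neg_mem (Submodule.smul_mem _ _ (Submodule.subset_span ⟨⟨-j, -i, m, h'⟩, rfl⟩))
  · have hc : c ≠ C := by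
      rintro rfl
      rw [if_pos rfl] at h h'
      rw [v, v] at h'
      omega
    rw [if_neg hc] at h h'
    rw [v, v] at h'
    have hij : j = -i := Subtype.ext (show j.val = -i.val by omega)
    have := cur_antisymm i j m
    rw [hij, theta_neg_self, sgn, if_neg hc, one_smul, Idx.neg_neg] at this
    have h2 : (2 : ℂ) • cur i (-i) m = 0 := by
      rw [two_smul]
      nth_rewrite 1 [this]
      exact neg_add_cancel _
    rw [hij, (smul_eq_zero.1 h2).resolve_left two_ne_zero]
    exact zero_mem _

variable (hn : 1 ≤ n) (hκ : kappa c n ≠ 0)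

/-- The map `𝔞 x^m → gr Y(𝔞)`. -/
def symbolHom (m : ℕ) : lieAlg c n →ₗ[ℂ] (filtY c n).Gr where
  toFun M := (1 / 2 : ℂ) • ∑ i, ∑ j, (M : Matrix (Idx c n) (Idx c n) ℂ) i j • tauBar hn hκ i j m
  map_add' M M' := by
    have : ((M + M' : lieAlg c n) : Matrix (Idx c n) (Idx c n) ℂ) = M + M' := rfl
    simp only [this, Matrix.add_apply, add_smul, Finset.sum_add_distrib, smul_add]
  map_smul' r M := by
    have : ((r • M : lieAlg c n) : Matrix (Idx c n) (Idx c n) ℂ) = r • ↑M := rfl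
    simp only [this, Matrix.smul_apply, smul_eq_mul, mul_smul, RingHom.id_apply,
      ← Finset.smul_sum]
    rw [smul_comm]

/-- This is the consistency of the assignment on the linearly dependent elements `F_{ij}`: the
antisymmetry of the symbols makes the two halves of the sum agree. -/
theorem symbolHom_F (i j : Idx c n) (m : ℕ) : symbolHom hn hκ m (F c n i j) = tauBar hn hκ i j m := by
  have h1 : ∀ a b, (F c n i j : Matrix (Idx c n) (Idx c n) ℂ) a b
      = (if i = a ∧ j = b then 1 else 0) - theta i j * (if -j = a ∧ -i = b then 1 else 0) :=
    fun a b => by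
      change (Matrix.single i j 1 - theta i j • Matrix.single (-j) (-i) 1 : Matrix _ _ ℂ) a b = _
      rw [Matrix.sub_apply, Matrix.smul_apply, Matrix.single_apply, Matrix.single_apply,
        smul_eq_mul]
  have e : ∀ k l : Idx c n, ∑ a, ∑ b, (if k = a ∧ l = b then 1 else 0 : ℂ) • tauBar hn hκ a b m
      = tauBar hn hκ k l m := fun k l => by
    rw [Finset.sum_eq_single k, Finset.sum_eq_single l] <;> simp +contextual [eq_comm]
  change (1 / 2 : ℂ) • ∑ a, ∑ b, (F c n i j : Matrix (Idx c n) (Idx c n) ℂ) a b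
    • tauBar hn hκ a b m = _
  simp only [h1, sub_smul, mul_smul, Finset.sum_sub_distrib, ← Finset.smul_sum, e, tauBar_antisymm]
  module

/-- The map `𝔞[x] → gr Y(𝔞)`. -/
def currentHom : Current c n →ₗ[ℂ] (filtY c n).Gr :=
  TensorProduct.lift ((Polynomial.basisMonomials ℂ).constr ℂ fun m => symbolHom hn hκ m)

theorem currentHom_cur (i j : Idx c n) (m : ℕ) :
    currentHom hn hκ (cur i j m) = tauBar hn hκ i j m := by
  have := (Polynomial.basisMonomials ℂ).constr_basis ℂ (fun m => symbolHom hn hκ m) m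
  rw [Polynomial.coe_basisMonomials] at this
  rw [cur, currentHom, TensorProduct.lift.tmul, Polynomial.X_pow_eq_monomial, this, symbolHom_F]

theorem currentHom_lie (x y : Current c n) :
    currentHom hn hκ ⁅x, y⁆ = ⁅currentHom hn hκ x, currentHom hn hκ y⁆ := by
  refine map_lie_of_span span_cur (currentHom hn hκ) ?_ x y
  rintro ⟨i, j, r⟩ ⟨k, l, s⟩
  have hi : ∀ (P : Prop) [Decidable P] (x : Current c n), currentHom hn hκ (if P then x else 0)
      = if P then currentHom hn hκ x else 0 := fun P _ x => by split_ifs <;> simp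
  dsimp only
  rw [currentHom_cur, currentHom_cur, Ring.lie_def, tauBar_lie]
  refine (congrArg _ (cur_lie i j k l r s)).trans ?_
  simp only [map_sub, hi, map_smul, currentHom_cur]

/-- The homomorphism `U(𝔞[x]) → gr Y(𝔞)`. -/
def envelopingHom : UniversalEnvelopingAlgebra ℂ (Current c n) →ₐ[ℂ] (filtY c n).Gr :=
  UniversalEnvelopingAlgebra.lift ℂ
    ({ currentHom hn hκ with map_lie' := fun {x y} => currentHom_lie hn hκ x y } :
      Current c n →ₗ⁅ℂ⁆ (filtY c n).Gr)

theorem envelopingHom_cur (i j : Idx c n) (m : ℕ) :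
    envelopingHom hn hκ (UniversalEnvelopingAlgebra.ι ℂ (cur i j m)) = tauBar hn hκ i j m :=
  (UniversalEnvelopingAlgebra.lift_ι_apply ℂ _ _).trans (currentHom_cur hn hκ i j m)

end ClassicalFamily

end

noncomputable section

namespace UniversalEnvelopingAlgebra

theorem adjoin_range_ι (k L : Type*) [CommRing k] [LieRing L] [LieAlgebra k L] :
    Algebra.adjoin k (Set.range (ι k : L → UniversalEnvelopingAlgebra k L)) = ⊤ := by
  have h : Set.range (ι k : L → UniversalEnvelopingAlgebra k L)
      = mkAlgHom k L '' Set.range (TensorAlgebra.ι k) := by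
    rw [← Set.range_comp]
    rfl
  rw [h, ← AlgHom.map_adjoin, TensorAlgebra.adjoin_range_ι, Algebra.map_top, AlgHom.range_eq_top]
  exact Quotient.mk_surjective

end UniversalEnvelopingAlgebra

namespace ClassicalFamily

variable {c : ClassicalFamily} {n : ℕ}

attribute [local instance] AlgFiltration.grRing

/-! ## The Poincaré–Birkhoff–Witt theorem -/

theorem exists_mem_filtX (x : ExtYangian c n) : ∃ d, x ∈ (filtX c n).toFun d := by
  have hx : x ∈ Algebra.adjoin ℂ (Set.range (gen c n)) := by
    rw [adjoin_gen]
    trivial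
  induction hx using Algebra.adjoin_induction with
  | mem x hx =>
    obtain ⟨g, rfl⟩ := hx
    exact ⟨_, gen_mem_filtX g⟩
  | algebraMap r =>
    rw [Algebra.algebraMap_eq_smul_one]
    exact ⟨0, Submodule.smul_mem _ _ (filtX c n).one_mem⟩
  | add x y _ _ h h' =>
    obtain ⟨d, hd⟩ := h
    obtain ⟨e, he⟩ := h'
    exact ⟨max d e, add_mem ((filtX c n).mono (le_max_left _ _) hd)
      ((filtX c n).mono (le_max_right _ _) he)⟩
  | mul x y _ _ h h' =>
    obtain ⟨d, hd⟩ := h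
    obtain ⟨e, he⟩ := h'
    exact ⟨d + e, (filtX c n).mul_mem hd he⟩

/-- The ordered monomials in `U(𝔞[x])`. -/
def curMonomial (_ : LinearOrder (PBWIdx c n)) (s : Multiset (PBWIdx c n)) :
    UniversalEnvelopingAlgebra ℂ (Current c n) :=
  (s.sort.map fun g => UniversalEnvelopingAlgebra.ι ℂ (cur g.i g.j g.m : Current c n)).prod

/-- The elementary half of the Poincaré–Birkhoff–Witt theorem; independence is obtained only from
the images in the graded algebra. -/
theorem span_curMonomial (o : LinearOrder (PBWIdx c n)) :
    Submodule.span ℂ (Set.range (curMonomial o)) = ⊤ := by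
  have hι : ∀ x : Current c n, UniversalEnvelopingAlgebra.ι ℂ x ∈ Submodule.span ℂ
      (Set.range fun g : PBWIdx c n =>
        UniversalEnvelopingAlgebra.ι ℂ (cur g.i g.j g.m : Current c n)) := fun x => by
    have hx : x ∈ Submodule.span ℂ
        (Set.range fun g : PBWIdx c n => (cur g.i g.j g.m : Current c n)) := by
      rw [span_cur_pbw]
      trivial
    have := Submodule.mem_map_of_mem
      (f := (UniversalEnvelopingAlgebra.ι ℂ : Current c n →ₗ⁅ℂ⁆ _).toLinearMap) hx
    rw [Submodule.map_span, ← Set.range_comp] at this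
    exact this
  refine span_ordered_eq_top o _ ?_ fun a b => ?_
  · rw [eq_top_iff, ← UniversalEnvelopingAlgebra.adjoin_range_ι, Algebra.adjoin_le_iff]
    rintro _ ⟨x, rfl⟩
    exact Algebra.span_le_adjoin ℂ _ (hι x)
  · rw [← Ring.lie_def, ← LieHom.map_lie]
    exact hι _

theorem exists_linearCombination_curMonomial (o : LinearOrder (PBWIdx c n))
    (u : UniversalEnvelopingAlgebra ℂ (Current c n)) :
    ∃ f, Finsupp.linearCombination ℂ (curMonomial o) f = u :=
  LinearMap.range_eq_top.1 ((Finsupp.range_linearCombination ℂ).trans (span_curMonomial o)) u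

variable (hn : 1 ≤ n) (hκ : kappa c n ≠ 0)

/-- The ordered monomials as elements of the Yangian. -/
def monomialY (_ : LinearOrder (PBWIdx c n)) (s : Multiset (PBWIdx c n)) : yangian c n :=
  (s.sort.map fun g => (tauY hn hκ g.i g.j g.m : yangian c n)).prod

theorem coe_monomialY (o : LinearOrder (PBWIdx c n)) (s : Multiset (PBWIdx c n)) :
    (monomialY hn hκ o s : ExtYangian c n) = monomial o s := by
  have := map_list_prod (yangian c n).val (s.sort.map fun g => (tauY hn hκ g.i g.j g.m : yangian c n))
  rw [List.map_map] at this
  exact this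

theorem monomialY_mem (o : LinearOrder (PBWIdx c n)) (s : Multiset (PBWIdx c n)) :
    monomialY hn hκ o s ∈ (filtY c n).toFun (weight s) := by
  have := (filtY c n).list_prod_mem
    (fun g : PBWIdx c n => (tauY hn hκ g.i g.j g.m : yangian c n))
    (fun g => g.m) (fun g => (tauY hn hκ g.i g.j g.m).2) s.sort
  rw [sum_map_sort o s] at this
  exact this

theorem envelopingHom_curMonomial (o : LinearOrder (PBWIdx c n)) (s : Multiset (PBWIdx c n)) :
    envelopingHom hn hκ (curMonomial o s)
      = (filtY c n).toGr (weight s) ⟨monomialY hn hκ o s, monomialY_mem hn hκ o s⟩ := by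
  rw [curMonomial, map_list_prod, List.map_map]
  have := (filtY c n).toGr_list_prod
    (fun g : PBWIdx c n => (tauY hn hκ g.i g.j g.m : yangian c n))
    (fun g => g.m) (fun g => (tauY hn hκ g.i g.j g.m).2) s.sort
  refine Eq.trans ?_ (this.trans ((filtY c n).toGr_congr (sum_map_sort o s) rfl))
  congr 1
  exact List.map_congr_left fun g _ => envelopingHom_cur hn hκ g.i g.j g.m

/-- The part of degree `d` of an ordered monomial. -/
def monomialPart (o : LinearOrder (PBWIdx c n)) (d : ℕ) (s : Multiset (PBWIdx c n)) :
    (filtY c n).toFun d :=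
  if h : weight s = d then ⟨monomialY hn hκ o s, h ▸ monomialY_mem hn hκ o s⟩ else 0

theorem component_envelopingHom (o : LinearOrder (PBWIdx c n)) (d : ℕ)
    (f : Multiset (PBWIdx c n) →₀ ℂ) :
    (filtY c n).component d (envelopingHom hn hκ (Finsupp.linearCombination ℂ (curMonomial o) f))
      = (filtY c n).symbol d (Finsupp.linearCombination ℂ (monomialPart hn hκ o d) f) := by
  induction f using Finsupp.induction_linear with
  | zero => rw [map_zero, map_zero, map_zero, map_zero, map_zero]
  | add f g hf hg => rw [map_add, map_add, map_add, hf, hg, map_add, map_add]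
  | single s r =>
    rw [Finsupp.linearCombination_single, Finsupp.linearCombination_single, map_smul,
      envelopingHom_curMonomial, ← (filtY c n).toGrHom_apply, ← map_smul,
      (filtY c n).toGrHom_apply]
    by_cases h : weight s = d
    · subst h
      rw [(filtY c n).component_toGr_same, monomialPart, dif_pos rfl]
    · rw [(filtY c n).component_toGr_of_ne h, monomialPart, dif_neg h, smul_zero, map_zero]

theorem coe_linearCombination_monomialPart (o : LinearOrder (PBWIdx c n)) (d : ℕ)
    (f : Multiset (PBWIdx c n) →₀ ℂ) :
    (((Finsupp.linearCombination ℂ (monomialPart hn hκ o d) f : (filtY c n).toFun d) :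
      yangian c n) : ExtYangian c n)
      = (f.filter fun s => weight s = d).sum fun s r => r • monomial o s := by
  induction f using Finsupp.induction_linear with
  | zero =>
    rw [map_zero, Finsupp.filter_zero, Finsupp.sum_zero_index]
    rfl
  | add f g hf hg =>
    rw [map_add, Finsupp.filter_add, Finsupp.sum_add_index' (fun s => zero_smul ℂ (monomial o s))
      (fun s r r' => add_smul r r' (monomial o s)), ← hf, ← hg]
    rfl
  | single s r =>
    rw [Finsupp.linearCombination_single]
    by_cases h : weight s = d
    · rw [Finsupp.filter_single_of_pos (fun s => weight s = d) h, Finsupp.sum_single_index (zero_smul ℂ (monomial o s)),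
        monomialPart, dif_pos h, ← coe_monomialY hn hκ o s]
      rfl
    · rw [Finsupp.filter_single_of_neg (fun s => weight s = d) h, Finsupp.sum_zero_index, monomialPart, dif_neg h,
        smul_zero]
      rfl

/-- An element of the kernel is a combination of ordered monomials. Each homogeneous component of
its image vanishes, so the combination of the corresponding monomials of degree `d` lies in lower
degree, and the independence modulo lower degree makes all its coefficients zero. -/
theorem envelopingHom_injective : Function.Injective (envelopingHom hn hκ : _ → (filtY c n).Gr) := by
  refine (injective_iff_map_eq_zero _).2 fun u hu => ?_
  -- The statement does not mention an ordering, so any will do.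
  obtain ⟨o⟩ : Nonempty (LinearOrder (PBWIdx c n)) := ⟨IsWellOrder.linearOrder WellOrderingRel⟩
  obtain ⟨f, rfl⟩ := exists_linearCombination_curMonomial o u
  suffices f = 0 by rw [this, map_zero]
  ext s
  have h1 := component_envelopingHom hn hκ o (weight s) f
  rw [hu, map_zero] at h1
  have h2 := (Submodule.Quotient.mk_eq_zero _).1 h1.symm
  have h3 := mem_below_filtY.1 (Submodule.mem_comap.1 h2)
  have h4 := weight_ne_of_sum_mem hn hκ o (f.filter fun t => weight t = weight s)
    (d := weight s) (fun t ht => by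
      rw [Finsupp.support_filter] at ht
      exact (Finset.mem_filter.1 ht).2.le) (coe_linearCombination_monomialPart hn hκ o (weight s) f ▸ h3) s
  by_contra h
  refine h4 ?_ rfl
  rw [Finsupp.support_filter]
  exact Finset.mem_filter.2 ⟨Finsupp.mem_support_iff.2 h, rfl⟩

/-- An element of degree at most `d` is a combination of monomials in the `τ_{ij}^{(r)}` of degree
at most `d`. The symbol of a monomial of degree exactly `d` is the product of the symbols of its
factors, and monomials of smaller degree have symbol zero. -/
theorem toGr_mem_range {d : ℕ} (a : (filtY c n).toFun d) :
    (filtY c n).toGr d a ∈ (envelopingHom hn hκ).range := by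
  -- The span lies in the extended Yangian, so the induction also carries a lift `b` to the filtered
  -- piece of the Yangian.
  have key : ∀ x ∈ Submodule.span ℂ {x | ∃ l : List (GenIdx c n), (l.map fun g => g.2.2).sum ≤ d ∧
      x = (l.map fun g => tauCoeff c n g.1 g.2.1 (g.2.2 + 1)).prod},
      ∃ b : (filtY c n).toFun d, ((b : yangian c n) : ExtYangian c n) = x ∧
        (filtY c n).toGrHom d b ∈ (envelopingHom hn hκ).range := by
    intro x hx
    induction hx using Submodule.span_induction with
    | zero => exact ⟨0, rfl, by rw [map_zero]; exact zero_mem _⟩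
    | add x y _ _ h h' =>
      obtain ⟨b, rfl, hb⟩ := h
      obtain ⟨b', rfl, hb'⟩ := h'
      exact ⟨b + b', rfl, by rw [map_add]; exact add_mem hb hb'⟩
    | smul r x _ h =>
      obtain ⟨b, rfl, hb⟩ := h
      exact ⟨r • b, rfl, by rw [map_smul]; exact Subalgebra.smul_mem _ hb r⟩
    | mem x hx =>
      obtain ⟨l, hl, rfl⟩ := hx
      let t : GenIdx c n → yangian c n := fun g => tauY hn hκ g.1 g.2.1 g.2.2
      have ht : ∀ g, t g ∈ (filtY c n).toFun g.2.2 := fun g => (tauY hn hκ g.1 g.2.1 g.2.2).2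
      have hmem := (filtY c n).list_prod_mem t (fun g => g.2.2) ht l
      have hcoe : (((l.map t).prod : yangian c n) : ExtYangian c n)
          = (l.map fun g => tauCoeff c n g.1 g.2.1 (g.2.2 + 1)).prod := by
        have := map_list_prod (yangian c n).val (l.map t)
        rw [List.map_map] at this
        exact this
      refine ⟨⟨(l.map t).prod, (filtY c n).mono hl hmem⟩, hcoe, ?_⟩
      rw [AlgFiltration.toGrHom_apply]
      rcases hl.eq_or_lt with h | h
      · rw [← (filtY c n).toGr_congr h (a := ⟨(l.map t).prod, hmem⟩) rfl,
          ← (filtY c n).toGr_list_prod t (fun g => g.2.2) ht l]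
        refine list_prod_mem fun y hy => ?_
        obtain ⟨g, _, rfl⟩ := List.mem_map.1 hy
        exact ⟨_, envelopingHom_cur hn hκ g.1 g.2.1 g.2.2⟩
      · have : (filtY c n).toGr d ⟨(l.map t).prod, (filtY c n).mono hl hmem⟩ = 0 := by
          rw [AlgFiltration.toGr_eq_zero_iff]
          obtain ⟨e, rfl⟩ : ∃ e, d = e + 1 := ⟨d - 1, by omega⟩
          exact (filtY c n).mono (Nat.lt_succ_iff.1 h) hmem
        rw [this]
        exact zero_mem _
  obtain ⟨b, hb, h⟩ := key _ (mem_span_tau hn hκ (a : yangian c n).2 a.2)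
  have : b = a := Subtype.ext (Subtype.ext hb)
  rwa [this] at h

theorem envelopingHom_surjective :
    Function.Surjective (envelopingHom hn hκ : _ → (filtY c n).Gr) := by
  intro x
  change x ∈ (envelopingHom hn hκ).range
  exact (filtY c n).induction_on_gr x (zero_mem _) (fun d a => toGr_mem_range hn hκ a)
    fun x y => add_mem

/-- The isomorphism `U(𝔞[x]) ≃ gr Y(𝔞)`. -/
def envelopingEquiv : UniversalEnvelopingAlgebra ℂ (Current c n) ≃ₐ[ℂ] (filtY c n).Gr :=
  AlgEquiv.ofBijective (envelopingHom hn hκ)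
    ⟨envelopingHom_injective hn hκ, envelopingHom_surjective hn hκ⟩

theorem linearIndependent_monomialY (o : LinearOrder (PBWIdx c n)) :
    LinearIndependent ℂ (monomialY hn hκ o) := by
  rw [linearIndependent_iff]
  intro f hf
  by_contra h
  -- A vanishing combination lies below its top degree, which contradicts the independence there.
  obtain ⟨s, hs, hmax⟩ := f.support.exists_max_image weight (Finsupp.support_nonempty_iff.2 h)
  refine weight_ne_of_sum_mem hn hκ o f (d := weight s) hmax ?_ s hs rfl
  have := congrArg (yangian c n).val hf
  rw [Finsupp.linearCombination_apply, map_finsuppSum, map_zero] at this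
  simp only [map_smul, Subalgebra.coe_val, coe_monomialY] at this
  rw [this]
  exact zero_mem _

/-- By surjectivity onto the graded algebra some combination of ordered monomials of degree `d` has
the same symbol as `a`. The difference has lower degree, and the induction on `d` applies. -/
theorem mem_span_monomialY (o : LinearOrder (PBWIdx c n)) (d : ℕ) (a : yangian c n)
    (ha : a ∈ (filtY c n).toFun d) :
    a ∈ Submodule.span ℂ (Set.range (monomialY hn hκ o)) := by
  have step : ∀ d (a : (filtY c n).toFun d), ∃ b ∈ Submodule.span ℂ (Set.range (monomialY hn hκ o)),
      (a : yangian c n) - b ∈ (filtY c n).below d := by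
    intro d a
    obtain ⟨u, hu⟩ := envelopingHom_surjective hn hκ ((filtY c n).toGr d a)
    obtain ⟨f, rfl⟩ := exists_linearCombination_curMonomial o u
    have h1 := component_envelopingHom hn hκ o d f
    rw [hu, AlgFiltration.component_toGr_same] at h1
    refine ⟨(Finsupp.linearCombination ℂ (monomialPart hn hκ o d) f : (filtY c n).toFun d), ?_,
      Submodule.mem_comap.1 ((Submodule.Quotient.eq _).1 h1)⟩
    rw [Finsupp.linearCombination_apply, Finsupp.sum, AddSubmonoidClass.coe_finsetSum]
    refine sum_mem fun s _ => Submodule.smul_mem _ (f s) ?_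
    rw [monomialPart]
    split_ifs
    · exact Submodule.subset_span ⟨s, rfl⟩
    · exact zero_mem _
  induction d generalizing a with
  | zero =>
    obtain ⟨b, hb, h⟩ := step 0 ⟨a, ha⟩
    rwa [← sub_eq_zero.1 ((Submodule.mem_bot ℂ).1 h)] at hb
  | succ d ih =>
    obtain ⟨b, hb, h⟩ := step (d + 1) ⟨a, ha⟩
    have := add_mem (ih _ h) hb
    rwa [sub_add_cancel] at this

/-- The basis of the Yangian formed by the ordered monomials. -/
def pbwBasis (o : LinearOrder (PBWIdx c n)) : Module.Basis (Multiset (PBWIdx c n)) ℂ (yangian c n) :=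
  Module.Basis.mk (linearIndependent_monomialY hn hκ o) fun a _ => by
    obtain ⟨d, hd⟩ := exists_mem_filtX (a : ExtYangian c n)
    exact mem_span_monomialY hn hκ o d a hd

theorem coe_pbwBasis (o : LinearOrder (PBWIdx c n)) (s : Multiset (PBWIdx c n)) :
    (pbwBasis hn hκ o s : ExtYangian c n) = monomial o s := by
  rw [pbwBasis, Module.Basis.mk_apply, coe_monomialY]

end ClassicalFamily

end

theorem theorem3p6 (c : ClassicalFamily) (n : ℕ) (hn : 1 ≤ n) (hD : c = .D → 2 ≤ n) :
    (c.TtShift n * c.T n = Matrix.scalar (c.Idx n) (c.z n) ∧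
      c.T n * c.TtShift n = Matrix.scalar (c.Idx n) (c.z n)) ∧
    ∃ (hY : ∀ (i j : c.Idx n) (m : ℕ), c.tauCoeff n i j (m + 1) ∈ c.yangian n)
      (hdeg : ∀ (i j : c.Idx n) (m : ℕ),
        (⟨c.tauCoeff n i j (m + 1), hY i j m⟩ : c.yangian n) ∈ (c.filtY n).toFun m),
      (∃ ψ : UniversalEnvelopingAlgebra ℂ (c.Current n) ≃ₐ[ℂ] (c.filtY n).Gr,
        ∀ (i j : c.Idx n) (m : ℕ),
          ψ (UniversalEnvelopingAlgebra.ι ℂ ((Polynomial.X ^ m : Polynomial ℂ) ⊗ₜ[ℂ] c.F n i j)) =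
            (c.filtY n).toGr m ⟨_, hdeg i j m⟩) ∧
      ∀ _ : LinearOrder (c.PBWIdx n),
        ∃ b : Module.Basis (Multiset (c.PBWIdx n)) ℂ (c.yangian n),
          ∀ s : Multiset (c.PBWIdx n),
            (b s : c.ExtYangian n) =
              (s.sort.map fun g => c.tauCoeff n g.i g.j (g.m + 1)).prod :=
  have hκ := ClassicalFamily.kappa_ne_zero hn hD
  ⟨ClassicalFamily.isRTT_T.transShift_mul hn hκ,
    fun i j m => ClassicalFamily.tauCoeff_mem_yangian hn i j (m + 1),
    fun i j m => ClassicalFamily.tauCoeff_mem_filtX hn hκ i j m,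
    ⟨ClassicalFamily.envelopingEquiv hn hκ, ClassicalFamily.envelopingHom_cur hn hκ⟩,
    fun o => ⟨ClassicalFamily.pbwBasis hn hκ o, ClassicalFamily.coe_pbwBasis hn hκ o⟩⟩
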